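/- **Definitions.** A *flat cell* in $\mathbb{R}^d$ is a closed polyhedron $C$ (near each of its points $x$ the set $C$ is a cone with apex $x$), not necessarily convex or bounded, whose relative interior $\operatorname{relint} C$ (interior in the affine span) is connected and is connected near every point of $C$, i.e. $B(x,\varepsilon)\cap\operatorname{relint} C$ is connected and non-empty for every $x\in C$ and all small $\varepsilon>0$. (Convex polyhedra and flat polyhedral balls are examples.) Its dimension is that of its affine span. A *cell-decomposition* $\Delta$ of a polyhedral region in $\mathbb{R}^d$ is a family of flat cells, with union $|\Delta|$ (the region), such that: every point of $|\Delta|$ has a neighbourhood that meets only finitely many cells; the relative interiors of different cells are disjoint; the relative boundary of each cell is the union of the cells properly contained in it; every cell is contained in a $d$-cell; and no dihedral angle is equal to $\pi$ at an internal cell, that is, if two different cells $F,F'\subseteq C$ of dimension $\dim C-1$ contain a common internal cell of dimension $\dim C-2$, then $F$ and $F'$ have different affine spans. A cell $C$ is *internal* if $\operatorname{relint} C$ lies in the interior of $|\Delta|$. Let $w$ be one of the following two weights on cells: either $w(C)=1$ for all $C$, or, if all cells are bounded, $w(C)=\operatorname{vol}_{\dim C}(C)$. For a cell $C$ and a cell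 $F\subset C$ with $\dim F=\dim C-1$, let $\mathbf n(F,C)$ be the inner unit normal to $C$ at $F$. A *$k$-stress* is a real function $s$ on the $(k-1)$-cells of $\Delta$ with $$\sum_{C\supset F,\ \dim C=k-1} s(C)\,w(C)\,\mathbf n(F,C)=0$$ for every internal $(k-2)$-cell $F$ (for $k=1$ there is no condition). A *$k$-tension* is a $k$-stress with non-negative coefficients; the $k$-tensions form a cone $\mathrm{Tension}_k(\Delta)$. A $k$-tension is *all-nonzero* if none of its coefficients vanishes. Given a $d$-tension $s$ and an internal cell $G$, a *reciprocal* of the star of $G$ with edges $s$ is a choice of points $r(A)\in\mathbb{R}^d$ for the $d$-cells $A\supseteq G$ such that $r(B)-r(A)=s(F)w(F)\,\mathbf n(F,B)$ whenever $A\ne B$ contain a common $(d-1)$-cell $F\supseteq G$. For a cell $C\supseteq G$ put $D_r(C)=\operatorname{conv}\{r(A): A\supseteq C,\ \dim A=d\}$. The polytope $D_r(G)$ is called a *dual convex polytope* of the star of $G$ if $C\mapsto D_r(C)$ is an inclusion-reversing bijection (with inclusion-reversing inverse) from the cells $C\supseteq G$ of $\Delta$ to the non-empty faces of $D_r(G)$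 (including $D_r(G)$ itself), with $\dim D_r(C)=d-\dim C$ and $D_r(C)$ perpendicular to $C$. **Proposition 5.2.** Let $\Delta$ be a cell-decomposition of a polyhedral region in $\mathbb{R}^d$, let $w$ be one of the two weights above, and let $1\le k\le d-1$. There is a map $p$, from functions on the $(d-1)$-cells to functions on the $(k-1)$-cells, each coordinate $p(\cdot)(C)$ of which is a homogeneous polynomial of degree $d-k+1$ in finitely many of the coefficients, such that: 1. $p$ maps $\mathrm{Tension}_d(\Delta)$ into $\mathrm{Tension}_k(\Delta)$; 2. if a $d$-tension $s$ is all-nonzero, then so is the $k$-tension $p(s)$; 3. for every $d$-tension $s$ and every internal cell $G$ (in particular every internal vertex) there is a reciprocal $r$ of the star of $G$ with edges $s$, and for each such $r$: - if $s(F)\neq0$ for all $(d-1)$-cells $F\supseteq G$, then $D_r(G)$ is a dual convex polytope of the star of $G$; - $p(s)(C)\,w(C)=\operatorname{vol}_{d-k+1}\bigl(D_r(C)\bigr)$ for every $(k-1)$-cell $C\supseteq G$, i.e. $p(s)$ is given by the volumes of the faces of the dual polytopes. -/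

import Mathlib

open Set Filter Topology MeasureTheory

noncomputable section

/-- Euclidean `d`-space. -/
abbrev Euc (d : ℕ) : Type := EuclideanSpace ℝ (Fin d)

/-- The dimension of (the affine span of) a subset of Euclidean space. -/
def flatDim {d : ℕ} (S : Set (Euc d)) : ℕ := Module.finrank ℝ (vectorSpan ℝ S)

/-- The `m`-dimensional Euclidean volume of a subset of Euclidean space (the `m`-dimensional
Hausdorff measure, normalised so that it is Lebesgue measure on every `m`-flat). -/
def flatVol {d : ℕ} (m : ℕ) (S : Set (Euc d)) : ℝ :=
  (μHE[m] : Measure (Euc d)).real S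

/-- A flat polyhedral cell, not necessarily convex and not necessarily bounded: a closed set that
is a polyhedron (each of its points has a neighbourhood in which the set is a cone with that point
as apex), whose relative interior is connected, and is also connected near every
point of the cell (the boundary does not pinch the cell). All convex polyhedra, and all flat
polyhedra that are manifolds with boundary and have connected interior, e.g. polyhedral balls,
satisfy this. -/
structure IsFlatCell {d : ℕ} (C : Set (Euc d)) : Prop where
  isClosed : IsClosed C
  polyhedral : ∀ x ∈ C, ∃ ε > 0, ∀ y ∈ Metric.ball x ε, ∀ t ∈ Ioc (0 : ℝ) 1,
    (x + t • (y - x) ∈ C ↔ y ∈ C)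
  connected : IsConnected (intrinsicInterior ℝ C)
  locallyConnected : ∀ x ∈ C, ∀ᶠ ε in 𝓝[>] (0 : ℝ),
    IsConnected (Metric.ball x ε ∩ intrinsicInterior ℝ C)

/-- The region covered by a family of cells. -/
def region {d : ℕ} (cells : Set (Set (Euc d))) : Set (Euc d) := ⋃₀ cells

/-- A cell is internal if it does not lie in the boundary of the region. -/
def IsInternalIn {d : ℕ} (cells : Set (Set (Euc d))) (C : Set (Euc d)) : Prop :=
  intrinsicInterior ℝ C ⊆ interior (region cells)

/-- A (locally finite, possibly infinite) cell-decomposition of a `d`-dimensional polyhedral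
region of `ℝ^d` into flat polyhedral cells. The region need not be all of `ℝ^d`. -/
structure CellDecomposition (d : ℕ) where
  /-- The closed cells, of all dimensions. -/
  cells : Set (Set (Euc d))
  isFlatCell : ∀ C ∈ cells, IsFlatCell C
  locallyFinite : ∀ x ∈ region cells, ∃ U ∈ 𝓝 x, {C ∈ cells | (C ∩ U).Nonempty}.Finite
  /-- The open cells are pairwise disjoint. -/
  disjoint : ∀ C ∈ cells, ∀ C' ∈ cells, C ≠ C' →
    Disjoint (intrinsicInterior ℝ C) (intrinsicInterior ℝ C')
  /-- The boundary of a cell is the union of the cells properly contained in it. -/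
  boundary : ∀ C ∈ cells, intrinsicFrontier ℝ C = ⋃₀ {D ∈ cells | D ⊂ C}
  /-- Every cell is a face of a `d`-cell. -/
  pure : ∀ C ∈ cells, ∃ A ∈ cells, flatDim A = d ∧ C ⊆ A
  /-- The subcells of codimension one in a cell are its genuine facets: at an internal cell, no two
  of them continue each other inside one flat (no dihedral angle is equal to `π`). -/
  genuine : ∀ C ∈ cells, ∀ F ∈ cells, ∀ F' ∈ cells, ∀ G ∈ cells, IsInternalIn cells G →
    F ⊆ C → F' ⊆ C → G ⊆ F → G ⊆ F' →
    flatDim F + 1 = flatDim C → flatDim F' + 1 = flatDim C → flatDim G + 2 = flatDim C →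
    F ≠ F' → affineSpan ℝ F ≠ affineSpan ℝ F'

/-- `u` is the inner unit normal to the cell `C` at its facet `F`: the unit vector parallel to `C`
and perpendicular to `F` that points from `F` into `C`. -/
structure IsInnerNormal {d : ℕ} (F C : Set (Euc d)) (u : Euc d) : Prop where
  norm_eq : ‖u‖ = 1
  mem : u ∈ vectorSpan ℝ C
  perp : ∀ a ∈ vectorSpan ℝ F, inner ℝ a u = 0
  inward : ∀ y ∈ intrinsicInterior ℝ F, ∀ᶠ t in 𝓝[>] (0 : ℝ), y + t • u ∈ C

open Classical in
/-- The inner unit normal to the cell `C` at its facet `F`. -/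
def innerNormal {d : ℕ} (F C : Set (Euc d)) : Euc d :=
  if h : ∃ u, IsInnerNormal F C u then h.choose else 0

namespace CellDecomposition

variable {d : ℕ} (Δ : CellDecomposition d)

/-- A cell is internal if it does not lie in the boundary of the region. -/
def IsInternal (C : Set (Euc d)) : Prop := IsInternalIn Δ.cells C

/-- The `(k-1)`-dimensional cells: these carry the coefficients of `k`-stresses. -/
def StressCell (k : ℕ) : Type := {C : Set (Euc d) // C ∈ Δ.cells ∧ flatDim C + 1 = k}

/-- The `d`-dimensional cells. -/
def TopCell : Type := {A : Set (Euc d) // A ∈ Δ.cells ∧ flatDim A = d}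

/-- The two conventions for the weight of a cell in the equilibrium condition: the volumes of the
cells are left out (the only possibility if there are unbounded cells), or all the cells are
bounded and the weight of a cell is its volume. -/
def IsWeight (w : Set (Euc d) → ℝ) : Prop :=
  (∀ C, w C = 1) ∨
    ((∀ C ∈ Δ.cells, Bornology.IsBounded C) ∧ ∀ C, w C = flatVol (flatDim C) C)

/-- A `k`-stress is a real function on the `(k-1)`-cells that is in equilibrium at every internal
`(k-2)`-cell `F`: the sum of `s(C) w(C) n(F, C)` over the `(k-1)`-cells `C` that contain `F`
vanishes. The sum is finite. For `k = 1` there are no conditions. -/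
def IsStress (w : Set (Euc d) → ℝ) (k : ℕ) (s : Δ.StressCell k → ℝ) : Prop :=
  ∀ F ∈ Δ.cells, flatDim F + 2 = k → Δ.IsInternal F →
    ∑ᶠ (C : Δ.StressCell k) (_ : F ⊆ C.1), (s C * w C.1) • innerNormal F C.1 = 0

/-- The cone of `k`-tensions: the `k`-stresses with non-negative coefficients. -/
def tensionCone (w : Set (Euc d) → ℝ) (k : ℕ) : Set (Δ.StressCell k → ℝ) :=
  {s | Δ.IsStress w k s ∧ ∀ C, 0 ≤ s C}

/-- The polynomial map whose coordinates are given by the polynomials `p C`. -/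
def polyMap {Δ : CellDecomposition d} {j k : ℕ}
    (p : Δ.StressCell k → MvPolynomial (Δ.StressCell j) ℝ) (s : Δ.StressCell j → ℝ) :
    Δ.StressCell k → ℝ :=
  fun C => MvPolynomial.eval s (p C)

/-- `r` is a reciprocal of the star of the cell `G` with edges given by the function `s` on the
facets: it assigns to each `d`-cell of the star a point, so that for each two different `d`-cells
`A`, `B` with common facet `F` in the star, the edge from `r A` to `r B` is `s(F) w(F)` times the
outer unit normal to `A` (the inner one to `B`) at `F`. For `s` positive this is a convex
reciprocal. -/
def IsReciprocal (w : Set (Euc d) → ℝ) (s : Δ.StressCell d → ℝ) (G : Set (Euc d))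
    (r : Δ.TopCell → Euc d) : Prop :=
  ∀ (F : Δ.StressCell d) (A B : Δ.TopCell), G ⊆ F.1 → F.1 ⊆ A.1 → F.1 ⊆ B.1 → A ≠ B →
    r B - r A = (s F * w F.1) • innerNormal F.1 B.1

/-- The polytope spanned by the points of the reciprocal that belong to the `d`-cells around `C`. -/
def dualFace {Δ : CellDecomposition d} (r : Δ.TopCell → Euc d) (C : Set (Euc d)) : Set (Euc d) :=
  convexHull ℝ (r '' {A | C ⊆ A.1})

/-- The polytope `D = dualFace r G` spanned by the points `r A` is a dual convex polytope of the
star of `G`: `C ↦ dualFace r C` is an inclusion-reversing bijection from the cells of the star to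
the non-empty faces of `D`, it takes `c`-cells to `(d-c)`-faces, and each face is perpendicular to
the cell it corresponds to. -/
structure IsDualPolytope (G : Set (Euc d)) (r : Δ.TopCell → Euc d) : Prop where
  bijOn : Set.BijOn (dualFace r) {C | C ∈ Δ.cells ∧ G ⊆ C}
    {P | P.Nonempty ∧ IsExposed ℝ (dualFace r G) P}
  subset_iff : ∀ C ∈ Δ.cells, ∀ C' ∈ Δ.cells, G ⊆ C → G ⊆ C' →
    (C ⊆ C' ↔ dualFace r C' ⊆ dualFace r C)
  dim_add : ∀ C ∈ Δ.cells, G ⊆ C → flatDim (dualFace r C) + flatDim C = d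
  perp : ∀ C ∈ Δ.cells, G ⊆ C → ∀ a ∈ vectorSpan ℝ (dualFace r C), ∀ b ∈ vectorSpan ℝ C,
    inner ℝ a b = 0

end CellDecomposition

end

/-! Around an internal cell `G`, a reciprocal `r` is the list of gradients of a piecewise linear
function on the star of `G` whose bend across a facet `F` is `s F * w F`. Equilibrium of `s` at the
cells of codimension two is exactly what makes such a function exist, and non-negative bends make it
convex. All statements are read off from this function and its dual polytope.

Existence (`exists_isReciprocal`): from a generic base point `o` near a point `y` of the open cell,
the gradient at `x` is the sum of the jumps `s F * w F` times normal over the facets met by the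
segment from `o` to `x`. As `x` moves inside one open `d`-cell, this segment can be kept away from
cells of codimension three; passing over a cell of codimension two does not change the sum, since
the equilibrium condition there, turned by a right angle, says so (`exists_nhds_sum_jump_eq`).

Convexity: walking along a generic segment that ends near `x`, each crossing increases the value of
the current linear piece at the end (`exists_walk`, `inner_reciprocal_le`). Hence the pieces of the
cells containing `x` are the maximal ones, and the face of `dualFace r G` in direction `x - y` is
`dualFace r K`, with `K` the cell whose relative interior contains `x` (`face_eq_dualFace`). If `s`
is positive around `G`, then `r` is injective on the star, and each cell `C` spans the whole
orthogonal complement of its dual face (`lin_eq_dualPerp`); here dihedral angles `π` have to be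
excluded. Dimensions and the bijection between cells and faces follow.

Volumes: the facets of `dualFace r C` are dual to the cells of one dimension more, with normals
`innerNormal C C'`. Cutting the polytope into pyramids over its facets expresses its volume by
support numbers, which are linear in `s`, and volumes of facets; recursion gives homogeneous
polynomials (`exists_poly_flatVol`). Since the volume does not depend on the apex of the pyramids,
Minkowski's relation holds: facet volumes times unit normals sum to zero (`polytope_facets`). For
`dualFace r F` this is the equilibrium of the new stress at `F`. Cells that are not internal enter
no equilibrium condition, so any monomial of the right degree serves there. -/

noncomputable section

/-! ### Relative interiors in metric terms -/

lemma mem_relint_iff {d : ℕ} {C : Set (Euc d)} {x : Euc d} :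
    x ∈ intrinsicInterior ℝ C ↔
      x ∈ C ∧ ∃ ε > 0, ∀ v ∈ vectorSpan ℝ C, ‖v‖ < ε → x + v ∈ C := by
  rw [mem_intrinsicInterior]
  constructor
  · rintro ⟨y, hy, rfl⟩
    refine ⟨(interior_subset hy : y ∈ Subtype.val ⁻¹' C), ?_⟩
    rw [mem_interior_iff_mem_nhds, Metric.mem_nhds_iff] at hy
    obtain ⟨ε, hε, h⟩ := hy
    refine ⟨ε, hε, fun v hv hvε => ?_⟩
    have hv' : v ∈ (affineSpan ℝ C).direction := by rwa [direction_affineSpan]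
    have hm : (y : Euc d) + v ∈ affineSpan ℝ C := by
      have := AffineSubspace.vadd_mem_of_mem_direction hv' y.2
      rwa [vadd_eq_add, add_comm] at this
    have := @h ⟨y + v, hm⟩ (by
      rw [Metric.mem_ball, Subtype.dist_eq]; simpa [dist_eq_norm] using hvε)
    exact this
  · rintro ⟨hx, ε, hε, h⟩
    refine ⟨⟨x, subset_affineSpan ℝ C hx⟩, ?_, rfl⟩
    rw [mem_interior_iff_mem_nhds, Metric.mem_nhds_iff]
    refine ⟨ε, hε, fun z hz => ?_⟩
    have hv : (z : Euc d) - x ∈ vectorSpan ℝ C := by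
      rw [← direction_affineSpan]
      exact AffineSubspace.vsub_mem_direction z.2 (subset_affineSpan ℝ C hx)
    have := h _ hv (by rw [Metric.mem_ball, Subtype.dist_eq, dist_eq_norm] at hz; exact hz)
    simpa using this

lemma relint_subset {d : ℕ} {C : Set (Euc d)} : intrinsicInterior ℝ C ⊆ C :=
  intrinsicInterior_subset

lemma sub_mem_lin {d : ℕ} {C : Set (Euc d)} {x y : Euc d} (hx : x ∈ C) (hy : y ∈ C) :
    x - y ∈ vectorSpan ℝ C := by
  simpa using vsub_mem_vectorSpan ℝ hx hy

/-- The relative interior is relatively open. -/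
lemma relint_open {d : ℕ} {C : Set (Euc d)} {x : Euc d} (hx : x ∈ intrinsicInterior ℝ C) :
    ∃ ε > 0, ∀ v ∈ vectorSpan ℝ C, ‖v‖ < ε → x + v ∈ intrinsicInterior ℝ C := by
  obtain ⟨hxC, ε, hε, h⟩ := mem_relint_iff.1 hx
  refine ⟨ε / 2, by linarith, fun v hv hvε => mem_relint_iff.2 ⟨h v hv (by linarith), ε / 2,
    by linarith, fun v' hv' hv'ε => ?_⟩⟩
  rw [add_assoc]
  exact h _ (Submodule.add_mem _ hv hv') ((norm_add_le _ _).trans_lt (by linarith))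

/-- A preconnected subset of the flat of a closed set `C` that does not meet the relative boundary
of `C` lies in `C` if it meets `C`. -/
lemma subset_of_isPreconnected {d : ℕ} {C T : Set (Euc d)} (hcl : IsClosed C)
    (hT : IsPreconnected T) (haff : ∀ p ∈ T, ∀ q ∈ C, p - q ∈ vectorSpan ℝ C)
    (hrel : ∀ p ∈ T, p ∈ C → p ∈ intrinsicInterior ℝ C) {p : Euc d} (hp : p ∈ T) (hpC : p ∈ C) :
    T ⊆ C := by
  by_contra hcon
  obtain ⟨p', hp', hp'C⟩ := Set.not_subset.1 hcon
  -- `O` thickens the relative interior to an open set of the whole space. A point of `O` in the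
  -- flat of `C` lies in `C`, so `O` and the complement of `C` would separate `T`.
  let O : Set (Euc d) := ⋃ p ∈ intrinsicInterior ℝ C, ⋃ δ ∈ {δ : ℝ | ∀ w ∈ vectorSpan ℝ C,
    ‖w‖ < δ → p + w ∈ intrinsicInterior ℝ C}, Metric.ball p δ
  have hO : IsOpen O := isOpen_biUnion fun p _ => isOpen_biUnion fun δ _ => Metric.isOpen_ball
  have hmemO : ∀ p ∈ intrinsicInterior ℝ C, p ∈ O := by
    intro p hp
    obtain ⟨δ, hδ, h⟩ := relint_open hp
    simp only [O, mem_iUnion]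
    exact ⟨p, hp, δ, h, Metric.mem_ball_self hδ⟩
  obtain ⟨q, hq, hq1, hq2⟩ := hT O Cᶜ hO hcl.isOpen_compl
    (fun q hq => by
      by_cases hqC : q ∈ C
      · exact Or.inl (hmemO q (hrel q hq hqC))
      · exact Or.inr hqC)
    ⟨p, hp, hmemO p (hrel p hp hpC)⟩ ⟨p', hp', hp'C⟩
  simp only [O, mem_iUnion] at hq1
  obtain ⟨q', hq', δ, h, hqq'⟩ := hq1
  have := h _ (haff q hq q' (relint_subset hq')) (by rwa [mem_ball_iff_norm] at hqq')
  exact hq2 (by simpa using relint_subset this)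

lemma interior_eq_relint {d : ℕ} {C : Set (Euc d)} (h : vectorSpan ℝ C = ⊤) :
    intrinsicInterior ℝ C = interior C := by
  ext x
  rw [mem_relint_iff, mem_interior_iff_mem_nhds, Metric.mem_nhds_iff]
  constructor
  · rintro ⟨_, ε, hε, H⟩
    refine ⟨ε, hε, fun z hz => ?_⟩
    have := H (z - x) (by simp [h]) (by rwa [mem_ball_iff_norm] at hz)
    simpa using this
  · rintro ⟨ε, hε, H⟩
    refine ⟨H (Metric.mem_ball_self hε), ε, hε, fun v _ hv => H ?_⟩
    simpa [mem_ball_iff_norm] using hv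

lemma IsFlatCell.exists_relint_near {d : ℕ} {C : Set (Euc d)} (h : IsFlatCell C) {x : Euc d}
    (hx : x ∈ C) {ε : ℝ} (hε : 0 < ε) : ∃ z ∈ intrinsicInterior ℝ C, dist z x < ε := by
  have h1 := (h.locallyConnected x hx).and
    (Ioo_mem_nhdsGT hε : Ioo 0 ε ∈ 𝓝[>] (0 : ℝ))
  obtain ⟨δ, hδ, hδ'⟩ := h1.exists
  obtain ⟨z, hz, hz'⟩ := hδ.nonempty
  exact ⟨z, hz', (Metric.mem_ball.1 hz).trans hδ'.2⟩

lemma vectorSpan_eq_top_iff_flatDim {d : ℕ} {C : Set (Euc d)} :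
    vectorSpan ℝ C = ⊤ ↔ flatDim C = d := by
  unfold flatDim
  constructor
  · intro h; rw [h]; simp
  · intro h; exact Submodule.eq_top_of_finrank_eq (by simpa using h)

lemma flatDim_le {d : ℕ} (C : Set (Euc d)) : flatDim C ≤ d := by
  unfold flatDim
  simpa using Submodule.finrank_le (vectorSpan ℝ C)

/-! ### Carriers of points and small neighbourhoods in a decomposition -/

namespace CellDecomposition

variable {d : ℕ} {Δ : CellDecomposition d}

lemma nonempty_relint {C : Set (Euc d)} (hC : C ∈ Δ.cells) : (intrinsicInterior ℝ C).Nonempty :=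
  (Δ.isFlatCell C hC).connected.nonempty

lemma nonempty_cell {C : Set (Euc d)} (hC : C ∈ Δ.cells) : C.Nonempty :=
  (nonempty_relint hC).mono relint_subset

lemma mem_region {C : Set (Euc d)} (hC : C ∈ Δ.cells) {x : Euc d} (hx : x ∈ C) :
    x ∈ region Δ.cells := ⟨C, hC, hx⟩

/-- The relative boundary of a cell is the rest of the cell. -/
lemma not_relint_iff {C : Set (Euc d)} (hC : C ∈ Δ.cells) {x : Euc d} (hx : x ∈ C) :
    x ∉ intrinsicInterior ℝ C ↔ ∃ D ∈ Δ.cells, D ⊂ C ∧ x ∈ D := by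
  have h1 : intrinsicFrontier ℝ C = C \ intrinsicInterior ℝ C := by
    rw [← intrinsicClosure_sdiff_intrinsicInterior, IsClosed.intrinsicClosure]
    exact (Δ.isFlatCell C hC).isClosed.preimage continuous_subtype_val
  have h2 := Δ.boundary C hC
  rw [h1] at h2
  constructor
  · intro h
    have : x ∈ C \ intrinsicInterior ℝ C := ⟨hx, h⟩
    rw [h2] at this
    obtain ⟨D, ⟨hD, hDC⟩, hxD⟩ := this
    exact ⟨D, hD, hDC, hxD⟩
  · rintro ⟨D, hD, hDC, hxD⟩
    have : x ∈ C \ intrinsicInterior ℝ C := by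
      rw [h2]; exact ⟨D, ⟨hD, hDC⟩, hxD⟩
    exact this.2

lemma finite_cells_at (x : Euc d) : {C ∈ Δ.cells | x ∈ C}.Finite := by
  by_cases hx : x ∈ region Δ.cells
  · obtain ⟨U, hU, hf⟩ := Δ.locallyFinite x hx
    exact hf.subset fun C hC => ⟨hC.1, x, hC.2, mem_of_mem_nhds hU⟩
  · convert Set.finite_empty
    ext C; simp only [mem_ofPred_eq, mem_empty_iff_false, iff_false]
    exact fun h => hx (mem_region h.1 h.2)

/-- Each point of a cell lies in the relative interior of a subcell. -/
lemma exists_carrier {C : Set (Euc d)} (hC : C ∈ Δ.cells) {x : Euc d} (hx : x ∈ C) :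
    ∃ K ∈ Δ.cells, K ⊆ C ∧ x ∈ intrinsicInterior ℝ K := by
  have hf : {K ∈ Δ.cells | x ∈ K ∧ K ⊆ C}.Finite :=
    (finite_cells_at x).subset fun K hK => ⟨hK.1, hK.2.1⟩
  -- A minimal cell containing `x`: if `x` were on its relative boundary, a smaller cell would
  -- contain it.
  obtain ⟨K, hK⟩ := hf.exists_minimal ⟨C, hC, hx, Subset.rfl⟩
  refine ⟨K, hK.prop.1, hK.prop.2.2, ?_⟩
  by_contra h
  obtain ⟨D, hD, hDK, hxD⟩ := (not_relint_iff hK.prop.1 hK.prop.2.1).1 h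
  exact hDK.2 (hK.le_of_le ⟨hD, hxD, hDK.1.trans hK.prop.2.2⟩ hDK.1)

lemma carrier_unique {K K' : Set (Euc d)} (hK : K ∈ Δ.cells) (hK' : K' ∈ Δ.cells) {x : Euc d}
    (hx : x ∈ intrinsicInterior ℝ K) (hx' : x ∈ intrinsicInterior ℝ K') : K = K' := by
  by_contra h
  exact Set.disjoint_left.1 (Δ.disjoint K hK K' hK' h) hx hx'

lemma carrier_subset {K C : Set (Euc d)} (hK : K ∈ Δ.cells) (hC : C ∈ Δ.cells) {x : Euc d}
    (hx : x ∈ intrinsicInterior ℝ K) (hxC : x ∈ C) : K ⊆ C := by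
  obtain ⟨K', hK', hK'C, hx'⟩ := exists_carrier hC hxC
  rwa [carrier_unique hK hK' hx hx']

/-- A small ball around a point of the region meets only cells that contain the point. -/
lemma exists_star_ball {x : Euc d} (hx : x ∈ region Δ.cells) :
    ∃ ε > 0, ∀ C ∈ Δ.cells, ∀ z ∈ C, dist z x < ε → x ∈ C := by
  obtain ⟨U, hU, hf⟩ := Δ.locallyFinite x hx
  have h1 : ∀ C ∈ {C ∈ Δ.cells | (C ∩ U).Nonempty}, ∀ᶠ z in 𝓝 x, z ∈ C → x ∈ C := by
    intro C hC
    by_cases hxC : x ∈ C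
    · exact Eventually.of_forall fun _ _ => hxC
    · filter_upwards [(Δ.isFlatCell C hC.1).isClosed.isOpen_compl.mem_nhds hxC] with z hz hz'
      exact absurd hz' hz
  have h2 := ((hf.eventually_all).2 h1).and hU
  obtain ⟨ε, hε, h⟩ := Metric.eventually_nhds_iff.1 h2
  refine ⟨ε, hε, fun C hC z hz hzx => ?_⟩
  obtain ⟨h3, h4⟩ := h hzx
  exact h3 C ⟨hC, z, hz, h4⟩ hz

/-- With equal spans, a relative neighbourhood inside `D` would also be one inside `C`, although the
points of `D` are in the relative boundary of `C`. -/
lemma lin_lt_of_ssubset {C D : Set (Euc d)} (hC : C ∈ Δ.cells) (hD : D ∈ Δ.cells) (h : D ⊂ C) :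
    vectorSpan ℝ D < vectorSpan ℝ C := by
  refine lt_of_le_of_ne (vectorSpan_mono ℝ h.1) fun heq => ?_
  obtain ⟨x, hx⟩ := nonempty_relint hD
  obtain ⟨hxD, ε, hε, H⟩ := mem_relint_iff.1 hx
  refine (not_relint_iff hC (h.1 hxD)).2 ⟨D, hD, h, hxD⟩ (mem_relint_iff.2 ⟨h.1 hxD, ε, hε, ?_⟩)
  rw [← heq]
  exact fun v hv hvε => h.1 (H v hv hvε)

lemma dim_lt_of_ssubset {C D : Set (Euc d)} (hC : C ∈ Δ.cells) (hD : D ∈ Δ.cells) (h : D ⊂ C) :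
    flatDim D < flatDim C :=
  Submodule.finrank_lt_finrank_of_lt (lin_lt_of_ssubset hC hD h)

lemma dim_le_of_subset {C D : Set (Euc d)} (h : D ⊆ C) : flatDim D ≤ flatDim C :=
  Submodule.finrank_mono (vectorSpan_mono ℝ h)

lemma eq_of_subset_of_dim_le {C D : Set (Euc d)} (hC : C ∈ Δ.cells) (hD : D ∈ Δ.cells)
    (h : D ⊆ C) (hd : flatDim C ≤ flatDim D) : D = C := by
  by_contra hne
  exact absurd (dim_lt_of_ssubset hC hD (h.ssubset_of_ne hne)) (by omega)

/-- The carriers are constant on a preconnected set that is parallel to all of them. -/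
lemma carrier_const {S : Set (Euc d)} (hS : IsPreconnected S) {W : Submodule ℝ (Euc d)}
    (hW : ∀ x ∈ S, ∀ x' ∈ S, x' - x ∈ W)
    (hc : ∀ x ∈ S, ∃ K ∈ Δ.cells, x ∈ intrinsicInterior ℝ K ∧ vectorSpan ℝ K = W)
    {K : Set (Euc d)} (hK : K ∈ Δ.cells) {x : Euc d} (hxS : x ∈ S)
    (hx : x ∈ intrinsicInterior ℝ K) : S ⊆ intrinsicInterior ℝ K := by
  have hKW : vectorSpan ℝ K = W := by
    obtain ⟨L, hL, hxL, hLW⟩ := hc x hxS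
    rwa [carrier_unique hK hL hx hxL]
  -- The carrier of such a point is a subcell of `K` of the same dimension, hence `K` itself. So `S`
  -- never touches the relative boundary of `K`.
  have hrel : ∀ p ∈ S, p ∈ K → p ∈ intrinsicInterior ℝ K := by
    intro p hp hpK
    obtain ⟨L, hL, hpL, hLW⟩ := hc p hp
    rwa [← eq_of_subset_of_dim_le hK hL (carrier_subset hL hK hpL hpK)
      (by unfold flatDim; rw [hLW, hKW])]
  have := subset_of_isPreconnected (Δ.isFlatCell K hK).isClosed hS (fun p hp q hq => by
    have h1 := hW x hxS p hp
    rw [← hKW] at h1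
    have := Submodule.add_mem _ h1 (sub_mem_lin (relint_subset hx) hq)
    simpa using this) hrel hxS (relint_subset hx)
  exact fun p hp => hrel p hp (this hp)

end CellDecomposition

/-! ### The local shape of a cell at its facets, and inner normals -/

open scoped RealInnerProductSpace

namespace CellDecomposition

variable {d : ℕ} {Δ : CellDecomposition d}

/-- A vector that is parallel to `C`, where `F ⊆ C` has codimension one, splits into a vector
parallel to `F` and a multiple of a unit normal. -/
lemma lin_decomp {F C : Set (Euc d)} (hFC : F ⊆ C) (hdim : flatDim F + 1 = flatDim C)
    {u : Euc d} (hu1 : ‖u‖ = 1) (hu : u ∈ vectorSpan ℝ C)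
    (hperp : ∀ a ∈ vectorSpan ℝ F, ⟪a, u⟫ = 0) {v : Euc d} (hv : v ∈ vectorSpan ℝ C) :
    v - ⟪u, v⟫ • u ∈ vectorSpan ℝ F := by
  have hsub : vectorSpan ℝ F ⊔ ℝ ∙ u = vectorSpan ℝ C := by
    apply Submodule.eq_of_le_of_finrank_le
    · refine sup_le (vectorSpan_mono ℝ hFC) ?_
      rw [Submodule.span_singleton_le_iff_mem]; exact hu
    · have hinf : vectorSpan ℝ F ⊓ ℝ ∙ u = ⊥ := by
        rw [eq_bot_iff]
        rintro z ⟨hz1, hz2⟩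
        obtain ⟨c, rfl⟩ := Submodule.mem_span_singleton.1 hz2
        have := hperp _ hz1
        rw [inner_smul_left, real_inner_self_eq_norm_sq, hu1] at this
        simp only [conj_trivial, one_pow, mul_one] at this
        simp [this]
      have h1 := Submodule.finrank_sup_add_finrank_inf_eq (vectorSpan ℝ F) (ℝ ∙ u)
      rw [hinf, finrank_bot, finrank_span_singleton (by rintro rfl; simp at hu1)] at h1
      unfold flatDim at hdim
      omega
  rw [← hsub] at hv
  obtain ⟨a, ha, b, hb, rfl⟩ := Submodule.mem_sup.1 hv
  obtain ⟨c, rfl⟩ := Submodule.mem_span_singleton.1 hb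
  rw [inner_add_right, inner_smul_right, real_inner_self_eq_norm_sq, hu1, real_inner_comm,
    hperp a ha]
  simpa using ha

lemma exists_unit_perp {V W : Submodule ℝ (Euc d)} (h : V ≤ W)
    (hd : Module.finrank ℝ V < Module.finrank ℝ W) :
    ∃ u ∈ W, ‖u‖ = 1 ∧ ∀ a ∈ V, ⟪a, u⟫ = 0 := by
  have hlt : V < W := lt_of_le_of_ne h (by rintro rfl; exact lt_irrefl _ hd)
  obtain ⟨w, hw, hwV⟩ := SetLike.exists_of_lt hlt
  let p : Euc d := V.starProjection w
  have hp : p ∈ V := V.starProjection_apply_mem w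
  have h0 : w - p ≠ 0 := fun h0 => hwV (by rw [sub_eq_zero.1 h0]; exact hp)
  refine ⟨(‖w - p‖)⁻¹ • (w - p), W.smul_mem _ (W.sub_mem hw (h hp)), ?_, fun a ha => ?_⟩
  · rw [norm_smul, norm_inv, norm_norm, inv_mul_cancel₀ (norm_ne_zero_iff.2 h0)]
  · rw [inner_smul_right, (V.sub_starProjection_mem_orthogonal w) a ha, mul_zero]

/-- A cell is, near a relative interior point of one of its facets, a half-flat, whose side may a
priori depend on the point. -/
lemma half_flat_at {F C : Set (Euc d)} (hF : F ∈ Δ.cells) (hC : C ∈ Δ.cells)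
    (hFC : F ⊆ C) (hdim : flatDim F + 1 = flatDim C)
    {u : Euc d} (hu1 : ‖u‖ = 1) (hu : u ∈ vectorSpan ℝ C)
    (hperp : ∀ a ∈ vectorSpan ℝ F, ⟪a, u⟫ = 0) {z : Euc d} (hz : z ∈ intrinsicInterior ℝ F) :
    (∃ ε > 0, ∀ v ∈ vectorSpan ℝ C, ‖v‖ < ε → (z + v ∈ C ↔ 0 ≤ ⟪u, v⟫)) ∨
    (∃ ε > 0, ∀ v ∈ vectorSpan ℝ C, ‖v‖ < ε → (z + v ∈ C ↔ ⟪u, v⟫ ≤ 0)) := by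
  have hzF := relint_subset hz
  have hzC := hFC hzF
  have hFC' : F ⊂ C := hFC.ssubset_of_ne (by rintro rfl; omega)
  obtain ⟨ε₁, hε₁, hF1⟩ := (mem_relint_iff.1 hz).2
  obtain ⟨ε₂, hε₂, hst⟩ := exists_star_ball (mem_region hC hzC)
  set ε := min ε₁ ε₂ with hεdef
  have hε : 0 < ε := lt_min hε₁ hε₂
  -- off `F`, membership in `C` means membership in its relative interior
  have hrel : ∀ v ∈ vectorSpan ℝ C, ‖v‖ < ε → ⟪u, v⟫ ≠ 0 → z + v ∈ C →
      z + v ∈ intrinsicInterior ℝ C := by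
    intro v hv hvε hne hvC
    obtain ⟨K, hK, hKC, hvK⟩ := exists_carrier hC hvC
    have hzK : z ∈ K := hst K hK _ (relint_subset hvK)
      (by simpa [dist_eq_norm] using hvε.trans_le (min_le_right _ _))
    -- The carrier is squeezed between `F` and `C`, whose dimensions differ by one, so it is one of
    -- the two.
    have hFK : F ⊆ K := carrier_subset hF hK hz hzK
    have hd1 := dim_le_of_subset hFK
    have hd2 := dim_le_of_subset hKC
    rcases (by omega : flatDim K ≤ flatDim F ∨ flatDim C ≤ flatDim K) with h | h
    · obtain rfl := eq_of_subset_of_dim_le hK hF hFK h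
      have : v ∈ vectorSpan ℝ F := by
        have := sub_mem_lin (relint_subset hvK) hzF
        simpa using this
      exact absurd (by rw [real_inner_comm]; exact hperp v this) hne
    · rwa [← eq_of_subset_of_dim_le hC hK hKC h]
  have hzero : ∀ v ∈ vectorSpan ℝ C, ‖v‖ < ε → ⟪u, v⟫ = 0 → z + v ∈ C := by
    intro v hv hvε h0
    have := lin_decomp hFC hdim hu1 hu hperp hv
    rw [h0, zero_smul, sub_zero] at this
    exact hFC (hF1 v this (hvε.trans_le (min_le_left _ _)))
  -- each open half is inside or outside
  have hside : ∀ σ : ℝ, ∀ v ∈ vectorSpan ℝ C, ‖v‖ < ε → 0 < σ * ⟪u, v⟫ → z + v ∈ C →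
      ∀ v' ∈ vectorSpan ℝ C, ‖v'‖ < ε → 0 < σ * ⟪u, v'⟫ → z + v' ∈ C := by
    intro σ v hv hvε hσ hvC v' hv' hvε' hσ'
    let H : Set (Euc d) := {p | p - z ∈ vectorSpan ℝ C ∧ ‖p - z‖ < ε ∧ 0 < σ * ⟪u, p - z⟫}
    have hH : Convex ℝ H := by
      intro p hp q hq a b ha hb hab
      have e : a • p + b • q - z = a • (p - z) + b • (q - z) := by
        rw [smul_sub, smul_sub, sub_add_sub_comm, ← add_smul, hab, one_smul]
      refine ⟨?_, ?_, ?_⟩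
      · rw [e]; exact Submodule.add_mem _ (Submodule.smul_mem _ _ hp.1) (Submodule.smul_mem _ _ hq.1)
      · rw [e]
        have := (convex_ball (0 : Euc d) ε) (x := p - z) (by simpa using hp.2.1) (y := q - z)
          (by simpa using hq.2.1) ha hb hab
        simpa using this
      · rw [e, inner_add_right, inner_smul_right, inner_smul_right]
        have h1 := hp.2.2
        have h2 := hq.2.2
        rcases ha.eq_or_lt with rfl | ha
        · have : b = 1 := by linarith
          subst this; simpa using h2
        · have h3 : 0 < a * (σ * ⟪u, p - z⟫) := by positivity
          have h4 : 0 ≤ b * (σ * ⟪u, q - z⟫) := by positivity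
          linarith [mul_left_comm σ a ⟪u, p - z⟫, mul_left_comm σ b ⟪u, q - z⟫,
            mul_add σ (a * ⟪u, p - z⟫) (b * ⟪u, q - z⟫)]
    have hne : ∀ w, 0 < σ * ⟪u, w⟫ → ⟪u, w⟫ ≠ 0 := fun w h h0 => by simp [h0] at h
    refine subset_of_isPreconnected (Δ.isFlatCell C hC).isClosed hH.isPreconnected
      (fun p hp q hq => ?_) (fun p hp hpC => ?_)
      (show z + v ∈ H from ⟨by simpa using hv, by simpa using hvε, by simpa using hσ⟩) hvC
      (show z + v' ∈ H from ⟨by simpa using hv', by simpa using hvε', by simpa using hσ'⟩)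
    · have := Submodule.add_mem _ hp.1 (sub_mem_lin hzC hq)
      simpa using this
    · have := hrel (p - z) hp.1 hp.2.1 (hne _ hp.2.2) (by simpa using hpC)
      simpa using this
  -- a point of the relative interior, off `F`
  obtain ⟨p, hp, hpz⟩ := (Δ.isFlatCell C hC).exists_relint_near hzC hε
  have hpv : p - z ∈ vectorSpan ℝ C := sub_mem_lin (relint_subset hp) hzC
  have hpε : ‖p - z‖ < ε := by rwa [dist_eq_norm] at hpz
  have hp0 : ⟪u, p - z⟫ ≠ 0 := by
    intro h0
    have h1 := lin_decomp hFC hdim hu1 hu hperp hpv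
    rw [h0, zero_smul, sub_zero] at h1
    have h2 := hF1 _ h1 (hpε.trans_le (min_le_left _ _))
    rw [add_sub_cancel] at h2
    exact (not_relint_iff hC (relint_subset hp)).2 ⟨F, hF, hFC', h2⟩ hp
  -- If both open halves met `C`, both would be inside `C`, and `z` would be a relative interior
  -- point of `C` instead of a boundary point.
  have hboth : ∀ σ : ℝ, 0 < σ * ⟪u, p - z⟫ → ∀ v ∈ vectorSpan ℝ C, ‖v‖ < ε →
      σ * ⟪u, v⟫ < 0 → z + v ∉ C := by
    intro σ hσ v hv hvε hσv hvC
    have hz' : z ∈ intrinsicInterior ℝ C := by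
      refine mem_relint_iff.2 ⟨hzC, ε, hε, fun v' hv' hvε' => ?_⟩
      rcases lt_trichotomy (σ * ⟪u, v'⟫) 0 with h | h | h
      · exact hside (-σ) v hv hvε (by linarith) hvC v' hv' hvε' (by linarith)
      · refine hzero v' hv' hvε' ?_
        rcases mul_eq_zero.1 h with h | h
        · simp [h] at hσ
        · exact h
      · exact hside σ (p - z) hpv hpε hσ (by simpa using relint_subset hp) v' hv' hvε' h
    exact (not_relint_iff hC hzC).2 ⟨F, hF, hFC', hzF⟩ hz'
  rcases lt_or_gt_of_ne hp0 with hneg | hpos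
  · right
    refine ⟨ε, hε, fun v hv hvε => ⟨fun hvC => ?_, fun h => ?_⟩⟩
    · by_contra hlt
      exact hboth (-1) (by linarith) v hv hvε (by linarith [not_le.1 hlt]) hvC
    · rcases h.eq_or_lt with h | h
      · exact hzero v hv hvε h
      · exact hside (-1) (p - z) hpv hpε (by linarith) (by simpa using relint_subset hp) v hv hvε
          (by linarith)
  · left
    refine ⟨ε, hε, fun v hv hvε => ⟨fun hvC => ?_, fun h => ?_⟩⟩
    · by_contra hlt
      exact hboth 1 (by linarith) v hv hvε (by linarith [not_le.1 hlt]) hvC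
    · rcases h.eq_or_lt with h | h
      · exact hzero v hv hvε h.symm
      · exact hside 1 (p - z) hpv hpε (by linarith) (by simpa using relint_subset hp) v hv hvε
          (by linarith)

/-- A cell is, near the relative interior points of one of its facets, a half-flat. -/
lemma exists_half_flat {F C : Set (Euc d)} (hF : F ∈ Δ.cells) (hC : C ∈ Δ.cells)
    (hFC : F ⊆ C) (hdim : flatDim F + 1 = flatDim C) :
    ∃ u ∈ vectorSpan ℝ C, ‖u‖ = 1 ∧ (∀ a ∈ vectorSpan ℝ F, ⟪a, u⟫ = 0) ∧
      ∀ z ∈ intrinsicInterior ℝ F,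
        ∃ ε > 0, ∀ v ∈ vectorSpan ℝ C, ‖v‖ < ε → (z + v ∈ C ↔ 0 ≤ ⟪u, v⟫) := by
  obtain ⟨u, hu, hu1, hperp⟩ := exists_unit_perp (vectorSpan_mono ℝ hFC)
    (by unfold flatDim at hdim; omega)
  let P : ℝ → Euc d → Prop := fun σ z => ∃ ε > 0, ∀ v ∈ vectorSpan ℝ C, ‖v‖ < ε →
    (z + v ∈ C ↔ 0 ≤ σ * ⟪u, v⟫)
  have hP : ∀ z ∈ intrinsicInterior ℝ F, P 1 z ∨ P (-1) z := by
    intro z hz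
    rcases half_flat_at hF hC hFC hdim hu1 hu hperp hz with h | h
    · left; simpa [P] using h
    · right; simpa [P] using h
  have hopen : ∀ σ z, P σ z → z ∈ intrinsicInterior ℝ F → ∃ δ > 0,
      ∀ z' ∈ intrinsicInterior ℝ F, dist z' z < δ → P σ z' := by
    rintro σ z ⟨ε, hε, h⟩ hz
    refine ⟨ε / 2, by linarith, fun z' hz' hd => ⟨ε / 2, by linarith, fun v hv hvε => ?_⟩⟩
    have hd1 : z' - z ∈ vectorSpan ℝ F := sub_mem_lin (relint_subset hz') (relint_subset hz)
    have h1 := h (z' - z + v) (Submodule.add_mem _ (vectorSpan_mono ℝ hFC hd1) hv)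
      ((norm_add_le _ _).trans_lt (by rw [dist_eq_norm] at hd; linarith))
    rw [inner_add_right, real_inner_comm, hperp _ hd1, zero_add] at h1
    rw [← h1]; congr! 1; abel
  have hexcl : ∀ z ∈ intrinsicInterior ℝ F, P 1 z → ¬ P (-1) z := by
    rintro z hz ⟨ε, hε, h⟩ ⟨ε', hε', h'⟩
    have hpos : 0 < min ε ε' / 2 := by positivity
    have hn : ‖(min ε ε' / 2) • u‖ = min ε ε' / 2 := by
      rw [norm_smul, hu1, Real.norm_of_nonneg hpos.le, mul_one]
    have h1 := h ((min ε ε' / 2) • u) (Submodule.smul_mem _ _ hu)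
      (by rw [hn]; linarith [min_le_left ε ε'])
    have h2 := h' ((min ε ε' / 2) • u) (Submodule.smul_mem _ _ hu)
      (by rw [hn]; linarith [min_le_right ε ε'])
    rw [h1, inner_smul_right, real_inner_self_eq_norm_sq, hu1] at h2
    have := h2.1 (by linarith)
    linarith
  -- The side on which `C` lies is locally constant along the open cell of `F`, which is connected.
  have hall : (∀ z ∈ intrinsicInterior ℝ F, P 1 z) ∨ (∀ z ∈ intrinsicInterior ℝ F, P (-1) z) := by
    by_contra hcon
    push Not at hcon
    obtain ⟨⟨z, hz, hz1⟩, z', hz', hz1'⟩ := hcon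
    have := (Δ.isFlatCell F hF).connected.isPreconnected.induction₂ (fun a b => P 1 a ↔ P 1 b)
      (fun p hp => by
        rcases hP p hp with h | h
        · obtain ⟨δ, hδ, H⟩ := hopen 1 p h hp
          filter_upwards [self_mem_nhdsWithin, mem_nhdsWithin_of_mem_nhds (Metric.ball_mem_nhds p hδ)]
            with q hq hqδ
          exact iff_of_true h (H q hq hqδ)
        · obtain ⟨δ, hδ, H⟩ := hopen (-1) p h hp
          filter_upwards [self_mem_nhdsWithin, mem_nhdsWithin_of_mem_nhds (Metric.ball_mem_nhds p hδ)]
            with q hq hqδ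
          exact iff_of_false (fun h1 => hexcl p hp h1 h) (fun h1 => hexcl q hq h1 (H q hq hqδ)))
      (fun _ _ _ _ _ _ h h' => h.trans h') (fun _ _ _ _ h => h.symm) hz hz'
    exact hz1 (this.2 ((hP z' hz').resolve_right hz1'))
  rcases hall with h | h
  · exact ⟨u, hu, hu1, hperp, fun z hz => by simpa [P] using h z hz⟩
  · exact ⟨-u, Submodule.neg_mem _ hu, by rwa [norm_neg],
      fun a ha => by rw [inner_neg_right, hperp a ha, neg_zero],
      fun z hz => by simpa [P, inner_neg_left] using h z hz⟩

lemma isInnerNormal_of_half {F C : Set (Euc d)} {u : Euc d} (hu : u ∈ vectorSpan ℝ C)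
    (hu1 : ‖u‖ = 1) (hperp : ∀ a ∈ vectorSpan ℝ F, ⟪a, u⟫ = 0)
    (h : ∀ z ∈ intrinsicInterior ℝ F,
        ∃ ε > 0, ∀ v ∈ vectorSpan ℝ C, ‖v‖ < ε → (z + v ∈ C ↔ 0 ≤ ⟪u, v⟫)) :
    IsInnerNormal F C u := by
  refine ⟨hu1, hu, hperp, fun y hy => ?_⟩
  obtain ⟨ε, hε, H⟩ := h y hy
  filter_upwards [Ioo_mem_nhdsGT hε] with t ht
  refine (H _ (Submodule.smul_mem _ _ hu) ?_).2 ?_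
  · rw [norm_smul, hu1, mul_one, Real.norm_of_nonneg ht.1.le]; exact ht.2
  · rw [inner_smul_right, real_inner_self_eq_norm_sq, hu1]; nlinarith [ht.1]

/-- The unit normals to a facet are determined up to sign. -/
lemma unit_normal_eq_or_neg {F C : Set (Euc d)} (hFC : F ⊆ C) (hdim : flatDim F + 1 = flatDim C)
    {u u' : Euc d} (hu1 : ‖u‖ = 1) (hu : u ∈ vectorSpan ℝ C)
    (hperp : ∀ a ∈ vectorSpan ℝ F, ⟪a, u⟫ = 0) (hu1' : ‖u'‖ = 1) (hu' : u' ∈ vectorSpan ℝ C)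
    (hperp' : ∀ a ∈ vectorSpan ℝ F, ⟪a, u'⟫ = 0) : u' = u ∨ u' = -u := by
  have h3 := lin_decomp hFC hdim hu1 hu hperp hu'
  have h4 : u' - ⟪u, u'⟫ • u = 0 := by
    rw [← inner_self_eq_zero (𝕜 := ℝ), inner_sub_right (u' - ⟪u, u'⟫ • u) u' (⟪u, u'⟫ • u),
      hperp' _ h3, inner_smul_right, hperp _ h3]
    simp
  have h5 : u' = ⟪u, u'⟫ • u := sub_eq_zero.1 h4
  have h6 : |⟪u, u'⟫| = 1 := by
    have := congrArg norm h5
    rw [norm_smul, hu1, hu1', mul_one, Real.norm_eq_abs] at this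
    exact this.symm
  rcases (abs_eq zero_le_one).1 h6 with h | h
  · left; rwa [h, one_smul] at h5
  · right; rwa [h, neg_one_smul] at h5

/-- Uniqueness of the inner unit normal. -/
lemma isInnerNormal_unique {F C : Set (Euc d)} (hF : F ∈ Δ.cells)
    (hFC : F ⊆ C) (hdim : flatDim F + 1 = flatDim C) {u u' : Euc d}
    (hu : u ∈ vectorSpan ℝ C) (hu1 : ‖u‖ = 1) (hperp : ∀ a ∈ vectorSpan ℝ F, ⟪a, u⟫ = 0)
    (h : ∀ z ∈ intrinsicInterior ℝ F,
        ∃ ε > 0, ∀ v ∈ vectorSpan ℝ C, ‖v‖ < ε → (z + v ∈ C ↔ 0 ≤ ⟪u, v⟫))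
    (hu' : IsInnerNormal F C u') : u' = u := by
  obtain ⟨z, hz⟩ := nonempty_relint hF
  obtain ⟨ε, hε, H⟩ := h z hz
  obtain ⟨t, ht, htε⟩ := ((hu'.inward z hz).and (Ioo_mem_nhdsGT hε)).exists
  have h1 := (H _ (Submodule.smul_mem _ t hu'.mem) (by
    rw [norm_smul, hu'.norm_eq, mul_one, Real.norm_of_nonneg htε.1.le]; exact htε.2)).1 ht
  rw [inner_smul_right] at h1
  have h2 : 0 ≤ ⟪u, u'⟫ := nonneg_of_mul_nonneg_right h1 htε.1
  rcases unit_normal_eq_or_neg hFC hdim hu1 hu hperp hu'.norm_eq hu'.mem hu'.perp with h | h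
  · exact h
  · rw [h, inner_neg_right, real_inner_self_eq_norm_sq, hu1] at h2
    linarith

/-- The defining properties of the inner unit normal, including the local shape of the cell. -/
lemma innerNormal_spec {F C : Set (Euc d)} (hF : F ∈ Δ.cells) (hC : C ∈ Δ.cells)
    (hFC : F ⊆ C) (hdim : flatDim F + 1 = flatDim C) :
    innerNormal F C ∈ vectorSpan ℝ C ∧ ‖innerNormal F C‖ = 1 ∧
      (∀ a ∈ vectorSpan ℝ F, ⟪a, innerNormal F C⟫ = 0) ∧
      ∀ z ∈ intrinsicInterior ℝ F,
        ∃ ε > 0, ∀ v ∈ vectorSpan ℝ C, ‖v‖ < ε → (z + v ∈ C ↔ 0 ≤ ⟪innerNormal F C, v⟫) := by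
  obtain ⟨u, hu, hu1, hperp, h⟩ := exists_half_flat hF hC hFC hdim
  have hex : ∃ u, IsInnerNormal F C u := ⟨u, isInnerNormal_of_half hu hu1 hperp h⟩
  have : innerNormal F C = u := by
    unfold innerNormal
    rw [dif_pos hex]
    exact isInnerNormal_unique hF hFC hdim hu hu1 hperp h hex.choose_spec
  rw [this]
  exact ⟨hu, hu1, hperp, h⟩

/-- Near a facet, the points strictly on the inner side are in the relative interior. -/
lemma half_relint {F C : Set (Euc d)} (hF : F ∈ Δ.cells) (hC : C ∈ Δ.cells)
    (hFC : F ⊆ C) (hdim : flatDim F + 1 = flatDim C) {z : Euc d}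
    (hz : z ∈ intrinsicInterior ℝ F) :
    ∃ ε > 0, ∀ v ∈ vectorSpan ℝ C, ‖v‖ < ε → 0 < ⟪innerNormal F C, v⟫ →
      z + v ∈ intrinsicInterior ℝ C := by
  obtain ⟨-, -, -, h⟩ := innerNormal_spec hF hC hFC hdim
  obtain ⟨ε, hε, H⟩ := h z hz
  refine ⟨ε, hε, fun v hv hvε hpos => ?_⟩
  have hcont : ∀ᶠ w in 𝓝 v, ‖w‖ < ε ∧ 0 < ⟪innerNormal F C, w⟫ :=
    ((continuous_norm.tendsto v).eventually (gt_mem_nhds hvε)).and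
      (((continuous_const.inner continuous_id).tendsto v).eventually (lt_mem_nhds hpos))
  obtain ⟨δ, hδ, hδ'⟩ := Metric.eventually_nhds_iff.1 hcont
  refine mem_relint_iff.2 ⟨(H v hv hvε).2 hpos.le, δ, hδ, fun w hw hwδ => ?_⟩
  obtain ⟨h1, h2⟩ := hδ' (y := v + w) (by simpa [dist_eq_norm] using hwδ)
  rw [add_assoc]
  exact (H _ (Submodule.add_mem _ hv hw) h1).2 h2.le

/-- Different cells have different inner normals at a common facet. -/
lemma eq_of_innerNormal_eq {F C C' : Set (Euc d)} (hF : F ∈ Δ.cells) (hC : C ∈ Δ.cells)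
    (hC' : C' ∈ Δ.cells) (hFC : F ⊆ C) (hFC' : F ⊆ C') (hdim : flatDim F + 1 = flatDim C)
    (hdim' : flatDim F + 1 = flatDim C') (h : innerNormal F C = innerNormal F C') : C = C' := by
  obtain ⟨z, hz⟩ := nonempty_relint hF
  obtain ⟨hn, hn1, -, -⟩ := innerNormal_spec hF hC hFC hdim
  obtain ⟨hn', -, -, -⟩ := innerNormal_spec hF hC' hFC' hdim'
  obtain ⟨ε, hε, H⟩ := half_relint hF hC hFC hdim hz
  obtain ⟨ε', hε', H'⟩ := half_relint hF hC' hFC' hdim' hz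
  have hpos : 0 < min ε ε' / 2 := by positivity
  have hn2 : ‖(min ε ε' / 2) • innerNormal F C‖ = min ε ε' / 2 := by
    rw [norm_smul, hn1, Real.norm_of_nonneg hpos.le, mul_one]
  have hin : 0 < ⟪innerNormal F C, (min ε ε' / 2) • innerNormal F C⟫ := by
    rw [inner_smul_right, real_inner_self_eq_norm_sq, hn1]; linarith
  refine carrier_unique hC hC' (H _ (Submodule.smul_mem _ _ hn)
    (by rw [hn2]; linarith [min_le_left ε ε']) hin) (H' ((min ε ε' / 2) • innerNormal F C)
    (by rw [h]; exact Submodule.smul_mem _ _ hn') (by rw [hn2]; linarith [min_le_right ε ε'])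
    (by rw [← h]; exact hin))

/-- The inner normals of two cells in the same flat at a common facet are opposite. -/
lemma innerNormal_neg {F C C' : Set (Euc d)} (hF : F ∈ Δ.cells) (hC : C ∈ Δ.cells)
    (hC' : C' ∈ Δ.cells) (hFC : F ⊆ C) (hFC' : F ⊆ C') (hdim : flatDim F + 1 = flatDim C)
    (hlin : vectorSpan ℝ C = vectorSpan ℝ C') (hne : C ≠ C') :
    innerNormal F C' = -innerNormal F C := by
  have hdim' : flatDim F + 1 = flatDim C' := by rw [hdim]; unfold flatDim; rw [hlin]
  obtain ⟨hn, hn1, hp, -⟩ := innerNormal_spec hF hC hFC hdim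
  obtain ⟨hn', hn1', hp', -⟩ := innerNormal_spec hF hC' hFC' hdim'
  rw [← hlin] at hn'
  exact (unit_normal_eq_or_neg hFC hdim hn1 hn hp hn1' hn' hp').resolve_left fun h =>
    hne (eq_of_innerNormal_eq hF hC hC' hFC hFC' hdim hdim' h.symm)

end CellDecomposition

/-! ### Generic points -/

/-- Finitely many proper affine subspaces do not cover an open set. -/
lemma exists_generic_point {d : ℕ} {ι : Type*} {s : Set ι} (hs : s.Finite)
    (f : ι → AffineSubspace ℝ (Euc d)) (hf : ∀ i ∈ s, f i ≠ ⊤) {U : Set (Euc d)} (hU : IsOpen U)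
    (hne : U.Nonempty) : ∃ x ∈ U, ∀ i ∈ s, x ∉ f i := by
  by_contra! hcon
  have h1 : U ⊆ ⋃ i ∈ s, (f i : Set (Euc d)) := by
    intro x hx
    obtain ⟨i, hi, h⟩ := hcon x hx
    exact mem_biUnion hi h
  have h2 : volume (⋃ i ∈ s, (f i : Set (Euc d))) = 0 := by
    rw [measure_biUnion_null_iff hs.countable]
    exact fun i hi => Measure.addHaar_affineSubspace volume (f i) (hf i hi)
  exact (hU.measure_pos volume hne).ne' (measure_mono_null h1 h2)

lemma affineSpan_ne_top {d : ℕ} {S : Set (Euc d)} (h : flatDim S < d) : affineSpan ℝ S ≠ ⊤ := by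
  intro htop
  have : vectorSpan ℝ S = ⊤ := by rw [← direction_affineSpan, htop, AffineSubspace.direction_top]
  rw [vectorSpan_eq_top_iff_flatDim] at this
  omega

lemma flatDim_insert_le {d : ℕ} (S : Set (Euc d)) (q : Euc d) :
    flatDim (insert q S) ≤ flatDim S + 1 := finrank_vectorSpan_insert_le_set ℝ S q

/-- The segment from a point that is generic with respect to `q` and `E` to `q` misses `E`. -/
lemma lineMap_not_mem_of_generic {d : ℕ} {E : Set (Euc d)} {p q : Euc d} (hq : q ∉ E)
    (hp : p ∉ affineSpan ℝ (insert q E)) (t : ℝ) : AffineMap.lineMap p q t ∉ E := by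
  intro hx
  have ht : 1 - t ≠ 0 := by
    intro h
    have : t = 1 := by linarith
    subst this
    rw [AffineMap.lineMap_apply_one] at hx
    exact hq hx
  apply hp
  -- A point of `E` on the segment, different from `q`, would put `p` on a line through `q` and that
  -- point, hence into the excluded span.
  have e : p = AffineMap.lineMap q (AffineMap.lineMap p q t) (1 / (1 - t)) := by
    simp only [AffineMap.lineMap_apply, vsub_eq_sub, vadd_eq_add]
    have : t • (q - p) + p - q = (1 - t) • (p - q) := by
      rw [sub_smul, one_smul, smul_sub, smul_sub]; abel
    rw [this, smul_smul, one_div, inv_mul_cancel₀ ht, one_smul]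
    abel
  rw [e]
  exact AffineMap.lineMap_mem _ (subset_affineSpan ℝ _ (mem_insert _ _))
    (subset_affineSpan ℝ _ (mem_insert_of_mem _ hx))

/-- The complement of a subspace of codimension at least two in a ball is preconnected. -/
lemma isPreconnected_ball_diff {d : ℕ} {V W : Submodule ℝ (Euc d)}
    (hVW : V ≤ W) (hd : Module.finrank ℝ V + 2 ≤ Module.finrank ℝ W) (x : Euc d) {ε : ℝ}
    (hε : 0 < ε) : IsPreconnected {p : Euc d | p - x ∈ W ∧ ‖p - x‖ < ε ∧ p - x ∉ V} := by
  let E : Submodule ℝ W := V.comap W.subtype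
  have hEr : Module.finrank ℝ E = Module.finrank ℝ V :=
    (Submodule.comapSubtypeEquivOfLe hVW).finrank_eq
  have hcod : 1 < Module.rank ℝ (W ⧸ E) := by
    have h1 := Submodule.finrank_quotient_add_finrank E
    have h2 : 1 < Module.finrank ℝ (W ⧸ E) := by omega
    rw [← Module.finrank_eq_rank]
    exact_mod_cast h2
  have hc := (isConnected_compl_of_one_lt_codim hcod).isPreconnected
  -- Radial contraction of `W` onto the open disc. It preserves each ray, hence the subspace and its
  -- complement, and transfers the connectedness of the complement in `W`.
  let g : W → Euc d := fun v => x + (ε / (1 + ‖v‖)) • (v : Euc d)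
  have hg : Continuous g := by
    refine continuous_const.add (Continuous.smul (continuous_const.div
      (continuous_const.add continuous_norm) fun v => ?_) continuous_subtype_val)
    exact (add_pos_of_pos_of_nonneg one_pos (norm_nonneg v)).ne'
  convert hc.image g hg.continuousOn using 1
  ext p
  simp only [mem_ofPred_eq, mem_image, mem_compl_iff, SetLike.mem_coe]
  constructor
  · rintro ⟨h1, h2, h3⟩
    refine ⟨(ε - ‖p - x‖)⁻¹ • ⟨p - x, h1⟩, ?_, ?_⟩
    · intro h
      apply h3
      have h4 : (ε - ‖p - x‖)⁻¹ • (p - x) ∈ V := h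
      rwa [Submodule.smul_mem_iff _ (inv_ne_zero (by linarith))] at h4
    · have hpos : 0 < ε - ‖p - x‖ := by linarith
      simp only [g, Submodule.coe_smul, norm_smul, Submodule.coe_norm, norm_inv,
        Real.norm_of_nonneg hpos.le]
      rw [smul_smul]
      have : ε / (1 + (ε - ‖p - x‖)⁻¹ * ‖p - x‖) * (ε - ‖p - x‖)⁻¹ = 1 := by
        field_simp; ring
      rw [this, one_smul]; abel
  · rintro ⟨v, hv, rfl⟩
    have hpos : 0 < ε / (1 + ‖v‖) := by positivity
    simp only [g, add_sub_cancel_left]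
    refine ⟨W.smul_mem _ v.2, ?_, ?_⟩
    · rw [norm_smul, Real.norm_of_nonneg hpos.le, Submodule.coe_norm, div_mul_eq_mul_div,
        div_lt_iff₀ (by positivity)]
      nlinarith [norm_nonneg v]
    · rw [Submodule.smul_mem_iff _ hpos.ne']; exact hv

/-! ### Facets above a cell, and internal cells -/

namespace CellDecomposition

variable {d : ℕ} {Δ : CellDecomposition d}

/-- Every cell properly contained in `A` is contained in a facet of `A`. -/
lemma exists_facet_above {C A : Set (Euc d)} (hC : C ∈ Δ.cells) (hA : A ∈ Δ.cells) (h : C ⊂ A) :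
    ∃ K ∈ Δ.cells, C ⊆ K ∧ K ⊂ A ∧ flatDim K + 1 = flatDim A := by
  obtain ⟨c, hc⟩ := nonempty_cell hC
  have hf : {K ∈ Δ.cells | C ⊆ K ∧ K ⊂ A}.Finite :=
    (finite_cells_at c).subset fun K hK => ⟨hK.1, hK.2.1 hc⟩
  obtain ⟨K, hCK, hK⟩ := hf.exists_le_maximal ⟨hC, Subset.rfl, h⟩
  obtain ⟨hKc, -, hKA⟩ := hK.prop
  refine ⟨K, hKc, hCK, hKA, ?_⟩
  have hlt := dim_lt_of_ssubset hA hKc hKA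
  by_contra hne
  obtain ⟨x, hx⟩ := nonempty_relint hKc
  have hxK := relint_subset hx
  have hxA := hKA.1 hxK
  obtain ⟨ε₁, hε₁, h1⟩ := (mem_relint_iff.1 hx).2
  obtain ⟨ε₂, hε₂, hst⟩ := exists_star_ball (mem_region hA hxA)
  have hε : 0 < min ε₁ ε₂ := lt_min hε₁ hε₂
  -- If `K`, maximal among the proper subcells of `A` that contain `C`, had codimension at least
  -- two, the disc minus the flat of `K` would be connected. By maximality it misses the relative
  -- boundary of `A`, so it would lie in `A`, and `x` would become a relative interior point of `A`.
  have hcon := isPreconnected_ball_diff (vectorSpan_mono ℝ hKA.1)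
    (by unfold flatDim at hlt hne; omega) x hε
  obtain ⟨p, hp, hpx⟩ := (Δ.isFlatCell A hA).exists_relint_near hxA hε
  have hnr : x ∉ intrinsicInterior ℝ A := (not_relint_iff hA hxA).2 ⟨K, hKc, hKA, hxK⟩
  have hmem : p ∈ {p : Euc d | p - x ∈ vectorSpan ℝ A ∧ ‖p - x‖ < min ε₁ ε₂ ∧
      p - x ∉ vectorSpan ℝ K} := by
    rw [dist_eq_norm] at hpx
    refine ⟨sub_mem_lin (relint_subset hp) hxA, hpx, fun hcon => ?_⟩
    have := h1 _ hcon (hpx.trans_le (min_le_left _ _))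
    rw [add_sub_cancel] at this
    exact (not_relint_iff hA (relint_subset hp)).2 ⟨K, hKc, hKA, this⟩ hp
  have hsub := subset_of_isPreconnected (Δ.isFlatCell A hA).isClosed hcon (fun p hp q hq => by
      simpa using Submodule.add_mem _ hp.1 (sub_mem_lin hxA hq)) (fun p hp hpA => by
      by_contra hnr
      obtain ⟨D, hD, hDA, hpD⟩ := (not_relint_iff hA hpA).1 hnr
      have hxD := hst D hD p hpD (by rw [dist_eq_norm]; exact hp.2.1.trans_le (min_le_right _ _))
      have hKD := carrier_subset hKc hD hx hxD
      have hDK : D ⊆ K := hK.le_of_ge ⟨hD, hCK.trans hKD, hDA⟩ hKD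
      exact hp.2.2 (sub_mem_lin (hDK hpD) hxK)) hmem (relint_subset hp)
  refine hnr (mem_relint_iff.2 ⟨hxA, _, hε, fun v hv hvε => ?_⟩)
  by_cases hvK : v ∈ vectorSpan ℝ K
  · exact hKA.1 (h1 v hvK (hvε.trans_le (min_le_left _ _)))
  · exact hsub ⟨by simpa using hv, by simpa using hvε, by simpa using hvK⟩

/-- A cell properly contained in `A` is a facet of a subcell of `A`. -/
lemma exists_cell_above {C A : Set (Euc d)} (hC : C ∈ Δ.cells) (hA : A ∈ Δ.cells) (h : C ⊂ A) :
    ∃ K ∈ Δ.cells, C ⊆ K ∧ flatDim C + 1 = flatDim K := by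
  induction hn : flatDim A using Nat.strong_induction_on generalizing A with
  | _ n ih =>
    obtain ⟨K, hK, hCK, hKA, hd⟩ := exists_facet_above hC hA h
    rcases hCK.eq_or_ssubset with rfl | hss
    · exact ⟨A, hA, h.1, hd⟩
    · exact ih (flatDim K) (by omega) hK hss rfl

/-- The local description of the top-dimensional cells at a facet, uniformly in the cells. -/
lemma exists_uniform_half {F : Set (Euc d)} (hF : F ∈ Δ.cells) (hdim : flatDim F + 1 = d)
    {z : Euc d} (hz : z ∈ intrinsicInterior ℝ F) :
    ∃ ε > 0, ∀ B ∈ Δ.cells, flatDim B = d → F ⊆ B → ∀ v : Euc d, ‖v‖ < ε →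
      (z + v ∈ B ↔ 0 ≤ ⟪innerNormal F B, v⟫) := by
  have hf : {B ∈ Δ.cells | z ∈ B}.Finite := finite_cells_at z
  have : ∀ B ∈ {B ∈ Δ.cells | z ∈ B}, ∀ᶠ v : Euc d in 𝓝 0, flatDim B = d → F ⊆ B →
      (z + v ∈ B ↔ 0 ≤ ⟪innerNormal F B, v⟫) := by
    intro B hB
    by_cases h : flatDim B = d ∧ F ⊆ B
    · obtain ⟨-, -, -, h1⟩ := innerNormal_spec hF hB.1 h.2 (by rw [hdim, h.1])
      obtain ⟨ε, hε, H⟩ := h1 z hz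
      filter_upwards [Metric.ball_mem_nhds 0 hε] with v hv _ _
      exact H v (by rw [vectorSpan_eq_top_iff_flatDim.2 h.1]; trivial) (by simpa using hv)
    · exact Eventually.of_forall fun v h1 h2 => absurd ⟨h1, h2⟩ h
  obtain ⟨ε, hε, h⟩ := Metric.eventually_nhds_iff.1 (hf.eventually_all.2 this)
  exact ⟨ε, hε, fun B hB hBd hFB v hv =>
    h (y := v) (by simpa using hv) B ⟨hB, hFB (relint_subset hz)⟩ hBd hFB⟩

lemma exists_top_of_mem_region {x : Euc d} (hx : x ∈ region Δ.cells) :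
    ∃ A ∈ Δ.cells, flatDim A = d ∧ x ∈ A := by
  obtain ⟨C, hC, hxC⟩ := hx
  obtain ⟨A, hA, hd, hCA⟩ := Δ.pure C hC
  exact ⟨A, hA, hd, hCA hxC⟩

lemma relint_top_subset_interior {A : Set (Euc d)} (hA : A ∈ Δ.cells) (hd : flatDim A = d) :
    intrinsicInterior ℝ A ⊆ interior (region Δ.cells) := by
  rw [interior_eq_relint (vectorSpan_eq_top_iff_flatDim.2 hd)]
  exact interior_mono fun x hx => mem_region hA hx

/-- A facet is in the interior of the region if and only if it is in two top-dimensional cells. -/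
lemma facet_interior_iff {F : Set (Euc d)} (hF : F ∈ Δ.cells) (hdim : flatDim F + 1 = d)
    {z : Euc d} (hz : z ∈ intrinsicInterior ℝ F) :
    z ∈ interior (region Δ.cells) ↔ ∃ A ∈ Δ.cells, ∃ B ∈ Δ.cells, flatDim A = d ∧ flatDim B = d ∧
      F ⊆ A ∧ F ⊆ B ∧ A ≠ B := by
  obtain ⟨ε, hε, H⟩ := exists_uniform_half hF hdim hz
  constructor
  · intro hint
    obtain ⟨A₀, hA₀, hA₀d, hFA₀⟩ := Δ.pure F hF
    obtain ⟨-, hn1, hnp, -⟩ := innerNormal_spec hF hA₀ hFA₀ (by rw [hdim, hA₀d])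
    set u := innerNormal F A₀
    obtain ⟨ε₁, hε₁, h1⟩ := Metric.mem_nhds_iff.1 (mem_interior_iff_mem_nhds.1 hint)
    obtain ⟨ε₂, hε₂, hst⟩ := exists_star_ball (mem_region hF (relint_subset hz))
    obtain ⟨δ, hδ, hδm⟩ : ∃ δ > 0, δ < min ε (min ε₁ ε₂) := exists_between (by positivity)
    have hn : ‖δ • u‖ = δ := by rw [norm_smul, hn1, mul_one, Real.norm_of_nonneg hδ.le]
    -- A point just beyond `F`, on the outer side of `A₀`, is still in the region, and the top cell
    -- that covers it cannot be `A₀`.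
    obtain ⟨B, hB, hBd, hzB⟩ := exists_top_of_mem_region (Δ := Δ) (x := z + -(δ • u)) (h1 (by
      rw [mem_ball_iff_norm, add_sub_cancel_left, norm_neg, hn]
      exact hδm.trans_le ((min_le_right _ _).trans (min_le_left _ _))))
    have hzB' := hst B hB _ hzB (by
      rw [dist_eq_norm, add_sub_cancel_left, norm_neg, hn]
      exact hδm.trans_le ((min_le_right _ _).trans (min_le_right _ _)))
    have hFB := carrier_subset hF hB hz hzB'
    refine ⟨A₀, hA₀, B, hB, hA₀d, hBd, hFA₀, hFB, ?_⟩
    rintro rfl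
    have := (H A₀ hA₀ hA₀d hFA₀ _ (by rw [norm_neg, hn]; exact hδm.trans_le (min_le_left _ _))).1 hzB
    rw [inner_neg_right, inner_smul_right, real_inner_self_eq_norm_sq, hn1] at this
    linarith
  · rintro ⟨A, hA, B, hB, hAd, hBd, hFA, hFB, hne⟩
    have hneg := innerNormal_neg hF hA hB hFA hFB (by rw [hdim, hAd])
      (by rw [vectorSpan_eq_top_iff_flatDim.2 hAd, vectorSpan_eq_top_iff_flatDim.2 hBd]) hne
    rw [mem_interior_iff_mem_nhds, Metric.mem_nhds_iff]
    refine ⟨ε, hε, fun p hp => ?_⟩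
    have hpn : ‖p - z‖ < ε := by rwa [mem_ball_iff_norm] at hp
    rcases le_total 0 ⟪innerNormal F A, p - z⟫ with h | h
    · exact mem_region hA (by simpa using (H A hA hAd hFA (p - z) hpn).2 h)
    · refine mem_region hB ?_
      simpa using (H B hB hBd hFB (p - z) hpn).2 (by rw [hneg, inner_neg_left]; linarith)

/-- Otherwise a segment runs from the interior of the region near `z'` to a point outside the region
near `z`. When generic, it avoids codimension two, so its first exit from the interior is in the
open cell of a facet or of a `d`-cell. That cell contains `C`; for a facet, being interior can be
tested near `z'`, so no exit is possible. -/
lemma mem_interior_of_near {C : Set (Euc d)} (hC : C ∈ Δ.cells) {z z' : Euc d}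
    (hz : z ∈ intrinsicInterior ℝ C) (hz' : z' ∈ intrinsicInterior ℝ C) {ε : ℝ}
    (hst : ∀ C ∈ Δ.cells, ∀ p ∈ C, dist p z < ε → z ∈ C) (hd : dist z' z < ε)
    (hint : z' ∈ interior (region Δ.cells)) : z ∈ interior (region Δ.cells) := by
  by_contra hnot
  have hε : 0 < ε := dist_nonneg.trans_lt hd
  obtain ⟨q, hq, hqR⟩ : ∃ q ∈ Metric.ball z ε, q ∉ region Δ.cells := by
    by_contra! hcon
    exact hnot (mem_interior_iff_mem_nhds.2 (Metric.mem_nhds_iff.2 ⟨ε, hε, hcon⟩))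
  have hfin : {E ∈ Δ.cells | z ∈ E}.Finite := finite_cells_at z
  obtain ⟨p, ⟨hpball, hpint⟩, hp⟩ := exists_generic_point
    (s := {E ∈ Δ.cells | z ∈ E ∧ flatDim E + 2 ≤ d})
    (hfin.subset fun E hE => ⟨hE.1, hE.2.1⟩) (fun E => affineSpan ℝ (insert q E))
    (fun E hE => affineSpan_ne_top ((Nat.lt_succ_of_le (flatDim_insert_le E q)).trans_le hE.2.2))
    (Metric.isOpen_ball.inter isOpen_interior) ⟨z', hd, hint⟩
  let x : ℝ → Euc d := fun t => AffineMap.lineMap p q t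
  have hx : Continuous x := AffineMap.lineMap_continuous
  have hxball : ∀ t ∈ Icc (0 : ℝ) 1, x t ∈ Metric.ball z ε := fun t ht =>
    (convex_ball z ε).lineMap_mem hpball hq ht
  have hcpt : IsCompact (Icc (0 : ℝ) 1 ∩ x ⁻¹' (interior (region Δ.cells))ᶜ) :=
    isCompact_Icc.inter_right (isOpen_interior.isClosed_compl.preimage hx)
  obtain ⟨t, ⟨ht, htn⟩, hmin⟩ := hcpt.exists_isLeast ⟨1, ⟨by simp, by
    simp only [x, mem_preimage, AffineMap.lineMap_apply_one]
    exact fun h => hqR (interior_subset h)⟩⟩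
  have hless : ∀ s ∈ Ico 0 t, x s ∈ interior (region Δ.cells) := by
    intro s hs
    by_contra hcon
    exact absurd (hmin ⟨⟨hs.1, hs.2.le.trans ht.2⟩, hcon⟩) (not_le.2 hs.2)
  have ht0 : 0 < t := by
    rcases ht.1.eq_or_lt with h | h
    · subst h; simp only [x, mem_preimage, AffineMap.lineMap_apply_zero] at htn
      exact absurd hpint htn
    · exact h
  -- The first exit point is still covered: the points before it are in the finitely many cells at
  -- `z`, whose union is closed.
  have hcl : IsClosed (⋃ E ∈ {E ∈ Δ.cells | z ∈ E}, E) :=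
    hfin.isClosed_biUnion fun E hE => (Δ.isFlatCell E hE.1).isClosed
  have hxt : x t ∈ ⋃ E ∈ {E ∈ Δ.cells | z ∈ E}, E := by
    refine hcl.mem_of_frequently_of_tendsto (b := 𝓝[<] t) (f := x) (Eventually.frequently ?_)
      (hx.tendsto t |>.mono_left nhdsWithin_le_nhds)
    filter_upwards [Ioo_mem_nhdsLT ht0] with s hs
    obtain ⟨E, hE, hxE⟩ := interior_subset (hless s ⟨hs.1.le, hs.2⟩)
    exact mem_biUnion ⟨hE, hst E hE _ hxE (hxball s ⟨hs.1.le, hs.2.le.trans ht.2⟩)⟩ hxE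
  simp only [mem_iUnion] at hxt
  obtain ⟨E, hE, hxE⟩ := hxt
  obtain ⟨K, hK, hKE, hxK⟩ := exists_carrier hE.1 hxE
  have hzK := hst K hK _ (relint_subset hxK) (hxball t ht)
  have hCK := carrier_subset hC hK hz hzK
  rcases (by have := flatDim_le K; omega : flatDim K + 2 ≤ d ∨ flatDim K + 1 = d ∨ flatDim K = d)
    with h | h | h
  · exact lineMap_not_mem_of_generic (fun h => hqR (mem_region hK h)) (hp K ⟨hK, hzK, h⟩) t
      (relint_subset hxK)
  -- By `facet_interior_iff` interiority is the same at all points of the open facet. The facet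
  -- contains `z'`, and `z'` has points of the open facet arbitrarily near, which are interior.
  · obtain ⟨δ, hδ, hδs⟩ := Metric.mem_nhds_iff.1 (mem_interior_iff_mem_nhds.1
      (by rwa [interior_interior] : z' ∈ interior (interior (region Δ.cells))))
    obtain ⟨f, hf, hfz⟩ := (Δ.isFlatCell K hK).exists_relint_near (hCK (relint_subset hz')) hδ
    exact htn ((facet_interior_iff hK h hxK).2 ((facet_interior_iff hK h hf).1 (hδs hfz)))
  · exact htn (relint_top_subset_interior hK h hxK)

/-- If one point of an open cell is in the interior of the region, so is the whole open cell. -/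
lemma isInternal_of_mem {C : Set (Euc d)} (hC : C ∈ Δ.cells) {z : Euc d}
    (hz : z ∈ intrinsicInterior ℝ C) (hint : z ∈ interior (region Δ.cells)) : Δ.IsInternal C := by
  intro z' hz'
  refine ((Δ.isFlatCell C hC).connected.isPreconnected.induction₂ (fun a b =>
    a ∈ interior (region Δ.cells) ↔ b ∈ interior (region Δ.cells)) (fun p hp => ?_)
    (fun _ _ _ _ _ _ h h' => h.trans h') (fun _ _ _ _ h => h.symm) hz hz').1 hint
  obtain ⟨ε, hε, hst⟩ := exists_star_ball (mem_region hC (relint_subset hp))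
  by_cases h : p ∈ interior (region Δ.cells)
  · filter_upwards [mem_nhdsWithin_of_mem_nhds (isOpen_interior.mem_nhds h)] with q hq
    exact iff_of_true h hq
  · filter_upwards [self_mem_nhdsWithin, mem_nhdsWithin_of_mem_nhds (Metric.ball_mem_nhds p hε)]
      with q hq hqε
    exact iff_of_false h fun hq' => h (mem_interior_of_near hC hp hq hst hqε hq')

/-- The cells that contain an internal cell are internal. -/
lemma IsInternal.mono {G C : Set (Euc d)} (hG : G ∈ Δ.cells) (hC : C ∈ Δ.cells)
    (h : Δ.IsInternal G) (hGC : G ⊆ C) : Δ.IsInternal C := by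
  obtain ⟨y, hy⟩ := nonempty_relint hG
  obtain ⟨δ, hδ, hδs⟩ := Metric.mem_nhds_iff.1 (mem_interior_iff_mem_nhds.1
      (by rw [interior_interior]; exact h hy : y ∈ interior (interior (region Δ.cells))))
  obtain ⟨f, hf, hfz⟩ := (Δ.isFlatCell C hC).exists_relint_near (hGC (relint_subset hy)) hδ
  exact isInternal_of_mem hC hf (hδs hfz)

/-- A ball around a relative interior point of an internal cell is covered by its star. -/
lemma exists_internal_star_ball {G : Set (Euc d)} (hG : G ∈ Δ.cells) (h : Δ.IsInternal G)
    {y : Euc d} (hy : y ∈ intrinsicInterior ℝ G) :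
    ∃ ε > 0, (∀ C ∈ Δ.cells, ∀ z ∈ C, dist z y < ε → y ∈ C) ∧
      Metric.ball y ε ⊆ region Δ.cells := by
  obtain ⟨ε₂, hε₂, hst⟩ := exists_star_ball (mem_region hG (relint_subset hy))
  obtain ⟨ε₁, hε₁, h1⟩ := Metric.mem_nhds_iff.1 (mem_interior_iff_mem_nhds.1 (h hy))
  exact ⟨min ε₁ ε₂, lt_min hε₁ hε₂,
    fun C hC z hz hd => hst C hC z hz (hd.trans_le (min_le_right _ _)),
    (Metric.ball_subset_ball (min_le_left _ _)).trans h1⟩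

lemma mem_lin_of_inner_eq_zero {F B : Set (Euc d)} (hF : F ∈ Δ.cells) (hB : B ∈ Δ.cells)
    (hFB : F ⊆ B) (hdim : flatDim F + 1 = d) (hBd : flatDim B = d) {v : Euc d}
    (h : ⟪innerNormal F B, v⟫ = 0) : v ∈ vectorSpan ℝ F := by
  obtain ⟨hn, hn1, hnp, -⟩ := innerNormal_spec hF hB hFB (by rw [hdim, hBd])
  have := lin_decomp hFB (by rw [hdim, hBd]) hn1 hn hnp (v := v)
    (by rw [vectorSpan_eq_top_iff_flatDim.2 hBd]; trivial)
  rwa [h, zero_smul, sub_zero] at this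

lemma innerNormal_top_neg {F A B : Set (Euc d)} (hF : F ∈ Δ.cells) (hdim : flatDim F + 1 = d)
    (hA : A ∈ Δ.cells) (hB : B ∈ Δ.cells) (hAd : flatDim A = d)
    (hBd : flatDim B = d) (hFA : F ⊆ A) (hFB : F ⊆ B) (hne : A ≠ B) :
    innerNormal F B = -innerNormal F A :=
  innerNormal_neg hF hA hB hFA hFB (by rw [hdim, hAd])
    (by rw [vectorSpan_eq_top_iff_flatDim.2 hAd, vectorSpan_eq_top_iff_flatDim.2 hBd]) hne

/-! ### Generic walks through a star -/

/-- Walking along a generic segment inside a star: a reflexive and transitive relation that holds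
for each crossing of a facet holds between the cells of the end points. -/
lemma walk {y : Euc d} {ε : ℝ} (hst : ∀ C ∈ Δ.cells, ∀ z ∈ C, dist z y < ε → y ∈ C)
    (hreg : Metric.ball y ε ⊆ region Δ.cells) {a b : Euc d} (ha : a ∈ Metric.ball y ε)
    (hb : b ∈ Metric.ball y ε)
    (hgen2 : ∀ E ∈ Δ.cells, y ∈ E → flatDim E + 2 ≤ d → ∀ t ∈ Icc (0 : ℝ) 1,
      AffineMap.lineMap a b t ∉ E)
    (hgen1 : ∀ F ∈ Δ.cells, y ∈ F → flatDim F + 1 = d →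
      a ∉ F ∧ b ∉ F ∧ b - a ∉ vectorSpan ℝ F)
    {R : Δ.TopCell → Δ.TopCell → Prop} (hrefl : ∀ A, R A A)
    (htrans : ∀ A B C, R A B → R B C → R A C)
    (hR : ∀ F ∈ Δ.cells, y ∈ F → flatDim F + 1 = d → ∀ A B : Δ.TopCell, F ⊆ A.1 → F ⊆ B.1 → A ≠ B →
      ∀ t ∈ Ioo (0 : ℝ) 1, AffineMap.lineMap a b t ∈ F → 0 < ⟪innerNormal F B.1, b - a⟫ → R A B)
    {A B : Δ.TopCell} (haA : a ∈ A.1) (hbB : b ∈ B.1) : R A B := by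
  let x : ℝ → Euc d := fun t => AffineMap.lineMap a b t
  have hx : Continuous x := AffineMap.lineMap_continuous
  have hx0 : x 0 = a := AffineMap.lineMap_apply_zero _ _
  have hx1 : x 1 = b := AffineMap.lineMap_apply_one _ _
  have hxball : ∀ t ∈ Icc (0 : ℝ) 1, x t ∈ Metric.ball y ε := fun t ht =>
    (convex_ball y ε).lineMap_mem ha hb ht
  -- the carrier of a point on two top cells is a facet
  have hcar : ∀ t ∈ Icc (0 : ℝ) 1, ∀ A B : Δ.TopCell, A ≠ B → x t ∈ A.1 → x t ∈ B.1 →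
      ∃ F ∈ Δ.cells, y ∈ F ∧ flatDim F + 1 = d ∧ F ⊆ A.1 ∧ F ⊆ B.1 ∧
        x t ∈ intrinsicInterior ℝ F := by
    intro t ht A B hAB hA hB
    obtain ⟨K, hK, hKA, hxK⟩ := exists_carrier A.2.1 hA
    have hKB := carrier_subset hK B.2.1 hxK hB
    have hyK := hst K hK _ (relint_subset hxK) (hxball t ht)
    refine ⟨K, hK, hyK, ?_, hKA, hKB, hxK⟩
    have h1 : ¬ flatDim K + 2 ≤ d := fun h => hgen2 K hK hyK h t ht (relint_subset hxK)
    have h2 : flatDim K ≠ d := by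
      intro h
      have e1 := eq_of_subset_of_dim_le A.2.1 hK hKA (by rw [A.2.2, h])
      have e2 := eq_of_subset_of_dim_le B.2.1 hK hKB (by rw [B.2.2, h])
      exact hAB (Subtype.ext (e1.symm.trans e2))
    have := flatDim_le K
    omega
  by_contra hcon
  -- The parameters at which some covering cell is not yet related to `A`. Their infimum is
  -- attained, and it must be the crossing of a facet, where `hR` gives a contradiction.
  let bad : Set ℝ := {t | t ∈ Icc (0 : ℝ) 1 ∧ ∃ B : Δ.TopCell, x t ∈ B.1 ∧ ¬ R A B}
  have hbad1 : (1 : ℝ) ∈ bad := ⟨by simp, B, by rwa [hx1], hcon⟩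
  have hbdd : BddBelow bad := ⟨0, fun t ht => ht.1.1⟩
  set t₀ := sInf bad with ht₀
  have ht₀0 : 0 ≤ t₀ := le_csInf ⟨1, hbad1⟩ fun t ht => ht.1.1
  have ht₀1 : t₀ ≤ 1 := csInf_le hbdd hbad1
  have hgood : ∀ t ∈ Icc (0 : ℝ) 1, t < t₀ → ∀ B : Δ.TopCell, x t ∈ B.1 → R A B := by
    intro t ht hlt B hB
    by_contra h
    exact absurd (csInf_le hbdd ⟨ht, B, hB, h⟩) (not_le.2 hlt)
  obtain ⟨η, hη, hstη⟩ := exists_star_ball (hreg (hxball t₀ ⟨ht₀0, ht₀1⟩))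
  have hnear : ∀ᶠ t in 𝓝 t₀, dist (x t) (x t₀) < η :=
    (hx.tendsto t₀).eventually (Metric.ball_mem_nhds _ hη)
  by_cases hbad : t₀ ∈ bad
  · obtain ⟨-, B, hB, hRB⟩ := hbad
    have hpos : 0 < t₀ := by
      rcases ht₀0.eq_or_lt with h | h
      · exfalso
        by_cases hAB : A = B
        · subst hAB; exact hRB (hrefl _)
        · obtain ⟨F, hF, hyF, hFd, hFA, hFB, hxF⟩ := hcar t₀ ⟨ht₀0, ht₀1⟩ A B hAB
            (by rw [← h, hx0]; exact haA) hB
          rw [← h, hx0] at hxF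
          exact (hgen1 F hF hyF hFd).1 (relint_subset hxF)
      · exact h
    -- the facet crossed, if any, does not depend on the preceding cell
    obtain ⟨K, hK, hKB, hxK⟩ := exists_carrier B.2.1 hB
    have hhalf : ∀ᶠ t in 𝓝 t₀, flatDim K + 1 = d → ∀ B ∈ Δ.cells, flatDim B = d → K ⊆ B →
        (x t ∈ B ↔ 0 ≤ ⟪innerNormal K B, x t - x t₀⟫) := by
      by_cases hKd : flatDim K + 1 = d
      · obtain ⟨δ, hδ, H⟩ := exists_uniform_half hK hKd hxK
        filter_upwards [(hx.tendsto t₀).eventually (Metric.ball_mem_nhds _ hδ)] with t ht _ B hB hBd hKB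
        have := H B hB hBd hKB (x t - x t₀) (by rwa [dist_eq_norm] at ht)
        rwa [add_sub_cancel] at this
      · exact Eventually.of_forall fun t h => absurd h hKd
    obtain ⟨t, ⟨ht1, ht2⟩, ht3⟩ := (((hnear.and hhalf).filter_mono nhdsWithin_le_nhds).and
      (Ioo_mem_nhdsLT hpos)).exists
    have htI : t ∈ Icc (0 : ℝ) 1 := ⟨ht3.1.le, ht3.2.le.trans ht₀1⟩
    obtain ⟨B', hB', hB'd, hxB'⟩ := exists_top_of_mem_region (hreg (hxball t htI))
    have hRB' : R A ⟨B', hB', hB'd⟩ := hgood t htI ht3.2 ⟨B', hB', hB'd⟩ hxB'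
    have hx₀B' : x t₀ ∈ B' := hstη B' hB' _ hxB' ht1
    by_cases hBB : (⟨B', hB', hB'd⟩ : Δ.TopCell) = B
    · rw [hBB] at hRB'; exact hRB hRB'
    obtain ⟨F, hF, hyF, hFd, hFB', hFB, hxF⟩ := hcar t₀ ⟨ht₀0, ht₀1⟩ ⟨B', hB', hB'd⟩ B hBB hx₀B' hB
    obtain rfl := carrier_unique hK hF hxK hxF
    have ht₀lt : t₀ < 1 := by
      refine lt_of_le_of_ne ht₀1 fun h => ?_
      rw [h, hx1] at hxF
      exact (hgen1 K hF hyF hFd).2.1 (relint_subset hxF)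
    have h1 := (ht2 hFd B' hB' hB'd hFB').1 hxB'
    have e : x t - x t₀ = (t - t₀) • (b - a) := by
      simp only [x, AffineMap.lineMap_apply, vsub_eq_sub, vadd_eq_add]
      rw [sub_smul]; abel
    rw [e, inner_smul_right] at h1
    have h2 : ⟪innerNormal K B', b - a⟫ ≠ 0 := fun h0 =>
      (hgen1 K hF hyF hFd).2.2 (mem_lin_of_inner_eq_zero hF hB' hFB' hFd hB'd h0)
    -- The point just before the crossing is in `B'`, so the walk leaves `B'` there and enters `B`.
    have h3 : ⟪innerNormal K B', b - a⟫ < 0 := by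
      refine lt_of_le_of_ne ?_ h2
      by_contra hlt
      nlinarith [ht3.2]
    refine hRB (htrans _ _ _ hRB' (hR K hF hyF hFd _ B hFB' hFB hBB t₀ ⟨hpos, ht₀lt⟩
      (relint_subset hxF) ?_))
    rw [innerNormal_top_neg hF hFd hB' B.2.1 hB'd B.2.2 hFB' hFB
      (fun h => hBB (Subtype.ext h)), inner_neg_left]
    linarith
  -- The infimum is attained: cells covering bad points close to `x t₀` contain `x t₀` as well.
  · obtain ⟨δ, hδ, hδ'⟩ := Metric.eventually_nhds_iff.1 hnear
    obtain ⟨t, ht, htlt⟩ := exists_lt_of_csInf_lt ⟨1, hbad1⟩ (show sInf bad < t₀ + δ by linarith)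
    have htge := csInf_le hbdd ht
    obtain ⟨htI, B, hB, hRB⟩ := ht
    refine hbad ⟨⟨ht₀0, ht₀1⟩, B, hstη B.1 B.2.1 _ hB (hδ' ?_), hRB⟩
    rw [Real.dist_eq, abs_lt]; constructor <;> linarith

end CellDecomposition

/-- A vector is zero if it is orthogonal to the points of a nonempty open set. -/
lemma eq_zero_of_inner_eq_zero_on_open {E : Type*} [NormedAddCommGroup E] [InnerProductSpace ℝ E]
    {O : Set E} (hO : IsOpen O) (hne : O.Nonempty) {v y : E} (h : ∀ z ∈ O, ⟪v, z - y⟫ = 0) : v = 0 := by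
  obtain ⟨z, hz⟩ := hne
  have hc : Tendsto (fun t : ℝ => z + t • v) (𝓝 0) (𝓝 (z + (0 : ℝ) • v)) :=
    (continuous_const.add (continuous_id.smul continuous_const)).tendsto 0
  rw [zero_smul, add_zero] at hc
  have h1 : ∀ᶠ t : ℝ in 𝓝[>] 0, z + t • v ∈ O :=
    (hc.eventually (hO.mem_nhds hz)).filter_mono nhdsWithin_le_nhds
  obtain ⟨t, ht, ht0⟩ := (h1.and self_mem_nhdsWithin).exists
  have h2 := h _ ht
  have h3 := h z hz
  rw [add_sub_right_comm, inner_add_right, h3, zero_add, inner_smul_right,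
    real_inner_self_eq_norm_sq] at h2
  have h4 := (mul_eq_zero.1 h2).resolve_left (ne_of_gt ht0)
  exact norm_eq_zero.1 (by simpa using h4)

/-- The points of a convex hull that maximize a linear function. -/
lemma mem_convexHull_max {E : Type*} [AddCommGroup E] [Module ℝ E] {S : Set E} (l : E →ₗ[ℝ] ℝ)
    {M : ℝ} (hS : ∀ q ∈ S, l q ≤ M) {p : E} (hp : p ∈ convexHull ℝ S) (hpM : l p = M) :
    p ∈ convexHull ℝ {q ∈ S | l q = M} := by
  have key : convexHull ℝ S ⊆ {p | l p ≤ M ∧ (l p = M → p ∈ convexHull ℝ {q ∈ S | l q = M})} := by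
    refine convexHull_min (fun q hq => ⟨hS q hq, fun h => subset_convexHull ℝ _ ⟨hq, h⟩⟩) ?_
    rintro q ⟨hq1, hq2⟩ q' ⟨hq1', hq2'⟩ a b ha hb hab
    have e : l (a • q + b • q') = a * l q + b * l q' := by simp
    have hM : a * M + b * M = M := by rw [← add_mul, hab, one_mul]
    have h1 : a * l q ≤ a * M := mul_le_mul_of_nonneg_left hq1 ha
    have h2 : b * l q' ≤ b * M := mul_le_mul_of_nonneg_left hq1' hb
    refine ⟨by rw [e]; linarith, fun h => ?_⟩
    rw [e] at h
    rcases ha.eq_or_lt with rfl | ha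
    · have : b = 1 := by linarith
      subst this
      simp only [zero_smul, one_smul, zero_add]
      exact hq2' (by linarith)
    rcases hb.eq_or_lt with rfl | hb
    · have : a = 1 := by linarith
      subst this
      simp only [zero_smul, one_smul, add_zero]
      exact hq2 (by linarith)
    have h3 : l q = M := mul_left_cancel₀ ha.ne' (by linarith)
    have h4 : l q' = M := mul_left_cancel₀ hb.ne' (by linarith)
    exact (convex_convexHull ℝ _) (hq2 h3) (hq2' h4) ha.le hb.le hab
  exact (key hp).2 hpM

namespace CellDecomposition

variable {d : ℕ} {Δ : CellDecomposition d}

/-- The end points of a segment can be moved slightly to make the segment generic. -/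
lemma exists_generic_pair (y : Euc d) {U₁ U₂ : Set (Euc d)} (h₁ : IsOpen U₁) (h₂ : IsOpen U₂)
    (hne₁ : U₁.Nonempty) (hne₂ : U₂.Nonempty) :
    ∃ a ∈ U₁, ∃ b ∈ U₂,
      (∀ E ∈ Δ.cells, y ∈ E → flatDim E + 2 ≤ d → ∀ t ∈ Icc (0 : ℝ) 1,
        AffineMap.lineMap a b t ∉ E) ∧
      (∀ F ∈ Δ.cells, y ∈ F → flatDim F + 1 = d →
        a ∉ F ∧ b ∉ F ∧ b - a ∉ vectorSpan ℝ F) := by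
  have hfin : {E ∈ Δ.cells | y ∈ E}.Finite := finite_cells_at y
  obtain ⟨b, hb, hbg⟩ := exists_generic_point (s := {E ∈ Δ.cells | y ∈ E ∧ flatDim E < d})
    (hfin.subset fun E hE => ⟨hE.1, hE.2.1⟩) (fun E => affineSpan ℝ E)
    (fun E hE => affineSpan_ne_top hE.2.2) h₂ hne₂
  -- With `b` fixed, `a` has to avoid three kinds of proper flats: the joins of `b` with cells of
  -- codimension two, the spans of the cells, and their translates through `b`, which excludes
  -- segments parallel to a facet.
  obtain ⟨a, ha, hag⟩ := exists_generic_point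
    (s := (fun E => affineSpan ℝ (insert b E)) '' {E ∈ Δ.cells | y ∈ E ∧ flatDim E + 2 ≤ d} ∪
      ((fun E => affineSpan ℝ E) '' {E ∈ Δ.cells | y ∈ E ∧ flatDim E < d} ∪
      (fun E => AffineSubspace.mk' b (vectorSpan ℝ E)) '' {E ∈ Δ.cells | y ∈ E ∧ flatDim E < d}))
    (((hfin.subset fun E hE => ⟨hE.1, hE.2.1⟩).image _).union
      (((hfin.subset fun E hE => ⟨hE.1, hE.2.1⟩).image _).union
      ((hfin.subset fun E hE => ⟨hE.1, hE.2.1⟩).image _))) id (by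
      rintro _ (⟨E, hE, rfl⟩ | ⟨E, hE, rfl⟩ | ⟨E, hE, rfl⟩)
      · exact affineSpan_ne_top ((Nat.lt_succ_of_le (flatDim_insert_le E b)).trans_le hE.2.2)
      · exact affineSpan_ne_top hE.2.2
      · intro htop
        have := congrArg AffineSubspace.direction htop
        simp only [id_eq, AffineSubspace.direction_mk', AffineSubspace.direction_top] at this
        rw [vectorSpan_eq_top_iff_flatDim] at this
        have := hE.2.2
        omega) h₁ hne₁
  refine ⟨a, ha, b, hb, fun E hE hyE hd t _ => ?_, fun F hF hyF hd => ⟨?_, ?_, ?_⟩⟩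
  · refine lineMap_not_mem_of_generic (fun h => ?_) (hag _ (Or.inl ⟨E, ⟨hE, hyE, hd⟩, rfl⟩)) t
    exact hbg E ⟨hE, hyE, by omega⟩ (subset_affineSpan ℝ _ h)
  · exact fun h => hag _ (Or.inr (Or.inl ⟨F, ⟨hF, hyF, by omega⟩, rfl⟩)) (subset_affineSpan ℝ _ h)
  · exact fun h => hbg F ⟨hF, hyF, by omega⟩ (subset_affineSpan ℝ _ h)
  · intro h
    refine hag _ (Or.inr (Or.inr ⟨F, ⟨hF, hyF, by omega⟩, rfl⟩)) ?_
    rw [id, AffineSubspace.mem_mk', vsub_eq_sub, ← neg_sub]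
    exact Submodule.neg_mem _ h

/-- Between any two open sets in a star there is a generic segment, so that each reflexive and
transitive relation that holds for the facets crossed by it holds between its ends. -/
lemma exists_walk {y : Euc d} {ε : ℝ} (hst : ∀ C ∈ Δ.cells, ∀ z ∈ C, dist z y < ε → y ∈ C)
    (hreg : Metric.ball y ε ⊆ region Δ.cells) {U₁ U₂ : Set (Euc d)} (h₁ : IsOpen U₁)
    (h₂ : IsOpen U₂) (hne₁ : U₁.Nonempty) (hne₂ : U₂.Nonempty) (hs₁ : U₁ ⊆ Metric.ball y ε)
    (hs₂ : U₂ ⊆ Metric.ball y ε) :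
    ∃ a ∈ U₁, ∃ b ∈ U₂, ∀ R : Δ.TopCell → Δ.TopCell → Prop, (∀ A, R A A) →
      (∀ A B C, R A B → R B C → R A C) →
      (∀ (F : Δ.StressCell d) (A B : Δ.TopCell), y ∈ F.1 → F.1 ⊆ A.1 → F.1 ⊆ B.1 → A ≠ B →
        0 < ⟪innerNormal F.1 B.1, b - y⟫ → R A B) →
      ∀ A B : Δ.TopCell, a ∈ A.1 → b ∈ B.1 → R A B := by
  obtain ⟨a, ha, b, hb, hg2, hg1⟩ := exists_generic_pair (Δ := Δ) y h₁ h₂ hne₁ hne₂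
  refine ⟨a, ha, b, hb, fun R hrefl htrans hR A B haA hbB =>
    walk hst hreg (hs₁ ha) (hs₂ hb) hg2 hg1 hrefl htrans ?_ haA hbB⟩
  intro F hF hyF hFd A B hFA hFB hAB t ht hxF hpos
  refine hR ⟨F, hF, hFd⟩ A B hyF hFA hFB hAB ?_
  obtain ⟨-, -, hperp, -⟩ := innerNormal_spec hF B.2.1 hFB (by rw [hFd, B.2.2])
  -- The crossing point differs from `y` by a vector parallel to `F`, so the direction of crossing
  -- has the same sign against the normal as `b - y`. This makes the condition depend only on the
  -- end point `b`.
  have e : b - y = (1 - t) • (b - a) + (AffineMap.lineMap a b t - y) := by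
    simp only [AffineMap.lineMap_apply, vsub_eq_sub, vadd_eq_add]
    rw [sub_smul, one_smul]; abel
  rw [e, inner_add_right, inner_smul_right, real_inner_comm _ (innerNormal F B.1),
    real_inner_comm _ (innerNormal F B.1), hperp _ (sub_mem_lin hxF hyF), add_zero,
    real_inner_comm]
  exact mul_pos (by linarith [ht.2]) hpos

lemma exists_relint_ball {C : Set (Euc d)} (hC : C ∈ Δ.cells) {y : Euc d} (hy : y ∈ C) {ε : ℝ}
    (hε : 0 < ε) : (intrinsicInterior ℝ C ∩ Metric.ball y ε).Nonempty := by
  obtain ⟨z, hz, hd⟩ := (Δ.isFlatCell C hC).exists_relint_near hy hε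
  exact ⟨z, hz, hd⟩

lemma isOpen_relint_top (A : Δ.TopCell) : IsOpen (intrinsicInterior ℝ A.1) := by
  rw [interior_eq_relint (vectorSpan_eq_top_iff_flatDim.2 A.2.2)]
  exact isOpen_interior

/-- The differences of a reciprocal are linear polynomials in the coefficients of the stress. -/
lemma exists_poly_diff {G : Set (Euc d)} (hG : G ∈ Δ.cells) (hint : Δ.IsInternal G)
    (w : Set (Euc d) → ℝ) (A B : Δ.TopCell) (hGA : G ⊆ A.1) (hGB : G ⊆ B.1) :
    ∃ L : Fin d → MvPolynomial (Δ.StressCell d) ℝ, (∀ i, (L i).IsHomogeneous 1) ∧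
      ∀ s r, Δ.IsReciprocal w s G r → ∀ i, (r B - r A) i = MvPolynomial.eval s (L i) := by
  obtain ⟨y, hy⟩ := nonempty_relint hG
  obtain ⟨ε, hε, hst, hreg⟩ := exists_internal_star_ball hG hint hy
  obtain ⟨a, ha, b, hb, H⟩ := exists_walk hst hreg
    ((isOpen_relint_top A).inter Metric.isOpen_ball) ((isOpen_relint_top B).inter Metric.isOpen_ball)
    (exists_relint_ball A.2.1 (hGA (relint_subset hy)) hε)
    (exists_relint_ball B.2.1 (hGB (relint_subset hy)) hε) inter_subset_right inter_subset_right
  -- The linear forms add up along the walk. The walk is chosen before `s` and `r`, so the same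
  -- forms serve for all of them.
  refine H (fun A B => ∃ L : Fin d → MvPolynomial (Δ.StressCell d) ℝ,
    (∀ i, (L i).IsHomogeneous 1) ∧
      ∀ s r, Δ.IsReciprocal w s G r → ∀ i, (r B - r A) i = MvPolynomial.eval s (L i)) ?_ ?_ ?_ A B
      (relint_subset ha.1) (relint_subset hb.1)
  · exact fun A => ⟨0, fun i => MvPolynomial.isHomogeneous_zero _ _ _, fun s r _ i => by simp⟩
  · rintro A B C ⟨L, hL, h⟩ ⟨L', hL', h'⟩
    refine ⟨L + L', fun i => (hL i).add (hL' i), fun s r hr i => ?_⟩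
    rw [Pi.add_apply, map_add, ← h s r hr, ← h' s r hr]
    simp
  · intro F A B hyF hFA hFB hAB _
    refine ⟨fun i => MvPolynomial.C (w F.1 * innerNormal F.1 B.1 i) * MvPolynomial.X F,
      fun i => ?_, fun s r hr i => ?_⟩
    · have := (MvPolynomial.isHomogeneous_C (Δ.StressCell d) (w F.1 * innerNormal F.1 B.1 i)).mul
        (MvPolynomial.isHomogeneous_X ℝ F)
      simpa using this
    · rw [hr F A B (carrier_subset hG F.2.1 hy hyF) hFA hFB hAB]
      simp; ring

/-! ### Convexity of the piecewise linear function of a reciprocal -/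

section Support

variable {G : Set (Euc d)} (hG : G ∈ Δ.cells) {y : Euc d} (hy : y ∈ intrinsicInterior ℝ G)
  {ε : ℝ} (hst : ∀ C ∈ Δ.cells, ∀ z ∈ C, dist z y < ε → y ∈ C)
  (hreg : Metric.ball y ε ⊆ region Δ.cells)
  {w : Set (Euc d) → ℝ} {s : Δ.StressCell d → ℝ} {r : Δ.TopCell → Euc d}
  (hr : Δ.IsReciprocal w s G r)

include hG hy hst hreg hr

/-- The piecewise linear function with the gradients `r A` is the maximum of its pieces. -/
lemma inner_reciprocal_le (hs : ∀ F : Δ.StressCell d, G ⊆ F.1 → 0 ≤ s F * w F.1)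
    {x : Euc d} (hx : x ∈ Metric.ball y ε)
    (A B : Δ.TopCell) (hGA : G ⊆ A.1) (hxB : x ∈ B.1) : ⟪r A, x - y⟫ ≤ ⟪r B, x - y⟫ := by
  have hε : 0 < ε := dist_nonneg.trans_lt hx
  by_contra! hlt
  -- A violation at `x` persists nearby, so it also occurs at a generic end point `b` in the open
  -- cell of `B`.
  have hopen : IsOpen {b : Euc d | ⟪r B, b - y⟫ < ⟪r A, b - y⟫} :=
    isOpen_lt (continuous_const.inner (continuous_id.sub continuous_const))
      (continuous_const.inner (continuous_id.sub continuous_const))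
  obtain ⟨δ, hδ, hδs⟩ := Metric.mem_nhds_iff.1
    ((hopen.inter Metric.isOpen_ball).mem_nhds ⟨hlt, hx⟩)
  obtain ⟨a, ha, b, hb, H⟩ := exists_walk hst hreg
    ((isOpen_relint_top A).inter Metric.isOpen_ball)
    ((isOpen_relint_top B).inter Metric.isOpen_ball)
    (exists_relint_ball A.2.1 (hGA (relint_subset hy)) hε)
    (exists_relint_ball B.2.1 hxB hδ) inter_subset_right
    (inter_subset_right.trans (hδs.trans inter_subset_right))
  -- Each crossing adds to the gradient a non-negative multiple of a normal that has positive inner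
  -- product with `b - y`.
  have h1 := H (fun X Y => ⟪r X, b - y⟫ ≤ ⟪r Y, b - y⟫) (fun _ => le_rfl)
    (fun _ _ _ => le_trans) (fun F X Y hyF hFX hFY hXY hpos => by
      have hGF := carrier_subset hG F.2.1 hy hyF
      have := hr F X Y hGF hFX hFY hXY
      rw [← sub_nonneg, ← inner_sub_left, this, inner_smul_left]
      exact mul_nonneg (hs F hGF) hpos.le) A B (relint_subset ha.1) (relint_subset hb.1)
  exact absurd (hδs hb.2).1 (not_lt.2 h1)

/-- A positive reciprocal is injective on the star. -/
lemma reciprocal_injOn (hs : ∀ F : Δ.StressCell d, G ⊆ F.1 → 0 < s F * w F.1) (hε : 0 < ε)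
    (A B : Δ.TopCell) (hGA : G ⊆ A.1) (hGB : G ⊆ B.1) (hAB : r A = r B) : A = B := by
  obtain ⟨a, ha, b, hb, H⟩ := exists_walk hst hreg
    ((isOpen_relint_top A).inter Metric.isOpen_ball)
    ((isOpen_relint_top B).inter Metric.isOpen_ball)
    (exists_relint_ball A.2.1 (hGA (relint_subset hy)) hε)
    (exists_relint_ball B.2.1 (hGB (relint_subset hy)) hε) inter_subset_right inter_subset_right
  -- With positive coefficients each crossing strictly increases the value at `b`. Equal gradients
  -- at the two ends therefore force a walk without crossings.
  have h1 := H (fun X Y => X = Y ∨ ⟪r X, b - y⟫ < ⟪r Y, b - y⟫) (fun _ => Or.inl rfl)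
    (fun X Y Z h h' => by
      rcases h with rfl | h
      · exact h'
      · rcases h' with rfl | h'
        · exact Or.inr h
        · exact Or.inr (h.trans h')) (fun F X Y hyF hFX hFY hXY hpos => by
      right
      have hGF := carrier_subset hG F.2.1 hy hyF
      have := hr F X Y hGF hFX hFY hXY
      rw [← sub_pos, ← inner_sub_left, this, inner_smul_left]
      exact mul_pos (hs F hGF) hpos) A B (relint_subset ha.1) (relint_subset hb.1)
  refine h1.resolve_right ?_
  rw [hAB]; exact lt_irrefl _

/-- A piece that is maximal at `x` is the gradient at a cell that contains `x`. -/
lemma exists_mem_of_inner_eq (hs : ∀ F : Δ.StressCell d, G ⊆ F.1 → 0 ≤ s F * w F.1)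
    {x : Euc d} (hx : x ∈ Metric.ball y ε) (A B : Δ.TopCell) (hGA : G ⊆ A.1)
    (hxB : x ∈ B.1) (heq : ⟪r A, x - y⟫ = ⟪r B, x - y⟫) :
    ∃ B' : Δ.TopCell, x ∈ B'.1 ∧ r B' = r A := by
  have hε : 0 < ε := dist_nonneg.trans_lt hx
  obtain ⟨η, hη, hstη⟩ := exists_star_ball (hreg hx)
  obtain ⟨a, haA, hab⟩ := exists_relint_ball A.2.1 (hGA (relint_subset hy)) hε
  -- points close to `x` on the segments from interior points of `A` to `x`
  have hc : Tendsto (fun t : ℝ => AffineMap.lineMap a x t) (𝓝[<] 1) (𝓝 x) := by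
    have : Tendsto (fun t : ℝ => AffineMap.lineMap a x t) (𝓝 1) (𝓝 (AffineMap.lineMap a x (1:ℝ))) :=
      AffineMap.lineMap_continuous.tendsto 1
    rw [AffineMap.lineMap_apply_one] at this
    exact this.mono_left nhdsWithin_le_nhds
  obtain ⟨t, ht, ht01⟩ := ((hc.eventually (Metric.ball_mem_nhds x hη)).and
    (Ioo_mem_nhdsLT (zero_lt_one' ℝ))).exists
  have ht1 : 0 < 1 - t := by linarith [ht01.2]
  -- The expansion with centre `x` that undoes the motion from `a` towards `x`. Points near the
  -- moved point are carried back into the open cell of `A`.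
  let g : Euc d → Euc d := fun z => (1 - t)⁻¹ • (z - t • x)
  have hg : Continuous g := by fun_prop
  have hga : ∀ z, z = (1 - t) • g z + t • x := by
    intro z; simp only [g]; rw [smul_smul, mul_inv_cancel₀ ht1.ne', one_smul]; abel
  let O : Set (Euc d) := (g ⁻¹' (intrinsicInterior ℝ A.1 ∩ Metric.ball y ε)) ∩ Metric.ball x η
  have hO : IsOpen O :=
    (((isOpen_relint_top A).inter Metric.isOpen_ball).preimage hg).inter Metric.isOpen_ball
  have hOball : O ⊆ Metric.ball y ε := by
    intro z hz
    rw [hga z]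
    exact (convex_ball y ε) hz.1.2 hx ht1.le ht01.1.le (by ring)
  have haO : AffineMap.lineMap a x t ∈ O := by
    have : g (AffineMap.lineMap a x t) = a := by
      simp only [g, AffineMap.lineMap_apply, vsub_eq_sub, vadd_eq_add]
      have : t • (x - a) + a - t • x = (1 - t) • a := by
        rw [smul_sub, sub_smul, one_smul]; abel
      rw [this, smul_smul, inv_mul_cancel₀ ht1.ne', one_smul]
    refine ⟨?_, ht⟩
    rw [mem_preimage, this]
    exact ⟨haA, hab⟩
  obtain ⟨B', hB', hB'd, haB'⟩ := exists_top_of_mem_region (hreg (hOball haO))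
  obtain ⟨δ, hδ, hδs⟩ := Metric.mem_nhds_iff.1 (hO.mem_nhds haO)
  have hne := exists_relint_ball hB' haB' hδ
  have hxB' : x ∈ B' := hstη B' hB' _ haB' ht
  have hGB' : G ⊆ B' := carrier_subset hG hB' hy (hst B' hB' x hxB' hx)
  refine ⟨⟨B', hB', hB'd⟩, hxB', ?_⟩
  -- The pieces of `A` and `B'` agree on an open set: there `B'` is maximal, while each such point
  -- is a convex combination of `x` and a point of `A`, and the piece of `A` is maximal at both.
  refine sub_eq_zero.1 (eq_zero_of_inner_eq_zero_on_open
    ((isOpen_relint_top ⟨B', hB', hB'd⟩).inter Metric.isOpen_ball) hne (y := y) fun z hz => ?_)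
  have hzO := hδs hz.2
  have h1 := inner_reciprocal_le hG hy hst hreg hr hs (hOball hzO) A ⟨B', hB', hB'd⟩ hGA
    (relint_subset hz.1)
  have h2 := inner_reciprocal_le hG hy hst hreg hr hs hzO.1.2 ⟨B', hB', hB'd⟩ A hGB'
    (relint_subset hzO.1.1)
  have h3 := inner_reciprocal_le hG hy hst hreg hr hs hx ⟨B', hB', hB'd⟩ B hGB' hxB
  have e : z - y = (1 - t) • (g z - y) + t • (x - y) := by
    conv_lhs => rw [hga z]
    module
  have h4 : ⟪r ⟨B', hB', hB'd⟩, z - y⟫ ≤ ⟪r A, z - y⟫ := by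
    rw [e, inner_add_right, inner_add_right]
    simp only [inner_smul_right]
    exact add_le_add (mul_le_mul_of_nonneg_left h2 ht1.le)
      (mul_le_mul_of_nonneg_left (h3.trans heq.ge) ht01.1.le)
  rw [inner_sub_left]
  linarith

/-- The face of the dual polytope in the direction of a point near `G`. -/
lemma face_eq_dualFace (hs : ∀ F : Δ.StressCell d, G ⊆ F.1 → 0 ≤ s F * w F.1)
    {x : Euc d} (hx : x ∈ Metric.ball y ε) {K : Set (Euc d)} (hK : K ∈ Δ.cells)
    (hxK : x ∈ intrinsicInterior ℝ K) :
    {p ∈ dualFace r G | ∀ q ∈ dualFace r G, ⟪q, x - y⟫ ≤ ⟪p, x - y⟫} = dualFace r K := by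
  have hGK : G ⊆ K := carrier_subset hG hK hy (hst K hK x (relint_subset hxK) hx)
  obtain ⟨B, hB, hBd, hKB⟩ := Δ.pure K hK
  have hxB : x ∈ B := hKB (relint_subset hxK)
  let l : Euc d →ₗ[ℝ] ℝ := (innerₗ (Euc d)).flip (x - y)
  have hl : ∀ q, l q = ⟪q, x - y⟫ := fun q => rfl
  set M := ⟪r ⟨B, hB, hBd⟩, x - y⟫ with hM
  have hle : ∀ q ∈ r '' {A | G ⊆ A.1}, l q ≤ M := by
    rintro _ ⟨A, hA, rfl⟩
    exact inner_reciprocal_le hG hy hst hreg hr hs hx A ⟨B, hB, hBd⟩ hA hxB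
  have hle' : ∀ q ∈ dualFace r G, l q ≤ M := by
    have : dualFace r G ⊆ l ⁻¹' Iic M := convexHull_min hle ((convex_Iic M).linear_preimage l)
    exact fun q hq => this hq
  have hKM : ∀ q ∈ dualFace r K, l q = M := by
    have : dualFace r K ⊆ l ⁻¹' {M} := by
      refine convexHull_min ?_ ((convex_singleton M).linear_preimage l)
      rintro _ ⟨A, hA, rfl⟩
      exact le_antisymm (hle _ ⟨A, hGK.trans hA, rfl⟩)
        (inner_reciprocal_le hG hy hst hreg hr hs hx ⟨B, hB, hBd⟩ A (hGK.trans hKB)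
          (hA (relint_subset hxK)))
    exact fun q hq => this hq
  have hBG : r ⟨B, hB, hBd⟩ ∈ dualFace r G := subset_convexHull ℝ _ ⟨_, hGK.trans hKB, rfl⟩
  apply Subset.antisymm
  · rintro p ⟨hp, hmax⟩
    have hpM : l p = M := le_antisymm (hle' p hp) (hmax _ hBG)
    -- The face is the hull of the maximal vertices, and each of these is also the gradient at a top
    -- cell containing `x`, hence containing `K`.
    refine convexHull_mono ?_ (mem_convexHull_max l hle hp hpM)
    rintro _ ⟨⟨A, hA, rfl⟩, hAM⟩
    obtain ⟨B', hxB', hB'A⟩ := exists_mem_of_inner_eq hG hy hst hreg hr hs hx A ⟨B, hB, hBd⟩ hA hxB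
      hAM
    exact ⟨B', carrier_subset hK B'.2.1 hxK hxB', hB'A⟩
  · intro p hp
    refine ⟨convexHull_mono (image_mono fun A hA => hGK.trans hA) hp, fun q hq => ?_⟩
    have h1 := hle' q hq
    have h2 := hKM p hp
    rw [hl] at h1 h2
    linarith

end Support

end CellDecomposition

lemma vectorSpan_convexHull_eq {E : Type*} [AddCommGroup E] [Module ℝ E] (S : Set E) :
    vectorSpan ℝ (convexHull ℝ S) = vectorSpan ℝ S := by
  rw [← direction_affineSpan, affineSpan_convexHull, direction_affineSpan]

/-- The part of a flat disc on one side of a hyperplane is convex. -/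
lemma convex_half_disc {d : ℕ} (W : Submodule ℝ (Euc d)) (x v : Euc d) (δ : ℝ) :
    Convex ℝ {p : Euc d | p - x ∈ W ∧ ‖p - x‖ < δ ∧ 0 < ⟪v, p - x⟫} := by
  have h1 : Convex ℝ ((W : Set (Euc d)) ∩ (Metric.ball 0 δ ∩ {p | 0 < ⟪v, p⟫})) :=
    (Submodule.convex W).inter ((convex_ball (0 : Euc d) δ).inter
      (convex_halfSpace_gt (innerₛₗ ℝ v).isLinear 0))
  have e : {p : Euc d | p - x ∈ W ∧ ‖p - x‖ < δ ∧ 0 < ⟪v, p - x⟫} = (fun p => p + -x) ⁻¹'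
      ((W : Set (Euc d)) ∩ (Metric.ball 0 δ ∩ {p | 0 < ⟪v, p⟫})) := by
    ext p
    simp only [← sub_eq_add_neg, mem_ofPred_eq, mem_preimage, mem_inter_iff, SetLike.mem_coe,
      mem_ball_zero_iff]
  rw [e]
  exact h1.translate_preimage_left (-x)

/-! ### The dual polytope of a star -/

namespace CellDecomposition

variable {d : ℕ} {Δ : CellDecomposition d}

/-- The directions perpendicular to the face dual to `K`. -/
def dualPerp (r : Δ.TopCell → Euc d) (K : Set (Euc d)) : Submodule ℝ (Euc d) :=
  (vectorSpan ℝ (dualFace r K))ᗮ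

lemma mem_dualPerp {r : Δ.TopCell → Euc d} {K : Set (Euc d)} {u : Euc d} :
    u ∈ dualPerp r K ↔ ∀ A B : Δ.TopCell, K ⊆ A.1 → K ⊆ B.1 → ⟪r A - r B, u⟫ = 0 := by
  unfold dualPerp dualFace
  rw [vectorSpan_convexHull_eq, Submodule.mem_orthogonal]
  constructor
  · exact fun h A B hA hB => h _ (sub_mem_lin ⟨A, hA, rfl⟩ ⟨B, hB, rfl⟩)
  · intro h a ha
    have : vectorSpan ℝ (r '' {A | K ⊆ A.1}) ≤ LinearMap.ker ((innerₗ (Euc d)).flip u) := by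
      rw [vectorSpan_def, Submodule.span_le]
      rintro _ ⟨_, ⟨A, hA, rfl⟩, _, ⟨B, hB, rfl⟩, rfl⟩
      exact h A B hA hB
    exact this ha

lemma dualPerp_congr {r : Δ.TopCell → Euc d} {K L : Set (Euc d)}
    (h : ∀ A : Δ.TopCell, K ⊆ A.1 ↔ L ⊆ A.1) : dualPerp r K = dualPerp r L := by
  ext u
  simp only [mem_dualPerp, h]

lemma isReciprocal_mono {w : Set (Euc d) → ℝ} {s : Δ.StressCell d → ℝ} {G C : Set (Euc d)}
    {r : Δ.TopCell → Euc d} (h : Δ.IsReciprocal w s G r) (hGC : G ⊆ C) :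
    Δ.IsReciprocal w s C r :=
  fun F A B hF hFA hFB hAB => h F A B (hGC.trans hF) hFA hFB hAB

lemma finrank_dualPerp (r : Δ.TopCell → Euc d) (K : Set (Euc d)) :
    flatDim (dualFace r K) + Module.finrank ℝ (dualPerp r K) = d := by
  unfold flatDim dualPerp
  rw [Submodule.finrank_add_finrank_orthogonal]
  simp

/-- The dual face of a cell is perpendicular to the cell. -/
lemma lin_le_dualPerp {G : Set (Euc d)} (hG : G ∈ Δ.cells) (hint : Δ.IsInternal G)
    {w : Set (Euc d) → ℝ} {s : Δ.StressCell d → ℝ} {r : Δ.TopCell → Euc d}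
    (hr : Δ.IsReciprocal w s G r) (hs : ∀ F : Δ.StressCell d, G ⊆ F.1 → 0 ≤ s F * w F.1)
    {K : Set (Euc d)} (hK : K ∈ Δ.cells) (hGK : G ⊆ K) : vectorSpan ℝ K ≤ dualPerp r K := by
  obtain ⟨y, hy⟩ := nonempty_relint hG
  obtain ⟨ε, hε, hst, hreg⟩ := exists_internal_star_ball hG hint hy
  obtain ⟨x, hxK, hx⟩ := exists_relint_ball hK (hGK (relint_subset hy)) hε
  intro v hv
  rw [mem_dualPerp]
  intro A B hA hB
  -- On `K` both pieces are maximal, so they agree on a relatively open subset of `K`.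
  have heq : ∀ z ∈ K, z ∈ Metric.ball y ε → ⟪r A - r B, z - y⟫ = 0 := by
    intro z hz hzε
    have h1 := inner_reciprocal_le hG hy hst hreg hr hs hzε A B (hGK.trans hA) (hB hz)
    have h2 := inner_reciprocal_le hG hy hst hreg hr hs hzε B A (hGK.trans hB) (hA hz)
    rw [inner_sub_left]; linarith
  obtain ⟨δ, hδ, h⟩ := relint_open hxK
  have hc : Tendsto (fun t : ℝ => x + t • v) (𝓝 0) (𝓝 (x + (0 : ℝ) • v)) :=
    (continuous_const.add (continuous_id.smul continuous_const)).tendsto 0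
  rw [zero_smul, add_zero] at hc
  have hc2 : ∀ᶠ t : ℝ in 𝓝[>] 0, x + t • v ∈ Metric.ball y ε ∧ x + t • v ∈ Metric.ball x δ :=
    (hc.eventually (Filter.inter_mem (Metric.isOpen_ball.mem_nhds hx)
      (Metric.ball_mem_nhds x hδ))).filter_mono nhdsWithin_le_nhds
  obtain ⟨t, ⟨ht1, ht2⟩, ht0⟩ := (hc2.and self_mem_nhdsWithin).exists
  have h1 := heq _ (relint_subset (h (t • v) (Submodule.smul_mem _ _ hv)
    (by simpa [mem_ball_iff_norm] using ht2))) ht1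
  have h2 := heq x (relint_subset hxK) hx
  rw [add_sub_right_comm, inner_add_right, h2, zero_add, inner_smul_right] at h1
  exact (mul_eq_zero.1 h1).resolve_left (ne_of_gt ht0)

section Positive

variable {G : Set (Euc d)} (hG : G ∈ Δ.cells)
  {w : Set (Euc d) → ℝ} {s : Δ.StressCell d → ℝ} {r : Δ.TopCell → Euc d}
  (hr : Δ.IsReciprocal w s G r) (hs : ∀ F : Δ.StressCell d, G ⊆ F.1 → 0 < s F * w F.1)

include hG hr hs

/-- The top cells that contain a point near `G` are those whose pieces are maximal there. -/
lemma subset_top_iff {y : Euc d} (hy : y ∈ intrinsicInterior ℝ G)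
    {ε : ℝ} (hst : ∀ C ∈ Δ.cells, ∀ z ∈ C, dist z y < ε → y ∈ C)
    (hreg : Metric.ball y ε ⊆ region Δ.cells) {x : Euc d} (hx : x ∈ Metric.ball y ε)
    {L : Set (Euc d)} (hL : L ∈ Δ.cells) (hxL : x ∈ intrinsicInterior ℝ L) (A : Δ.TopCell)
    (hA : G ⊆ A.1) :
    L ⊆ A.1 ↔ ∀ B : Δ.TopCell, G ⊆ B.1 → ⟪r B, x - y⟫ ≤ ⟪r A, x - y⟫ := by
  have hs' : ∀ F : Δ.StressCell d, G ⊆ F.1 → 0 ≤ s F * w F.1 := fun F hF => (hs F hF).le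
  have hε : 0 < ε := dist_nonneg.trans_lt hx
  constructor
  · exact fun h B hB => inner_reciprocal_le hG hy hst hreg hr hs' hx B A hB (h (relint_subset hxL))
  · intro h
    obtain ⟨B, hB, hBd, hxB⟩ := exists_top_of_mem_region (hreg hx)
    have hGB := carrier_subset hG hB hy (hst B hB x hxB hx)
    obtain ⟨B', hxB', hB'⟩ := exists_mem_of_inner_eq hG hy hst hreg hr hs' hx A ⟨B, hB, hBd⟩ hA hxB
      (le_antisymm (inner_reciprocal_le hG hy hst hreg hr hs' hx A ⟨B, hB, hBd⟩ hA hxB)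
        (h ⟨B, hB, hBd⟩ hGB))
    have hGB' := carrier_subset hG B'.2.1 hy (hst _ B'.2.1 x hxB' hx)
    obtain rfl := reciprocal_injOn hG hy hst hreg hr hs hε B' A hGB' hA hB'
    exact carrier_subset hL B'.2.1 hxL hxB'

set_option maxHeartbeats 1000000 in
/-- If the tension is positive around `G`, each cell of the star spans all directions
perpendicular to its dual face. -/
lemma lin_eq_dualPerp (hint : Δ.IsInternal G) {C : Set (Euc d)} (hC : C ∈ Δ.cells) (hGC : G ⊆ C) :
    vectorSpan ℝ C = dualPerp r C := by
  have hs' : ∀ F : Δ.StressCell d, G ⊆ F.1 → 0 ≤ s F * w F.1 := fun F hF => (hs F hF).le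
  -- Downward induction on the dimension of `dualPerp r C`: the statement is available for all cells
  -- of the star whose dual face has smaller dimension.
  induction hn : d - Module.finrank ℝ (dualPerp r C) using Nat.strong_induction_on
    generalizing C with
  | _ n ih =>
  have hIH : ∀ K ∈ Δ.cells, G ⊆ K → Module.finrank ℝ (dualPerp r C) < Module.finrank ℝ
      (dualPerp r K) → vectorSpan ℝ K = dualPerp r K := by
    intro K hK hGK hlt
    have := finrank_dualPerp r K
    exact ih (d - Module.finrank ℝ (dualPerp r K)) (by omega) hK hGK rfl
  clear ih hn
  set W := dualPerp r C with hW
  set m := Module.finrank ℝ W with hm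
  by_contra hne
  -- Suppose the span of `C` is a proper subspace of `W`. The aim is to find two `m`-cells that
  -- continue each other across a common cell inside a flat parallel to `W`, as facets of one cell,
  -- against `Δ.genuine`.
  have hle : vectorSpan ℝ C ≤ W := lin_le_dualPerp hG hint hr hs' hC hGC
  have hdimC : flatDim C < m :=
    Submodule.finrank_lt_finrank_of_lt (lt_of_le_of_ne hle hne)
  have hintC : Δ.IsInternal C := hint.mono hG hC hGC
  have hrC := isReciprocal_mono hr hGC
  have hsC : ∀ F : Δ.StressCell d, C ⊆ F.1 → 0 < s F * w F.1 := fun F hF => hs F (hGC.trans hF)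
  obtain ⟨c, hc⟩ := nonempty_relint hC
  obtain ⟨ε, hε, hst, hreg⟩ := exists_internal_star_ball hC hintC hc
  have htop : ∀ {x}, x ∈ Metric.ball c ε → ∀ {L}, L ∈ Δ.cells → x ∈ intrinsicInterior ℝ L →
      ∀ A : Δ.TopCell, C ⊆ A.1 → (L ⊆ A.1 ↔
        ∀ B : Δ.TopCell, C ⊆ B.1 → ⟪r B, x - c⟫ ≤ ⟪r A, x - c⟫) :=
    fun hx L hL hxL A hA => subset_top_iff hC hrC hsC hc hst hreg hx hL hxL A hA
  have hCsub : ∀ {x}, x ∈ Metric.ball c ε → ∀ {L}, L ∈ Δ.cells → x ∈ intrinsicInterior ℝ L →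
      C ⊆ L := fun hx L hL hxL => carrier_subset hC hL hc (hst L hL _ (relint_subset hxL) hx)
  have hWeq : ∀ u ∈ W, ∀ A B : Δ.TopCell, C ⊆ A.1 → C ⊆ B.1 → ⟪r A, u⟫ = ⟪r B, u⟫ := by
    intro u hu A B hA hB
    have := mem_dualPerp.1 hu A B hA hB
    rw [inner_sub_left] at this; linarith
  -- the cells in the flat `c + W`
  have hflat : ∀ {x}, x ∈ Metric.ball c ε → x - c ∈ W → ∀ {L}, L ∈ Δ.cells →
      x ∈ intrinsicInterior ℝ L → dualPerp r L = W ∧ vectorSpan ℝ L ≤ W := by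
    intro x hx hxW L hL hxL
    have hCL := hCsub hx hL hxL
    -- In the flat `c + W` all pieces around `C` take the same value, so every top cell at `C`
    -- contains the carrier `L`.
    have h1 : dualPerp r L = W := dualPerp_congr fun A => by
      refine ⟨fun h => hCL.trans h, fun h => (htop hx hL hxL A h).2 fun B hB => ?_⟩
      exact (hWeq _ hxW B A hB h).le
    exact ⟨h1, h1 ▸ lin_le_dualPerp hG hint hr hs' hL (hGC.trans hCL)⟩
  -- a lower-dimensional cell in the flat, of maximal dimension
  have hf : {K ∈ Δ.cells | ∃ x ∈ Metric.ball c ε, x - c ∈ W ∧ x ∈ intrinsicInterior ℝ K ∧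
      flatDim K < m}.Finite := (finite_cells_at c).subset (by
    rintro K ⟨hK, x, hx, -, hxK, -⟩
    exact ⟨hK, hst K hK x (relint_subset hxK) hx⟩)
  obtain ⟨E, hE⟩ := hf.exists_maximal ⟨C, hC, c, Metric.mem_ball_self hε, by simp, hc, hdimC⟩
  obtain ⟨hEc, x₀, hx₀, hx₀W, hx₀E, hEm⟩ := hE.prop
  have hCE : C ⊆ E := hCsub hx₀ hEc hx₀E
  have hElin := (hflat hx₀ hx₀W hEc hx₀E).2
  obtain ⟨δ₁, hδ₁, h1⟩ := (mem_relint_iff.1 hx₀E).2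
  obtain ⟨δ₂, hδ₂, hst₂⟩ := exists_star_ball (mem_region hEc (relint_subset hx₀E))
  obtain ⟨δ₃, hδ₃, h3⟩ := Metric.mem_nhds_iff.1 (Metric.isOpen_ball.mem_nhds hx₀)
  set δ := min δ₁ (min δ₂ δ₃) with hδdef
  have hδ : 0 < δ := by positivity
  have hball : ∀ {p : Euc d}, ‖p - x₀‖ < δ → p ∈ Metric.ball c ε := fun {p} hp =>
    h3 (by rw [mem_ball_iff_norm]; exact hp.trans_le ((min_le_right _ _).trans (min_le_right _ _)))
  have hWsub : ∀ {p : Euc d}, p - x₀ ∈ W → p - c ∈ W := fun {p} hp => by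
    have := W.add_mem hp hx₀W
    simpa using this
  have hoff : ∀ {p : Euc d}, p - x₀ ∈ W → ‖p - x₀‖ < δ → p - x₀ ∉ vectorSpan ℝ E →
      ∀ L ∈ Δ.cells, p ∈ intrinsicInterior ℝ L → E ⊆ L ∧ vectorSpan ℝ L = W := by
    intro p hpW hpδ hpE L hL hpL
    have hEL : E ⊆ L := carrier_subset hEc hL hx₀E (hst₂ L hL p (relint_subset hpL) (by
      rw [dist_eq_norm]; exact hpδ.trans_le ((min_le_right _ _).trans (min_le_left _ _))))
    refine ⟨hEL, ?_⟩
    have hLW := (hflat (hball hpδ) (hWsub hpW) hL hpL).2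
    refine Submodule.eq_of_le_of_finrank_le hLW ?_
    by_contra hlt
    have hLE : L ⊆ E := hE.le_of_ge ⟨hL, p, hball hpδ, hWsub hpW, hpL, not_le.1 hlt⟩ hEL
    exact hpE (sub_mem_lin (hLE (relint_subset hpL)) (relint_subset hx₀E))
  have hexL : ∀ {p : Euc d}, ‖p - x₀‖ < δ → ∃ L ∈ Δ.cells, p ∈ intrinsicInterior ℝ L := by
    intro p hp
    obtain ⟨C', hC', hpC'⟩ := hreg (hball hp)
    obtain ⟨L, hL, -, hpL⟩ := exists_carrier hC' hpC'
    exact ⟨L, hL, hpL⟩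
  -- no cell covers all of the flat near `x₀`
  have hnocover : ∀ M ∈ Δ.cells, E ⊆ M → vectorSpan ℝ M = W →
      ¬ ∀ p : Euc d, p - x₀ ∈ W → ‖p - x₀‖ < δ → p - x₀ ∉ vectorSpan ℝ E → p ∈ M := by
    intro M hM hEM hMW hcov
    have hx₀M : x₀ ∈ intrinsicInterior ℝ M := by
      refine mem_relint_iff.2 ⟨hEM (relint_subset hx₀E), δ, hδ, fun v hv hvδ => ?_⟩
      rw [hMW] at hv
      by_cases hvE : v ∈ vectorSpan ℝ E
      · exact hEM (h1 v hvE (hvδ.trans_le (min_le_left _ _)))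
      · exact hcov _ (by simpa using hv) (by simpa using hvδ) (by simpa using hvE)
    obtain rfl := carrier_unique hEc hM hx₀E hx₀M
    have : flatDim E = m := by unfold flatDim; rw [hMW]
    omega
  obtain ⟨u, huW, hu1, huE⟩ := exists_unit_perp hElin (show flatDim E < m from hEm)
  have hu0 : ∀ t : ℝ, t ≠ 0 → t • u ∉ vectorSpan ℝ E := by
    intro t ht h
    have := huE _ h
    rw [inner_smul_left, real_inner_self_eq_norm_sq, hu1] at this
    simp at this; exact ht this
  have hun : ‖(δ / 2) • u‖ < δ := by
    rw [norm_smul, hu1, Real.norm_of_nonneg (by positivity)]; linarith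
  have hun' : ‖(-(δ / 2)) • u‖ < δ := by rwa [neg_smul, norm_neg]
  have hconst : ∀ S : Set (Euc d), IsPreconnected S → (∀ p ∈ S, p - x₀ ∈ W ∧ ‖p - x₀‖ < δ ∧
      p - x₀ ∉ vectorSpan ℝ E) → ∀ p ∈ S, ∃ M ∈ Δ.cells, E ⊆ M ∧ vectorSpan ℝ M = W ∧
      S ⊆ intrinsicInterior ℝ M := by
    intro S hS hSp p hp
    obtain ⟨M, hM, hpM⟩ := hexL (hSp p hp).2.1
    obtain ⟨hEM, hMW⟩ := hoff (hSp p hp).1 (hSp p hp).2.1 (hSp p hp).2.2 M hM hpM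
    refine ⟨M, hM, hEM, hMW, carrier_const hS (W := W) (fun q hq q' hq' => ?_) (fun q hq => ?_) hM
      hp hpM⟩
    · have := W.sub_mem (hSp q' hq').1 (hSp q hq).1
      simpa using this
    · obtain ⟨L, hL, hqL⟩ := hexL (hSp q hq).2.1
      exact ⟨L, hL, hqL, (hoff (hSp q hq).1 (hSp q hq).2.1 (hSp q hq).2.2 L hL hqL).2⟩
  -- In larger codimension the disc minus the flat of `E` would be connected, so one cell would
  -- cover it all, against `hnocover`.
  have hEm1 : flatDim E + 1 = m := by
    by_contra hne
    obtain ⟨M, hM, hEM, hMW, hsub⟩ := hconst _ (isPreconnected_ball_diff hElin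
      (by unfold flatDim at hEm hne; omega) x₀ hδ) (fun p hp => hp) (x₀ + (δ / 2) • u)
      ⟨by simpa using W.smul_mem _ huW, by simpa using hun, by
        simpa using hu0 (δ / 2) (by positivity)⟩
    exact hnocover M hM hEM hMW fun p h1 h2 h3 => relint_subset (hsub ⟨h1, h2, h3⟩)
  -- the two sides of `E` in the flat
  have hside : ∀ σ : ℝ, σ * σ = 1 → ∃ M ∈ Δ.cells, E ⊆ M ∧ vectorSpan ℝ M = W ∧
      {p : Euc d | p - x₀ ∈ W ∧ ‖p - x₀‖ < δ ∧ 0 < ⟪σ • u, p - x₀⟫} ⊆ intrinsicInterior ℝ M := by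
    intro σ hσ
    refine hconst _ (convex_half_disc W x₀ (σ • u) δ).isPreconnected
      (fun p hp => ⟨hp.1, hp.2.1, fun h => ?_⟩) (x₀ + (δ / 2 * σ) • u) ⟨?_, ?_, ?_⟩
    · have := hp.2.2
      rw [inner_smul_left, real_inner_comm, huE _ h, mul_zero] at this
      exact lt_irrefl _ this
    · rw [add_sub_cancel_left]; exact W.smul_mem _ huW
    · rcases mul_self_eq_one_iff.1 hσ with rfl | rfl
      · rwa [add_sub_cancel_left, mul_one]
      · rwa [add_sub_cancel_left, mul_neg_one]
    · rw [add_sub_cancel_left, inner_smul_left, inner_smul_right, real_inner_self_eq_norm_sq, hu1]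
      simp only [conj_trivial, one_pow, mul_one]
      nlinarith
  obtain ⟨M, hM, hEM, hMW, hMs⟩ := hside 1 (by norm_num)
  obtain ⟨M', hM', hEM', hMW', hMs'⟩ := hside (-1) (by norm_num)
  have hMd : flatDim M = m := by unfold flatDim; rw [hMW]
  have hMd' : flatDim M' = m := by unfold flatDim; rw [hMW']
  have hMM : M ≠ M' := by
    rintro rfl
    refine hnocover M hM hEM hMW fun p hpW hpδ hpE => ?_
    rcases lt_trichotomy ⟪u, p - x₀⟫ 0 with h | h | h
    · exact relint_subset (hMs' ⟨hpW, hpδ, by rw [neg_smul, one_smul, inner_neg_left]; linarith⟩)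
    · have := lin_decomp hEM (by rw [hEm1, hMd]) hu1 (by rwa [hMW]) huE (v := p - x₀) (by rwa [hMW])
      rw [h, zero_smul, sub_zero] at this
      exact absurd this hpE
    · exact relint_subset (hMs ⟨hpW, hpδ, by rwa [one_smul]⟩)
  have hpM : x₀ + (δ / 2) • u ∈ intrinsicInterior ℝ M := hMs
    ⟨by simpa using W.smul_mem _ huW, by simpa using hun, by
      rw [one_smul, add_sub_cancel_left, inner_smul_right, real_inner_self_eq_norm_sq, hu1]
      simpa using hδ⟩
  have hpM' : x₀ + (-(δ / 2)) • u ∈ intrinsicInterior ℝ M' := hMs'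
    ⟨by simpa using W.smul_mem _ huW, by simpa using hun', by
      rw [add_sub_cancel_left, inner_smul_right, inner_smul_left, real_inner_self_eq_norm_sq, hu1]
      simpa using hδ⟩
  -- a cell of one dimension more
  have hmd : m < d := by
    by_contra hge
    have hWtop : W = ⊤ := by
      refine Submodule.eq_top_of_finrank_eq ?_
      have := Submodule.finrank_le W
      simp only [finrank_euclideanSpace, Fintype.card_fin] at this ⊢
      omega
    obtain ⟨A, hA, hAd, hCA⟩ := Δ.pure C hC
    obtain ⟨F, hF, hCF, hFA, hFd⟩ := exists_facet_above hC hA (hCA.ssubset_of_ne (by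
      rintro rfl
      have := Submodule.finrank_le W
      simp only [finrank_euclideanSpace, Fintype.card_fin] at this
      omega))
    obtain ⟨z, hz⟩ := nonempty_relint hF
    obtain ⟨A₁, hA₁, B₁, hB₁, hA₁d, hB₁d, hFA₁, hFB₁, hne₁⟩ :=
      (facet_interior_iff hF (by omega) hz).1 (hintC.mono hC hF hCF hz)
    have h0 : r ⟨A₁, hA₁, hA₁d⟩ = r ⟨B₁, hB₁, hB₁d⟩ := by
      refine ext_inner_right ℝ fun v => hWeq v (by rw [hWtop]; trivial) _ _ (hCF.trans hFA₁)
        (hCF.trans hFB₁)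
    have := reciprocal_injOn hC hc hst hreg hrC hsC hε _ _ (hCF.trans hFA₁) (hCF.trans hFB₁) h0
    exact hne₁ (congrArg Subtype.val this)
  obtain ⟨A, hA, hAd, hMA⟩ := Δ.pure M hM
  obtain ⟨K, hK, hMK, hKd⟩ := exists_cell_above hM hA (hMA.ssubset_of_ne (by rintro rfl; omega))
  have hCK : C ⊆ K := hCE.trans (hEM.trans hMK)
  -- `K` has dimension `m + 1`, and its span is contained in `dualPerp r K`, so the induction
  -- hypothesis applies.
  have hKW : vectorSpan ℝ K = dualPerp r K := hIH K hK (hGC.trans hCK) (by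
    have := Submodule.finrank_mono (lin_le_dualPerp hG hint hr hs' hK (hGC.trans hCK))
    unfold flatDim at hKd hMd
    omega)
  have hWK : W ≤ vectorSpan ℝ K := by rw [← hMW]; exact vectorSpan_mono ℝ hMK
  -- A point `k` in the open cell of `K` close to `p` is translated along `u`, parallel to `W`. All
  -- pieces around `C` change by the same amount, so the same pieces stay maximal; by the induction
  -- hypothesis the carriers have constant span and the translate stays in `K`. Letting `k` tend to
  -- `p` puts `p'` into `K`.
  have hMK' : M' ⊆ K := by
    refine carrier_subset hM' hK hpM' ?_
    have hcl : IsClosed K := (Δ.isFlatCell K hK).isClosed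
    set p := x₀ + (δ / 2) • u with hp
    set p' := x₀ + (-(δ / 2)) • u with hp'
    have hpball : p ∈ Metric.ball c ε := hball (by simpa [hp] using hun)
    have hpball' : p' ∈ Metric.ball c ε := hball (by simpa [hp'] using hun')
    rw [← hcl.closure_eq]
    refine Metric.mem_closure_iff.2 fun η hη => ?_
    obtain ⟨η₁, hη₁, hη₁s⟩ := Metric.mem_nhds_iff.1 (Metric.isOpen_ball.mem_nhds hpball)
    obtain ⟨η₂, hη₂, hη₂s⟩ := Metric.mem_nhds_iff.1 (Metric.isOpen_ball.mem_nhds hpball')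
    obtain ⟨k, hkK, hkd⟩ := exists_relint_ball hK (hMK (relint_subset hpM))
      (show 0 < min η (min η₁ η₂) by positivity)
    have hkn : ‖k - p‖ < min η (min η₁ η₂) := by rwa [mem_ball_iff_norm] at hkd
    have hkball : k ∈ Metric.ball c ε := hη₁s (by
      rw [mem_ball_iff_norm]; exact hkn.trans_le ((min_le_right _ _).trans (min_le_left _ _)))
    have hkball' : p' + (k - p) ∈ Metric.ball c ε := hη₂s (by
      rw [mem_ball_iff_norm, add_sub_cancel_left]
      exact hkn.trans_le ((min_le_right _ _).trans (min_le_right _ _)))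
    have hpp : p' + (k - p) = k + (-δ) • u := by
      rw [hp, hp', neg_smul, neg_smul]
      have : δ • u = (δ / 2) • u + (δ / 2) • u := by rw [← add_smul]; congr 1; ring
      rw [this]; abel
    -- the carriers are constant along the segment from `k`
    have hseg : segment ℝ k (p' + (k - p)) ⊆ intrinsicInterior ℝ K := by
      have hdiff : ∀ q ∈ segment ℝ k (p' + (k - p)), q - k ∈ W := by
        intro q hq
        rw [segment_eq_image_lineMap] at hq
        obtain ⟨t, -, rfl⟩ := hq
        rw [hpp, AffineMap.lineMap_apply, vsub_eq_sub, vadd_eq_add, add_sub_cancel_right,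
          add_sub_cancel_left]
        exact W.smul_mem _ (W.smul_mem _ huW)
      refine carrier_const (convex_segment _ _).isPreconnected (W := dualPerp r K)
        (fun q hq q' hq' => ?_) (fun q hq => ?_) hK (left_mem_segment _ _ _) hkK
      · rw [← hKW]
        have := W.sub_mem (hdiff q' hq') (hdiff q hq)
        rw [sub_sub_sub_cancel_right] at this
        exact hWK this
      · have hqball : q ∈ Metric.ball c ε := (convex_ball c ε).segment_subset hkball hkball' hq
        obtain ⟨C', hC', hqC'⟩ := hreg hqball
        obtain ⟨L, hL, -, hqL⟩ := exists_carrier hC' hqC'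
        have hCL := hCsub hqball hL hqL
        have hLK : dualPerp r L = dualPerp r K := dualPerp_congr fun A => by
          have key : C ⊆ A.1 → (L ⊆ A.1 ↔ K ⊆ A.1) := by
            intro hCA
            rw [htop hqball hL hqL A hCA, htop hkball hK hkK A hCA]
            refine forall₂_congr fun B hCB => ?_
            have e : q - c = (k - c) + (q - k) := by abel
            rw [e, inner_add_right, inner_add_right, hWeq _ (hdiff q hq) B A hCB hCA]
            exact add_le_add_iff_right _
          exact ⟨fun h => (key (hCL.trans h)).1 h, fun h => (key (hCK.trans h)).2 h⟩
        refine ⟨L, hL, hqL, ?_⟩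
        rw [hIH L hL (hGC.trans hCL) (by
          rw [hLK, ← hKW]; unfold flatDim at hKd hMd; omega), hLK]
    refine ⟨p' + (k - p), relint_subset (hseg (right_mem_segment _ _ _)), ?_⟩
    rw [dist_eq_norm, sub_add_cancel_left, norm_neg]
    exact hkn.trans_le (min_le_left _ _)
  -- `M` and `M'` are different facets of `K` that meet in `E` and lie in the same flat through
  -- `x₀`.
  refine Δ.genuine K hK M hM M' hM' E hEc (hintC.mono hC hEc hCE) hMK hMK' hEM hEM' hKd
    (by rw [hMd', ← hMd, hKd]) (by omega) hMM ?_
  refine AffineSubspace.ext_of_direction_eq (by rw [direction_affineSpan, direction_affineSpan,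
    hMW, hMW']) ⟨x₀, subset_affineSpan ℝ _ (hEM (relint_subset hx₀E)),
      subset_affineSpan ℝ _ (hEM' (relint_subset hx₀E))⟩

/-- The dual faces reverse inclusions. -/
lemma subset_of_dualFace_subset (hint : Δ.IsInternal G) {C C' : Set (Euc d)} (hC : C ∈ Δ.cells)
    (hC' : C' ∈ Δ.cells) (hGC : G ⊆ C) (hGC' : G ⊆ C') (h : dualFace r C' ⊆ dualFace r C) :
    C ⊆ C' := by
  have hs' : ∀ F : Δ.StressCell d, G ⊆ F.1 → 0 ≤ s F * w F.1 := fun F hF => (hs F hF).le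
  obtain ⟨y, hy⟩ := nonempty_relint hG
  obtain ⟨ε, hε, hst, hreg⟩ := exists_internal_star_ball hG hint hy
  obtain ⟨c, hcC, hc⟩ := exists_relint_ball hC (hGC (relint_subset hy)) hε
  obtain ⟨c', hcC', hc'⟩ := exists_relint_ball hC' (hGC' (relint_subset hy)) hε
  have htop := fun {x} hx {L} hL hxL => subset_top_iff hG hr hs hy hst hreg (x := x) hx (L := L) hL hxL
  -- The vertices belonging to `C'` are in the face dual to `C`, so their pieces are maximal at `c`.
  have h1 : ∀ A : Δ.TopCell, C' ⊆ A.1 → C ⊆ A.1 := by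
    intro A hA
    refine (htop hc hC hcC A (hGC'.trans hA)).2 fun B hB => ?_
    have : r A ∈ dualFace r C := h (subset_convexHull ℝ _ ⟨A, hA, rfl⟩)
    rw [← face_eq_dualFace hG hy hst hreg hr hs' hc hC hcC] at this
    exact this.2 _ (subset_convexHull ℝ _ ⟨B, hB, rfl⟩)
  obtain ⟨A₀, hA₀, hA₀d, hCA₀⟩ := Δ.pure C' hC'
  let T₀ : Δ.TopCell := ⟨A₀, hA₀, hA₀d⟩
  have hmax' := fun A hA => (htop hc' hC' hcC' A (hGC'.trans hA)).1 hA
  have hmax := fun A hA => (htop hc hC hcC A (hGC.trans hA)).1 hA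
  -- Along the segment from `c'` towards `c`, with `c` left out, exactly the pieces of `C'` are
  -- maximal: they are maximal at both ends, and no others are maximal at `c'`. So the carrier stays
  -- `C'`, and `c` is in `C'` by closedness.
  let S : Set (Euc d) := (fun t : ℝ => AffineMap.lineMap c' c t) '' Ico 0 1
  have hSc : Continuous (fun t : ℝ => AffineMap.lineMap c' c t) := AffineMap.lineMap_continuous
  have hS : IsPreconnected S := isPreconnected_Ico.image _ hSc.continuousOn
  have hsub : S ⊆ intrinsicInterior ℝ C' := by
    have hcc : c - c' ∈ dualPerp r C' := by
      rw [mem_dualPerp]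
      intro A B hA hB
      have e1 : ⟪r A, c - y⟫ = ⟪r B, c - y⟫ := le_antisymm
        (hmax B (h1 B hB) A (hGC'.trans hA)) (hmax A (h1 A hA) B (hGC'.trans hB))
      have e2 : ⟪r A, c' - y⟫ = ⟪r B, c' - y⟫ := le_antisymm
        (hmax' B hB A (hGC'.trans hA)) (hmax' A hA B (hGC'.trans hB))
      rw [← sub_sub_sub_cancel_right c c' y, inner_sub_right, inner_sub_left, inner_sub_left, e1, e2]
      ring
    refine carrier_const hS (W := dualPerp r C') ?_ ?_ hC' ⟨0, by simp, by simp⟩ hcC'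
    · rintro _ ⟨t, -, rfl⟩ _ ⟨t', -, rfl⟩
      simp only [AffineMap.lineMap_apply, vsub_eq_sub, vadd_eq_add]
      rw [add_sub_add_right_eq_sub, ← sub_smul]
      exact Submodule.smul_mem _ _ hcc
    · rintro _ ⟨t, ht, rfl⟩
      have hxball : AffineMap.lineMap c' c t ∈ Metric.ball y ε :=
        (convex_ball y ε).lineMap_mem hc' hc ⟨ht.1, ht.2.le⟩
      have e : AffineMap.lineMap c' c t - y = (1 - t) • (c' - y) + t • (c - y) := by
        simp only [AffineMap.lineMap_apply, vsub_eq_sub, vadd_eq_add]; module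
      obtain ⟨X, hX, hxX⟩ := hreg hxball
      obtain ⟨L, hL, -, hxL⟩ := exists_carrier hX hxX
      have hGL : G ⊆ L := carrier_subset hG hL hy (hst L hL _ (relint_subset hxL) hxball)
      have ht1 : 0 < 1 - t := by linarith [ht.2]
      have hLC : dualPerp r L = dualPerp r C' := dualPerp_congr fun A => by
        constructor
        · intro hLA
          have hGA := hGL.trans hLA
          refine (htop hc' hC' hcC' A hGA).2 fun B hB => ?_
          have h2 := (htop hxball hL hxL A hGA).1 hLA T₀ (hGC'.trans hCA₀)
          have h3 := hmax T₀ (h1 T₀ hCA₀) A hGA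
          have h4 := hmax' T₀ hCA₀ B hB
          rw [e] at h2
          simp only [inner_add_right, inner_smul_right] at h2
          have h5 := mul_le_mul_of_nonneg_left h3 ht.1
          exact h4.trans (le_of_mul_le_mul_left (by linarith) ht1)
        · intro hA
          refine (htop hxball hL hxL A (hGC'.trans hA)).2 fun B hB => ?_
          rw [e]
          simp only [inner_add_right, inner_smul_right]
          exact add_le_add (mul_le_mul_of_nonneg_left (hmax' A hA B hB) ht1.le)
            (mul_le_mul_of_nonneg_left (hmax A (h1 A hA) B hB) ht.1)
      exact ⟨L, hL, hxL, by rw [lin_eq_dualPerp hG hr hs hint hL hGL, hLC]⟩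
  refine carrier_subset hC hC' hcC ?_
  refine (Δ.isFlatCell C' hC').isClosed.mem_of_frequently_of_tendsto (b := 𝓝[<] (1 : ℝ))
    (f := fun t : ℝ => AffineMap.lineMap c' c t) (Eventually.frequently ?_) ?_
  · filter_upwards [Ioo_mem_nhdsLT (zero_lt_one' ℝ)] with t ht
    exact relint_subset (hsub ⟨t, ⟨ht.1.le, ht.2⟩, rfl⟩)
  · have := hSc.tendsto 1
    simp only [AffineMap.lineMap_apply_one] at this
    exact this.mono_left nhdsWithin_le_nhds

/-- A positive reciprocal spans a dual convex polytope of the star. -/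
theorem isDualPolytope_of_pos (hint : Δ.IsInternal G) : Δ.IsDualPolytope G r := by
  have hs' : ∀ F : Δ.StressCell d, G ⊆ F.1 → 0 ≤ s F * w F.1 := fun F hF => (hs F hF).le
  obtain ⟨y, hy⟩ := nonempty_relint hG
  obtain ⟨ε, hε, hst, hreg⟩ := exists_internal_star_ball hG hint hy
  have hlin := fun {C} hC hGC => lin_eq_dualPerp hG hr hs hint (C := C) hC hGC
  refine ⟨⟨?_, ?_, ?_⟩, ?_, ?_, ?_⟩
  · rintro C ⟨hC, hGC⟩
    obtain ⟨c, hcC, hc⟩ := exists_relint_ball hC (hGC (relint_subset hy)) hε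
    obtain ⟨A, hA, hAd, hCA⟩ := Δ.pure C hC
    refine ⟨⟨r ⟨A, hA, hAd⟩, subset_convexHull ℝ _ ⟨_, hCA, rfl⟩⟩, fun _ => ?_⟩
    refine ⟨innerSL ℝ (c - y), ?_⟩
    rw [← face_eq_dualFace hG hy hst hreg hr hs' hc hC hcC]
    ext p
    simp only [mem_ofPred_eq, innerSL_apply_apply, real_inner_comm (c - y)]
  · rintro C ⟨hC, hGC⟩ C' ⟨hC', hGC'⟩ heq
    exact Subset.antisymm (subset_of_dualFace_subset hG hr hs hint hC hC' hGC hGC' heq.ge)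
      (subset_of_dualFace_subset hG hr hs hint hC' hC hGC' hGC heq.le)
  · rintro P ⟨hPne, hP⟩
    obtain ⟨l, hl⟩ := hP hPne
    let v := (InnerProductSpace.toDual ℝ (Euc d)).symm l
    have hlv : ∀ q, l q = ⟪q, v⟫ := fun q => by
      rw [real_inner_comm]; exact (InnerProductSpace.toDual_symm_apply).symm
    have hc : Tendsto (fun t : ℝ => y + t • v) (𝓝 0) (𝓝 (y + (0 : ℝ) • v)) :=
      (continuous_const.add (continuous_id.smul continuous_const)).tendsto 0
    rw [zero_smul, add_zero] at hc
    -- A face depends only on the direction of the functional, so the functional can be represented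
    -- by a point near `y`; the carrier of that point is the cell sought.
    obtain ⟨t, ht, ht0⟩ := (((hc.eventually (Metric.ball_mem_nhds y hε)).filter_mono
      nhdsWithin_le_nhds).and (self_mem_nhdsWithin (s := Ioi (0 : ℝ)))).exists
    obtain ⟨X, hX, hxX⟩ := hreg ht
    obtain ⟨K, hK, -, hxK⟩ := exists_carrier hX hxX
    refine ⟨K, ⟨hK, carrier_subset hG hK hy (hst K hK _ (relint_subset hxK) ht)⟩, ?_⟩
    rw [← face_eq_dualFace hG hy hst hreg hr hs' ht hK hxK, hl]
    ext p
    simp only [mem_ofPred_eq, hlv, add_sub_cancel_left, inner_smul_right]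
    refine and_congr_right fun _ => forall₂_congr fun q _ => ?_
    exact mul_le_mul_iff_right₀ ht0
  · intro C hC C' hC' hGC hGC'
    exact ⟨fun h => convexHull_mono (image_mono fun A hA => h.trans hA),
      subset_of_dualFace_subset hG hr hs hint hC hC' hGC hGC'⟩
  · intro C hC hGC
    have := finrank_dualPerp r C
    rw [← hlin hC hGC] at this
    exact this
  · intro C hC hGC a ha b hb
    rw [hlin hC hGC] at hb
    exact hb a ha

end Positive

end CellDecomposition

/-! ### Volumes of polytopes: pyramids over facets and Minkowski's relation -/

section Volume

variable {V : Type*} [NormedAddCommGroup V] [InnerProductSpace ℝ V] [FiniteDimensional ℝ V]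
  [MeasurableSpace V] [BorelSpace V]

omit [FiniteDimensional ℝ V] [MeasurableSpace V] [BorelSpace V] in
lemma isometry_add_coe (W : Submodule ℝ V) (x : V) : Isometry (fun v : W => x + (v : V)) :=
  fun v v' => by simp [edist_add_left, Subtype.edist_eq]

omit [FiniteDimensional ℝ V] [MeasurableSpace V] [BorelSpace V] in
lemma image_add_coe_preimage {W : Submodule ℝ V} {x : V} {S : Set V} (h : ∀ z ∈ S, z - x ∈ W) :
    (fun v : W => x + (v : V)) '' ((fun v : W => x + (v : V)) ⁻¹' S) = S := by
  rw [image_preimage_eq_iff]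
  exact fun z hz => ⟨⟨z - x, h z hz⟩, by simp⟩

/-- A bounded set has finite volume in the dimension of its affine span. -/
lemma euclideanHausdorffMeasure_lt_top {S : Set V} (hS : Bornology.IsBounded S) :
    (μHE[Module.finrank ℝ (vectorSpan ℝ S)] : Measure V) S < ⊤ := by
  rcases S.eq_empty_or_nonempty with rfl | ⟨x, hx⟩
  · simp
  have e := image_add_coe_preimage (W := vectorSpan ℝ S) (x := x) (S := S)
    (fun z hz => by simpa using vsub_mem_vectorSpan ℝ hz hx)
  have e2 : (μHE[Module.finrank ℝ (vectorSpan ℝ S)] : Measure V) S =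
      (μHE[Module.finrank ℝ (vectorSpan ℝ S)] : Measure (vectorSpan ℝ S))
        ((fun v : vectorSpan ℝ S => x + (v : V)) ⁻¹' S) := by
    rw [← (isometry_add_coe _ x).euclideanHausdorffMeasure_image, e]
  rw [e2]
  obtain ⟨R, hR⟩ := hS.subset_closedBall x
  refine lt_of_le_of_lt (measure_mono (t := Metric.closedBall 0 R) fun v hv => ?_)
    (isCompact_closedBall _ _).measure_lt_top
  have := hR hv
  simpa [dist_eq_norm] using this

/-- The measure is finite in the dimension of the span, so in any larger dimension it cannot be
infinite, and zero is the only other possibility. -/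
lemma euclideanHausdorffMeasure_eq_zero_of_finrank_lt {S : Set V} (hS : Bornology.IsBounded S)
    {n : ℕ} (hn : Module.finrank ℝ (vectorSpan ℝ S) < n) : (μHE[n] : Measure V) S = 0 :=
  (Measure.euclideanHausdorffMeasure_zero_or_top hn S).resolve_right
    (euclideanHausdorffMeasure_lt_top hS).ne

/-- The volume of a cone over a compact set in a hyperplane. -/
lemma volume_cone {n : ℕ} (hn : Module.finrank ℝ V = n + 1) {u : V} (hu : ‖u‖ = 1) {h : ℝ}
    (hh : 0 < h) {K : Set V} (hK : IsCompact K) (hKu : ∀ z ∈ K, ⟪z, u⟫ = h) :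
    (μHE[n + 1] : Measure V) ((fun q : ℝ × V => q.1 • q.2) '' (Icc 0 1 ×ˢ K)) =
      ENNReal.ofReal (h / (n + 1)) * (μHE[n] : Measure V) K := by
  set P := (fun q : ℝ × V => q.1 • q.2) '' (Icc 0 1 ×ˢ K) with hP
  have hPm : MeasurableSet P :=
    ((isCompact_Icc.prod hK).image (by fun_prop)).isClosed.measurableSet
  have hu0 : u ≠ 0 := by rintro rfl; simp at hu
  have hmem : ∀ x : ℝ, ∀ z : V, z ∈ AffineSubspace.mk' (x • u +ᵥ (0 : V)) (ℝ ∙ u)ᗮ ↔ ⟪z, u⟫ = x := by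
    intro x z
    rw [AffineSubspace.mem_mk', Submodule.mem_orthogonal_singleton_iff_inner_left, vsub_eq_sub,
      vadd_eq_add, add_zero, inner_sub_left, inner_smul_left, real_inner_self_eq_norm_sq, hu]
    simp [sub_eq_zero]
  -- The slice at height `x` is a copy of `K` scaled by `x / h`. Height `0` is a null set in the
  -- integral and is left out.
  have hslice : ∀ x : ℝ, x ≠ 0 →
      (μHE[n] : Measure V) (P ∩ AffineSubspace.mk' (x • u +ᵥ (0 : V)) (ℝ ∙ u)ᗮ) =
      (Ioc 0 h).indicator (fun x => ENNReal.ofReal ((x / h) ^ n) * (μHE[n] : Measure V) K) x := by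
    intro x hx
    by_cases hxI : x ∈ Ioc 0 h
    · have hpos : 0 < x / h := div_pos hxI.1 hh
      have : P ∩ AffineSubspace.mk' (x • u +ᵥ (0 : V)) (ℝ ∙ u)ᗮ =
          AffineMap.homothety (0 : V) (x / h) '' K := by
        ext z
        simp only [mem_inter_iff, SetLike.mem_coe, hmem, hP, mem_image, mem_prod, Prod.exists]
        constructor
        · rintro ⟨⟨t, k, ⟨ht, hk⟩, rfl⟩, hz⟩
          rw [inner_smul_left, hKu k hk] at hz
          refine ⟨k, hk, ?_⟩
          rw [← hz]; simp [AffineMap.homothety_apply, hh.ne']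
        · rintro ⟨k, hk, rfl⟩
          refine ⟨⟨x / h, k, ⟨⟨hpos.le, (div_le_one hh).2 hxI.2⟩, hk⟩, ?_⟩, ?_⟩
          · simp [AffineMap.homothety_apply]
          · simp [AffineMap.homothety_apply, inner_smul_left, hKu k hk, hh.ne']
      rw [this, euclideanHausdorffMeasure_homothety_image _ _ hpos.ne', indicator_of_mem hxI,
        ENNReal.smul_def, smul_eq_mul]
      congr 1
      rw [ENNReal.coe_pow, ENNReal.ofReal_pow hpos.le, ← enorm_eq_nnnorm, Real.enorm_eq_ofReal hpos.le]
    · rw [indicator_of_notMem hxI]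
      convert measure_empty (μ := (μHE[n] : Measure V))
      ext z
      simp only [mem_inter_iff, SetLike.mem_coe, hmem, hP, mem_image, mem_prod, Prod.exists,
        mem_empty_iff_false, iff_false, not_and]
      rintro ⟨t, k, ⟨ht, hk⟩, rfl⟩ hz
      rw [inner_smul_left, hKu k hk, conj_trivial] at hz
      refine hxI ⟨lt_of_le_of_ne ?_ hx.symm, ?_⟩
      · rw [← hz]; exact mul_nonneg ht.1 hh.le
      · rw [← hz]; exact mul_le_of_le_one_left hh.le ht.2
  have h1 := EuclideanGeometry.euclideanHausdorffMeasure_eq_lintegral (0 : V) hu0 hPm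
  rw [hn, Nat.add_sub_cancel, ← ofReal_norm, hu, ENNReal.ofReal_one, one_mul] at h1
  rw [h1, lintegral_congr_ae (g := (Ioc 0 h).indicator
    (fun x => ENNReal.ofReal ((x / h) ^ n) * (μHE[n] : Measure V) K))
    (by
      have : ∀ᵐ x : ℝ, x ≠ 0 := by simp [ae_iff]
      filter_upwards [this] with x hx
      exact hslice x hx), lintegral_indicator measurableSet_Ioc,
    lintegral_mul_const _ (by fun_prop)]
  congr 1
  rw [← ofReal_integral_eq_lintegral_ofReal]
  · congr 1
    rw [← intervalIntegral.integral_of_le hh.le]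
    simp_rw [div_pow]
    rw [intervalIntegral.integral_div, integral_pow]
    field_simp
    ring
  · exact (Continuous.integrableOn_Icc (by fun_prop)).mono_set Ioc_subset_Icc_self
  · filter_upwards [ae_restrict_mem measurableSet_Ioc] with x hx
    have := hx.1
    positivity

/-- The face of the convex hull of `S` in the direction `v`. -/
def maxFace {E : Type*} [NormedAddCommGroup E] [InnerProductSpace ℝ E] (S : Set E) (v : E) : Set E :=
  {p ∈ convexHull ℝ S | ∀ q ∈ convexHull ℝ S, ⟪q, v⟫ ≤ ⟪p, v⟫}

omit [FiniteDimensional ℝ V] [MeasurableSpace V] [BorelSpace V] in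
lemma isCompact_maxFace {S : Set V} (hS : S.Finite) (v : V) : IsCompact (maxFace S v) := by
  have : maxFace S v = convexHull ℝ S ∩ ⋂ q ∈ convexHull ℝ S, {p | ⟪q, v⟫ ≤ ⟪p, v⟫} := by
    ext p; simp [maxFace]
  rw [this]
  refine (hS.isCompact_convexHull ℝ).inter_right (isClosed_biInter fun q _ => ?_)
  exact isClosed_le continuous_const (continuous_id.inner continuous_const)

omit [FiniteDimensional ℝ V] [MeasurableSpace V] [BorelSpace V] in
lemma inner_eq_of_mem_maxFace {S : Set V} {v p q : V} (hp : p ∈ maxFace S v)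
    (hq : q ∈ maxFace S v) : ⟪p, v⟫ = ⟪q, v⟫ :=
  le_antisymm (hq.2 p hp.1) (hp.2 q hq.1)

lemma measure_ker_eq_zero {n : ℕ} (hn : Module.finrank ℝ V = n + 1) {v : V} (hv : v ≠ 0) :
    (μHE[n + 1] : Measure V) {z | ⟪z, v⟫ = 0} = 0 := by
  have h1 : {z : V | ⟪z, v⟫ = 0} = ((ℝ ∙ v)ᗮ : Submodule ℝ V) := by
    ext z
    rw [SetLike.mem_coe, Submodule.mem_orthogonal_singleton_iff_inner_left]; rfl
  rw [h1, ← hn]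
  refine Measure.addHaar_submodule _ _ fun htop => hv ?_
  have : v ∈ (ℝ ∙ v)ᗮ := by rw [htop]; trivial
  rwa [Submodule.mem_orthogonal_singleton_iff_inner_left, inner_self_eq_zero] at this

section Polytope

variable {n : ℕ} (hn : Module.finrank ℝ V = n + 1) {S : Set V} (hS : S.Finite)
  {ι : Type*} [Fintype ι] {u : ι → V} (hu : ∀ i, ‖u i‖ = 1) (hinj : Function.Injective u)
  (hfac : ∀ v : V, ‖v‖ = 1 → n ≤ Module.finrank ℝ (vectorSpan ℝ (maxFace S v)) → ∃ i, u i = v)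
  {p : ι → V} (hp : ∀ i, p i ∈ maxFace S (u i))

include hn hS hu hinj hfac hp

/-- The decomposition of a polytope into the pyramids over its facets, with the apex at `0`. -/
lemma volume_polytope_of_zero_mem (h0 : (0 : V) ∈ interior (convexHull ℝ S)) :
    (n + 1) * (μHE[n + 1] : Measure V).real (convexHull ℝ S) =
      ∑ i, ⟪p i, u i⟫ * (μHE[n] : Measure V).real (maxFace S (u i)) := by
  set P := convexHull ℝ S with hP
  have hPc : IsCompact P := hS.isCompact_convexHull ℝ
  have hPcv : Convex ℝ P := convex_convexHull ℝ S
  have h0P : (0 : V) ∈ P := interior_subset h0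
  obtain ⟨ε, hε, hεP⟩ := Metric.mem_nhds_iff.1 (mem_interior_iff_mem_nhds.1 h0)
  have hh : ∀ i, 0 < ⟪p i, u i⟫ := by
    intro i
    have h1 : (ε / 2) • u i ∈ P := hεP (by
      rw [mem_ball_zero_iff, norm_smul, hu, Real.norm_of_nonneg (by positivity)]; linarith)
    have h2 := (hp i).2 _ h1
    rw [inner_smul_left, real_inner_self_eq_norm_sq, hu] at h2
    simp only [conj_trivial, one_pow, mul_one] at h2
    linarith
  let C : ι → Set V := fun i => (fun q : ℝ × V => q.1 • q.2) '' (Icc 0 1 ×ˢ maxFace S (u i))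
  have hCm : ∀ i, MeasurableSet (C i) := fun i =>
    ((isCompact_Icc.prod (isCompact_maxFace hS (u i))).image (by fun_prop)).isClosed.measurableSet
  have hCP : ∀ i, C i ⊆ P := by
    rintro i _ ⟨⟨t, z⟩, ⟨ht, hz⟩, rfl⟩
    exact hPcv.smul_mem_of_zero_mem h0P hz.1 ht
  have hdisj : Pairwise (Function.onFun (AEDisjoint (μHE[n + 1] : Measure V)) C) := by
    intro i j hij
    -- Two pyramids overlap only in the hyperplane orthogonal to this vector, since a common point
    -- has the same scale factor in both. The vector is nonzero because the normals are different
    -- unit vectors and the heights are positive.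
    have hne : ⟪p j, u j⟫ • u i - ⟪p i, u i⟫ • u j ≠ 0 := by
      intro h
      have h1 := sub_eq_zero.1 h
      have h2 := congrArg norm h1
      rw [norm_smul, norm_smul, hu, hu, mul_one, mul_one, Real.norm_of_nonneg (hh j).le,
        Real.norm_of_nonneg (hh i).le] at h2
      rw [h2] at h1
      exact hij (hinj (smul_right_injective V (hh i).ne' h1))
    refine measure_mono_null ?_ (measure_ker_eq_zero hn hne)
    rintro z ⟨⟨⟨t, a⟩, ⟨ht, ha⟩, rfl⟩, ⟨⟨t', a'⟩, ⟨ht', ha'⟩, hz⟩⟩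
    simp only at hz ha ha' ht ht'
    have e1 : ⟪t • a, u i⟫ = t * ⟪p i, u i⟫ := by
      rw [inner_smul_left, inner_eq_of_mem_maxFace ha (hp i)]; rfl
    have e2 : ⟪t • a, u j⟫ = t' * ⟪p j, u j⟫ := by
      rw [← hz, inner_smul_left, inner_eq_of_mem_maxFace ha' (hp j)]; rfl
    have e3 : ⟪t • a, u i⟫ ≤ t' * ⟪p i, u i⟫ := by
      rw [← hz, inner_smul_left]
      exact mul_le_mul_of_nonneg_left ((hp i).2 a' ha'.1) ht'.1
    have e4 : ⟪t • a, u j⟫ ≤ t * ⟪p j, u j⟫ := by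
      rw [inner_smul_left]
      exact mul_le_mul_of_nonneg_left ((hp j).2 a ha.1) ht.1
    have e5 : t = t' := le_antisymm (le_of_mul_le_mul_right (e1 ▸ e3) (hh i))
      (le_of_mul_le_mul_right (e2 ▸ e4) (hh j))
    show ⟪t • a, _⟫ = 0
    rw [inner_sub_right, inner_smul_right, inner_smul_right, e1, e2, e5]
    ring
  -- the rest of the polytope is negligible
  have hcov : (μHE[n + 1] : Measure V) (P \ ⋃ i, C i) = 0 := by
    -- The rays from `0` that leave the polytope through a face of dimension less than `n` stay in
    -- the span of the vertices of that face, which is a proper subspace. There are finitely many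
    -- such spans.
    let N : Set V := ⋃ T ∈ {T ∈ 𝒫 S | Submodule.span ℝ T ≠ ⊤}, (Submodule.span ℝ T : Set V)
    have hN : (μHE[n + 1] : Measure V) N = 0 := by
      have hf : {T ∈ 𝒫 S | Submodule.span ℝ T ≠ ⊤}.Finite := hS.finite_subsets.subset fun T h => h.1
      rw [measure_biUnion_null_iff hf.countable]
      intro T hT
      rw [← hn]
      exact Measure.addHaar_submodule _ _ hT.2
    refine measure_mono_null ?_ hN
    rintro z ⟨hzP, hzC⟩
    rw [mem_iUnion, not_exists] at hzC
    by_cases hz0 : z = 0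
    · subst hz0
      refine mem_biUnion (x := ∅) ⟨empty_subset _, fun h => ?_⟩ (Submodule.zero_mem _)
      rw [Submodule.span_empty] at h
      have := congrArg (fun W : Submodule ℝ V => Module.finrank ℝ W) h
      simp [hn] at this
    have hcpt : IsCompact ({t : ℝ | t • z ∈ P} ∩ Ici 0) := by
      refine Metric.isCompact_of_isClosed_isBounded ((hPc.isClosed.preimage
        (by fun_prop : Continuous fun t : ℝ => t • z)).inter isClosed_Ici) ?_
      obtain ⟨R, hR⟩ := hPc.isBounded.subset_closedBall 0
      refine (Metric.isBounded_closedBall (x := (0 : ℝ)) (r := R / ‖z‖)).subset ?_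
      rintro t ⟨ht, -⟩
      have := hR ht
      rw [mem_closedBall_zero_iff, norm_smul] at this
      rw [mem_closedBall_zero_iff, le_div_iff₀ (norm_pos_iff.2 hz0)]
      exact this
    obtain ⟨τ, ⟨hτP, hτ0⟩, hτmax⟩ := hcpt.exists_isGreatest ⟨1, by simpa using hzP, by simp⟩
    have hτ1 : 1 ≤ τ := hτmax ⟨by simpa using hzP, by simp⟩
    have hτpos : 0 < τ := by linarith
    have hnint : τ • z ∉ interior P := by
      intro hint
      have hc : ∀ᶠ t in 𝓝[>] τ, t • z ∈ interior P :=
        ((continuous_id.smul continuous_const).tendsto τ |>.eventually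
          (isOpen_interior.mem_nhds hint)).filter_mono nhdsWithin_le_nhds
      obtain ⟨t, ht, htτ⟩ := (hc.and self_mem_nhdsWithin).exists
      exact absurd (hτmax ⟨(interior_subset ht : t • z ∈ P), (hτ0.trans (le_of_lt htτ) : (0 : ℝ) ≤ t)⟩) (not_le.2 htτ)
    -- A supporting hyperplane at the point where the ray through `z` leaves the polytope; its
    -- normal determines the face containing that point.
    obtain ⟨f, hf⟩ := geometric_hahn_banach_open_point hPcv.interior isOpen_interior hnint
    have hfle : ∀ a ∈ P, f a ≤ f (τ • z) := by
      have hcl : P ⊆ closure (interior P) := by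
        rw [hPcv.closure_interior_eq_closure_of_nonempty_interior ⟨0, h0⟩]; exact subset_closure
      intro a ha
      exact closure_minimal (fun a ha => (hf a ha).le)
        (isClosed_le f.continuous continuous_const) (hcl ha)
    let v := (InnerProductSpace.toDual ℝ V).symm f
    have hfv : ∀ a, ⟪a, v⟫ = f a := fun a => by
      rw [real_inner_comm]; exact InnerProductSpace.toDual_symm_apply
    have hv0 : v ≠ 0 := by
      intro h
      have h1 := hf 0 h0
      rw [← hfv, ← hfv, h] at h1
      simp at h1
    have hvn : 0 < ‖v‖ := norm_pos_iff.2 hv0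
    have hmem : τ • z ∈ maxFace S (‖v‖⁻¹ • v) := by
      refine ⟨hτP, fun q hq => ?_⟩
      rw [inner_smul_right, inner_smul_right, hfv, hfv]
      exact mul_le_mul_of_nonneg_left (hfle q hq) (by positivity)
    by_cases hdim : n ≤ Module.finrank ℝ (vectorSpan ℝ (maxFace S (‖v‖⁻¹ • v)))
    · obtain ⟨i, hi⟩ := hfac _ (by rw [norm_smul, norm_inv, norm_norm, inv_mul_cancel₀ hvn.ne']) hdim
      refine (hzC i ⟨(τ⁻¹, τ • z), ⟨⟨by positivity, inv_le_one_of_one_le₀ hτ1⟩, ?_⟩, ?_⟩).elim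
      · rw [hi]; exact hmem
      · simp only [smul_smul, inv_mul_cancel₀ hτpos.ne', one_smul]
    · push Not at hdim
      let l : V →ₗ[ℝ] ℝ := (innerₗ V).flip (‖v‖⁻¹ • v)
      let T : Set V := {q ∈ S | l q = l (τ • z)}
      have hzT : τ • z ∈ convexHull ℝ T :=
        mem_convexHull_max l (fun q hq => hmem.2 q (subset_convexHull ℝ _ hq)) hτP rfl
      have hTF : T ⊆ maxFace S (‖v‖⁻¹ • v) := by
        rintro q ⟨hq, hql⟩
        refine ⟨subset_convexHull ℝ _ hq, fun q' hq' => (hmem.2 q' hq').trans_eq ?_⟩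
        exact hql.symm
      have hTspan : convexHull ℝ T ⊆ (Submodule.span ℝ T : Set V) :=
        convexHull_min Submodule.subset_span (Submodule.convex _)
      have hspan : Submodule.span ℝ T ≠ ⊤ := by
        obtain ⟨t₀, ht₀⟩ : T.Nonempty := convexHull_nonempty_iff.1 ⟨_, hzT⟩
        have h1 : Submodule.span ℝ T ≤ vectorSpan ℝ T ⊔ ℝ ∙ t₀ := by
          rw [Submodule.span_le]
          intro t ht
          have : t = (t - t₀) + t₀ := by abel
          rw [this]
          exact Submodule.add_mem_sup (by simpa using vsub_mem_vectorSpan ℝ ht ht₀)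
            (Submodule.mem_span_singleton_self _)
        intro htop
        rw [htop, top_le_iff] at h1
        have h2 := Submodule.finrank_add_le_finrank_add_finrank (vectorSpan ℝ T) (ℝ ∙ t₀)
        rw [h1, finrank_top, hn] at h2
        have h3 : Module.finrank ℝ (ℝ ∙ t₀) ≤ 1 := by
          simpa using finrank_span_le_card (R := ℝ) ({t₀} : Set V)
        have h4 := Submodule.finrank_mono (vectorSpan_mono ℝ hTF)
        omega
      refine mem_biUnion (x := T) ⟨fun q hq => hq.1, hspan⟩ ?_
      have := Submodule.smul_mem _ τ⁻¹ (hTspan hzT)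
      rwa [smul_smul, inv_mul_cancel₀ hτpos.ne', one_smul] at this
  have hmeas : (μHE[n + 1] : Measure V) P = ∑ i, (μHE[n + 1] : Measure V) (C i) := by
    have h1 : (μHE[n + 1] : Measure V) P = (μHE[n + 1] : Measure V) (⋃ i, C i) := by
      refine le_antisymm ?_ (measure_mono (iUnion_subset hCP))
      calc (μHE[n + 1] : Measure V) P
          ≤ (μHE[n + 1] : Measure V) ((⋃ i, C i) ∪ (P \ ⋃ i, C i)) :=
            measure_mono (by rw [union_sdiff_self]; exact subset_union_right)
        _ ≤ _ := (measure_union_le _ _).trans (by rw [hcov, add_zero])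
    rw [h1, measure_iUnion₀ hdisj (fun i => (hCm i).nullMeasurableSet), tsum_fintype]
  have hfin : ∀ i, (μHE[n + 1] : Measure V) (C i) ≠ ⊤ := by
    intro i
    refine ne_top_of_le_ne_top ?_ (measure_mono (hCP i))
    rw [← hn]
    exact hPc.measure_lt_top.ne
  rw [Measure.real, hmeas, ENNReal.toReal_sum fun i _ => hfin i, Finset.mul_sum]
  refine Finset.sum_congr rfl fun i _ => ?_
  have := volume_cone hn (hu i) (hh i) (isCompact_maxFace hS (u i))
    (fun z hz => inner_eq_of_mem_maxFace hz (hp i))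
  rw [show C i = _ from rfl, this, ENNReal.toReal_mul, ENNReal.toReal_ofReal
    (div_nonneg (hh i).le (by positivity)), ← Measure.real]
  field_simp

omit hu hinj hfac hp hn hS [FiniteDimensional ℝ V] [MeasurableSpace V] [BorelSpace V] [Fintype ι] in
lemma maxFace_translate (x v : V) :
    maxFace ((fun q => q + x) '' S) v = (fun q => q + x) '' maxFace S v := by
  have h1 : convexHull ℝ ((fun q => q + x) '' S) = (fun q => q + x) '' convexHull ℝ S := by
    have := (AffineMap.image_convexHull (AffineEquiv.constVAdd ℝ V x : V →ᵃ[ℝ] V) S).symm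
    simpa [add_comm] using this
  unfold maxFace
  rw [h1]
  ext p
  constructor
  · rintro ⟨⟨q, hq, rfl⟩, h⟩
    refine ⟨q, ⟨hq, fun q' hq' => ?_⟩, rfl⟩
    have := h _ ⟨q', hq', rfl⟩
    simpa [inner_add_left] using this
  · rintro ⟨q, ⟨hq, h⟩, rfl⟩
    refine ⟨⟨q, hq, rfl⟩, ?_⟩
    rintro _ ⟨q', hq', rfl⟩
    simpa [inner_add_left] using h q' hq'

/-- The volume of a full-dimensional polytope in terms of its facets, with the apex of the pyramids
at an interior point `x`. -/
lemma volume_polytope_of_mem_interior {x : V} (hx : x ∈ interior (convexHull ℝ S)) :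
    (n + 1) * (μHE[n + 1] : Measure V).real (convexHull ℝ S) =
      ∑ i, ⟪p i - x, u i⟫ * (μHE[n] : Measure V).real (maxFace S (u i)) := by
  have hiso : Isometry (fun q : V => q + -x) := isometry_add_right _
  have hconv : convexHull ℝ ((fun q => q + -x) '' S) = (fun q => q + -x) '' convexHull ℝ S := by
    have := (AffineMap.image_convexHull (AffineEquiv.constVAdd ℝ V (-x) : V →ᵃ[ℝ] V) S).symm
    simpa [add_comm] using this
  have hvs : ∀ T : Set V, vectorSpan ℝ ((fun q => q + -x) '' T) = vectorSpan ℝ T := by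
    intro T
    have := AffineMap.map_vectorSpan (AffineEquiv.constVAdd ℝ V (-x) : V →ᵃ[ℝ] V) (s := T)
    simpa [add_comm] using this.symm
  have hmu : ∀ (m : ℕ) (T : Set V), (μHE[m] : Measure V).real ((fun q => q + -x) '' T) =
      (μHE[m] : Measure V).real T := fun m T => by
    rw [Measure.real, hiso.euclideanHausdorffMeasure_image, Measure.real]
  have := volume_polytope_of_zero_mem (S := (fun q => q + -x) '' S) hn (hS.image _) hu hinj
    (fun v hv h => hfac v hv (by rwa [maxFace_translate, hvs] at h)) (p := fun i => p i + -x)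
    (fun i => by rw [maxFace_translate]; exact ⟨_, hp i, rfl⟩) (by
      rw [hconv]
      have h1 : (fun q : V => q + -x) '' convexHull ℝ S = Homeomorph.addRight (-x) '' convexHull ℝ S :=
        rfl
      rw [h1, ← Homeomorph.image_interior]
      exact ⟨x, hx, by simp⟩)
  rw [hconv, hmu] at this
  rw [this]
  refine Finset.sum_congr rfl fun i _ => ?_
  rw [maxFace_translate, hmu, sub_eq_add_neg]

omit hfac hp in
/-- In a polytope without interior points, the contributions of the facets cancel. -/
lemma sum_facets_of_interior_eq_empty {E : Type*} [AddCommGroup E]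
    (hfac : ∀ v : V, ‖v‖ = 1 → n ≤ Module.finrank ℝ (vectorSpan ℝ (maxFace S v)) → ∃ i, u i = v)
    (hint : interior (convexHull ℝ S) = ∅) (hne : S.Nonempty) (g : ι → E)
    (hg0 : ∀ i, (μHE[n] : Measure V).real (maxFace S (u i)) = 0 → g i = 0)
    (hg : ∀ i j, u j = -u i → maxFace S (u i) = convexHull ℝ S → maxFace S (u j) = convexHull ℝ S →
      g i + g j = 0) : ∑ i, g i = 0 := by
  by_contra hsum
  -- A non-vanishing term forces the flat polytope to span exactly the hyperplane orthogonal to `u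
  -- i`. The whole polytope is then the face in both directions `u i` and `-u i`; these two terms
  -- cancel, and all others are zero.
  obtain ⟨i, -, hi⟩ := Finset.exists_ne_zero_of_sum_ne_zero hsum
  have hvS : vectorSpan ℝ S ≠ ⊤ := by
    intro htop
    have h1 : affineSpan ℝ S = ⊤ := by
      rw [AffineSubspace.affineSpan_eq_top_iff_vectorSpan_eq_top_of_nonempty _ _ _ hne]; exact htop
    rw [← interior_convexHull_nonempty_iff_affineSpan_eq_top, hint] at h1
    exact Set.not_nonempty_empty h1
  have hvS' : vectorSpan ℝ (convexHull ℝ S) = vectorSpan ℝ S :=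
    vectorSpan_convexHull_eq S
  have hfr : Module.finrank ℝ (vectorSpan ℝ S) ≤ n := by
    have := Submodule.finrank_lt hvS
    omega
  have hbig : ∀ j, g j ≠ 0 → vectorSpan ℝ S = (ℝ ∙ u j)ᗮ := by
    intro j hj
    have hdim : n ≤ Module.finrank ℝ (vectorSpan ℝ (maxFace S (u j))) := by
      by_contra hlt
      refine hj (hg0 j ?_)
      rw [Measure.real, euclideanHausdorffMeasure_eq_zero_of_finrank_lt
        (isCompact_maxFace hS (u j)).isBounded (not_le.1 hlt)]
      rfl
    have hle : vectorSpan ℝ (maxFace S (u j)) ≤ vectorSpan ℝ S := by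
      rw [← hvS']
      exact vectorSpan_mono ℝ fun q hq => hq.1
    have hle2 : vectorSpan ℝ (maxFace S (u j)) ≤ (ℝ ∙ u j)ᗮ := by
      rw [vectorSpan_def, Submodule.span_le]
      rintro _ ⟨a, ha, b, hb, rfl⟩
      show a - b ∈ (ℝ ∙ u j)ᗮ
      rw [Submodule.mem_orthogonal_singleton_iff_inner_left, inner_sub_left, inner_eq_of_mem_maxFace ha hb, sub_self]
    have h1 := Submodule.finrank_add_finrank_orthogonal (ℝ ∙ u j)
    rw [finrank_span_singleton (by intro h; have := hu j; rw [h] at this; simp at this), hn] at h1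
    rw [← Submodule.eq_of_le_of_finrank_le hle (by omega),
      Submodule.eq_of_le_of_finrank_le hle2 (by omega)]
  have hPface : ∀ v : V, vectorSpan ℝ S = (ℝ ∙ v)ᗮ → maxFace S v = convexHull ℝ S := by
    intro v hv
    refine Subset.antisymm (fun q hq => hq.1) fun q hq => ⟨hq, fun q' hq' => le_of_eq ?_⟩
    have h1 : q' - q ∈ vectorSpan ℝ (convexHull ℝ S) := by
      simpa using vsub_mem_vectorSpan ℝ hq' hq
    rw [hvS', hv, Submodule.mem_orthogonal_singleton_iff_inner_left, inner_sub_left] at h1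
    linarith
  have hVi := hbig i hi
  have hVn : vectorSpan ℝ S = (ℝ ∙ (-u i))ᗮ := by
    rw [hVi, ← Set.neg_singleton, Submodule.span_neg]
  have hdimS : Module.finrank ℝ (vectorSpan ℝ S) = n := by
    have h1 := Submodule.finrank_add_finrank_orthogonal (ℝ ∙ u i)
    rw [finrank_span_singleton (by intro h; have := hu i; rw [h] at this; simp at this), hn,
      ← hVi] at h1
    omega
  obtain ⟨j, hj⟩ := hfac (-u i) (by rw [norm_neg, hu]) (by rw [hPface _ hVn, hvS', hdimS])
  have hij : i ≠ j := by
    rintro rfl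
    have h1 : u i = 0 := by
      have : (2 : ℝ) • u i = 0 := by rw [two_smul]; nth_rw 1 [hj]; simp
      simpa using this
    have := hu i
    rw [h1] at this; simp at this
  refine hsum ?_
  rw [Finset.sum_eq_add i j hij (fun k _ hk => ?_) (by simp) (by simp)]
  · exact hg i j hj (hPface _ hVi) (by rw [hj]; exact hPface _ hVn)
  · by_contra hgk
    have h1 := hbig k hgk
    rw [hVi] at h1
    have h2 : u k ∈ ℝ ∙ u i := by
      have := congrArg Submodule.orthogonal h1
      rw [Submodule.orthogonal_orthogonal, Submodule.orthogonal_orthogonal] at this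
      rw [this]; exact Submodule.mem_span_singleton_self _
    obtain ⟨c, hc⟩ := Submodule.mem_span_singleton.1 h2
    have h3 : |c| = 1 := by
      have := congrArg norm hc
      rw [norm_smul, hu, hu, mul_one, Real.norm_eq_abs] at this
      exact this
    rcases (abs_eq zero_le_one).1 h3 with rfl | rfl
    · rw [one_smul] at hc; exact hk.1 (hinj hc.symm)
    · rw [neg_one_smul, ← hj] at hc; exact hk.2 (hinj hc.symm)

/-- **Minkowski relation and volume formula** for the facets of a polytope; among the given
normals, those of faces of too small dimension do not contribute. -/
theorem polytope_facets (hne : S.Nonempty) :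
    ∑ i, (μHE[n] : Measure V).real (maxFace S (u i)) • u i = 0 ∧
    (n + 1) * (μHE[n + 1] : Measure V).real (convexHull ℝ S) =
      ∑ i, ⟪p i, u i⟫ * (μHE[n] : Measure V).real (maxFace S (u i)) := by
  rcases (interior (convexHull ℝ S)).eq_empty_or_nonempty with hint | hint
  · constructor
    · refine sum_facets_of_interior_eq_empty hn hS hu hinj hfac hint hne _ (fun i hi => by simp [hi])
        fun i j hij hi hj => ?_
      rw [hi, hj, hij, smul_neg, add_neg_cancel]
    · rw [sum_facets_of_interior_eq_empty hn hS hu hinj hfac hint hne _ (fun i hi => by simp [hi])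
        fun i j hij hi hj => ?_]
      · have h0 : (μHE[n + 1] : Measure V) (convexHull ℝ S) = 0 := by
          rw [← hn]
          have h1 : (convexHull ℝ S : Set V) ⊆ affineSpan ℝ S := convexHull_subset_affineSpan S
          refine measure_mono_null h1 (Measure.addHaar_affineSubspace _ _ fun h2 => ?_)
          rw [← interior_convexHull_nonempty_iff_affineSpan_eq_top, hint] at h2
          exact Set.not_nonempty_empty h2
        rw [Measure.real, h0]; simp
      · have h1 : ⟪p i, u i⟫ = ⟪p j, u i⟫ :=
          inner_eq_of_mem_maxFace (hp i) (by rw [hi, ← hj]; exact hp j)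
        rw [hi, hj, hij, inner_neg_right, h1]
        ring
  · have hvol := fun x hx => volume_polytope_of_mem_interior hn hS hu hinj hfac hp (x := x) hx
    -- The pyramid formula is affine in the apex `x`, but its value is the volume for all interior
    -- `x`. So its linear part, the Minkowski sum, must vanish.
    have hexp : ∀ x, ∑ i, ⟪p i - x, u i⟫ * (μHE[n] : Measure V).real (maxFace S (u i)) =
        ∑ i, ⟪p i, u i⟫ * (μHE[n] : Measure V).real (maxFace S (u i)) -
          ⟪∑ i, (μHE[n] : Measure V).real (maxFace S (u i)) • u i, x⟫ := by
      intro x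
      rw [sum_inner, ← Finset.sum_sub_distrib]
      refine Finset.sum_congr rfl fun i _ => ?_
      rw [inner_sub_left, inner_smul_left, real_inner_comm x (u i)]
      simp only [conj_trivial]; ring
    obtain ⟨x₀, hx₀⟩ := hint
    have hzero : ∑ i, (μHE[n] : Measure V).real (maxFace S (u i)) • u i = 0 := by
      refine eq_zero_of_inner_eq_zero_on_open isOpen_interior ⟨x₀, hx₀⟩ (y := x₀) fun x hx => ?_
      have h1 := hvol x hx
      have h2 := hvol x₀ hx₀
      rw [hexp] at h1 h2
      rw [inner_sub_right]
      linarith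
    refine ⟨hzero, ?_⟩
    rw [hvol x₀ hx₀, hexp, hzero, inner_zero_left, sub_zero]

end Polytope

end Volume

/-- The facet relations for a polytope in a flat of Euclidean space. -/
theorem polytope_facets_of_flat {d n : ℕ} {W : Submodule ℝ (Euc d)}
    (hW : Module.finrank ℝ W = n + 1) {S : Set (Euc d)} (hS : S.Finite) {x : Euc d} (hx : x ∈ S)
    (hSW : ∀ z ∈ S, z - x ∈ W) {ι : Type*} [Fintype ι] {u : ι → Euc d} (huW : ∀ i, u i ∈ W)
    (hu : ∀ i, ‖u i‖ = 1) (hinj : Function.Injective u)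
    (hfac : ∀ v ∈ W, ‖v‖ = 1 → n ≤ flatDim (maxFace S v) → ∃ i, u i = v)
    {p : ι → Euc d} (hp : ∀ i, p i ∈ maxFace S (u i)) :
    ∑ i, flatVol n (maxFace S (u i)) • u i = 0 ∧
    (n + 1) * flatVol (n + 1) (convexHull ℝ S) =
      ∑ i, ⟪p i - x, u i⟫ * flatVol n (maxFace S (u i)) := by
  let f : W →ᵃ[ℝ] Euc d := (AffineEquiv.constVAdd ℝ (Euc d) x : Euc d →ᵃ[ℝ] Euc d).comp
    W.subtype.toAffineMap
  have hf : ∀ v, f v = x + (v : Euc d) := fun v => rfl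
  have hiso : Isometry f := isometry_add_coe W x
  set S' : Set W := f ⁻¹' S with hS'
  have himg : f '' S' = S := image_add_coe_preimage hSW
  have hconv : f '' convexHull ℝ S' = convexHull ℝ S := by
    rw [f.image_convexHull, himg]
  have hface : ∀ v : W, maxFace S (v : Euc d) = f '' maxFace S' v := by
    intro v
    unfold maxFace
    rw [← hconv]
    ext q
    constructor
    · rintro ⟨⟨q, hq, rfl⟩, h⟩
      refine ⟨q, ⟨hq, fun q' hq' => ?_⟩, rfl⟩
      have := h _ ⟨q', hq', rfl⟩
      simpa [hf, inner_add_left] using this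
    · rintro ⟨q, ⟨hq, h⟩, rfl⟩
      refine ⟨⟨q, hq, rfl⟩, ?_⟩
      rintro _ ⟨q', hq', rfl⟩
      simpa [hf, inner_add_left] using h q' hq'
  have hdim : ∀ T : Set W, flatDim (f '' T) = Module.finrank ℝ (vectorSpan ℝ T) := by
    intro T
    unfold flatDim
    rw [← AffineMap.map_vectorSpan]
    have : f.linear = W.subtype := by ext; simp [f]
    rw [this, Submodule.finrank_map_subtype_eq]
  have hvol : ∀ (m : ℕ) (T : Set W), flatVol m (f '' T) = (μHE[m] : Measure W).real T := by
    intro m T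
    unfold flatVol
    rw [Measure.real, hiso.euclideanHausdorffMeasure_image, Measure.real]
  have hS'fin : S'.Finite := hS.preimage hiso.injective.injOn
  have hface' : ∀ i, maxFace S (u i) = f '' maxFace S' ⟨u i, huW i⟩ := fun i => hface ⟨u i, huW i⟩
  have hp' : ∀ i, ∃ p' ∈ maxFace S' ⟨u i, huW i⟩, f p' = p i := fun i => by
    have := hp i
    rwa [hface'] at this
  choose p' hp'1 hp'2 using hp'
  obtain ⟨h1, h2⟩ := polytope_facets hW hS'fin (u := fun i => (⟨u i, huW i⟩ : W))
    (fun i => hu i) (fun i j hij => hinj (congrArg Subtype.val hij))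
    (fun v hv hd => by
      obtain ⟨i, hi⟩ := hfac v v.2 hv (by rw [hface, hdim]; exact hd)
      exact ⟨i, Subtype.ext hi⟩) hp'1 ⟨0, by simpa [hS', hf] using hx⟩
  constructor
  · have := congrArg W.subtype h1
    simp only [map_sum, map_smul, map_zero, Submodule.subtype_apply] at this
    rw [← this]
    exact Finset.sum_congr rfl fun i _ => by rw [hface', hvol]
  · rw [← hconv, hvol, h2]
    refine Finset.sum_congr rfl fun i _ => ?_
    rw [hface', hvol, ← hp'2, hf, add_sub_cancel_left]
    rfl

/-- A bounded set that contains a relative neighbourhood of a point has positive volume. -/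
lemma flatVol_pos {d : ℕ} {S : Set (Euc d)} (hS : Bornology.IsBounded S)
    (h : (intrinsicInterior ℝ S).Nonempty) : 0 < flatVol (flatDim S) S := by
  unfold flatVol flatDim
  obtain ⟨x, hx⟩ := h
  obtain ⟨hxS, ε, hε, H⟩ := mem_relint_iff.1 hx
  refine ENNReal.toReal_pos ?_ (euclideanHausdorffMeasure_lt_top hS).ne
  have hball : (fun v : vectorSpan ℝ S => x + (v : Euc d)) '' Metric.ball 0 ε ⊆ S := by
    rintro _ ⟨v, hv, rfl⟩
    exact H v v.2 (by simpa using hv)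
  refine (lt_of_lt_of_le ?_ (measure_mono hball)).ne'
  rw [(isometry_add_coe _ x).euclideanHausdorffMeasure_image]
  exact Metric.isOpen_ball.measure_pos _ ⟨0, by simpa using hε⟩

end

noncomputable section

open scoped RealInnerProductSpace

/-! ### Existence of reciprocals -/

/-- A local-constancy argument for a function that matters only at the points of `D`. Local
agreement can be chained along `S` because `D` meets the overlap of any two neighbourhoods of the
same point. -/
lemma eq_of_locally_eq_on_dense {X Y : Type*} [TopologicalSpace X] {S D : Set X}
    (hS : IsPreconnected S) (hD : Dense D) {J : X → Y}
    (h : ∀ x ∈ S, ∃ V ∈ 𝓝 x, ∀ a ∈ V ∩ D, ∀ b ∈ V ∩ D, J a = J b) {a b : X} (ha : a ∈ S ∩ D)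
    (hb : b ∈ S ∩ D) : J a = J b := by
  obtain ⟨V, hV, V', hV', H⟩ := hS.induction₂ (fun x x' => ∃ V ∈ 𝓝 x, ∃ V' ∈ 𝓝 x',
    ∀ a ∈ V ∩ D, ∀ b ∈ V' ∩ D, J a = J b) (fun x hx => by
      obtain ⟨V, hV, H⟩ := h x hx
      filter_upwards [mem_nhdsWithin_of_mem_nhds (eventually_mem_nhds_iff.2 hV)] with x' hx'
      exact ⟨V, hV, V, hx', H⟩)
    (fun x z x' _ _ _ h1 h2 => by
      obtain ⟨V, hV, V₁, hV₁, H1⟩ := h1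
      obtain ⟨V₂, hV₂, V', hV', H2⟩ := h2
      obtain ⟨c, hc, hcD⟩ := mem_closure_iff_nhds.1 (hD z) _ (inter_mem hV₁ hV₂)
      exact ⟨V, hV, V', hV', fun a ha b hb =>
        (H1 a ha c ⟨hc.1, hcD⟩).trans (H2 c ⟨hc.2, hcD⟩ b hb)⟩)
    (fun x x' _ _ h1 => by
      obtain ⟨V, hV, V', hV', H⟩ := h1
      exact ⟨V', hV', V, hV, fun a ha b hb => (H b hb a ha).symm⟩) ha.1 hb.1
  exact H a ⟨mem_of_mem_nhds hV, ha.2⟩ b ⟨mem_of_mem_nhds hV', hb.2⟩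

lemma mem_of_lineMap_mem {E : Type*} [AddCommGroup E] [Module ℝ E] {Q : AffineSubspace ℝ E}
    {o x : E} (ho : o ∈ Q) {t : ℝ} (ht : t ≠ 0) (h : AffineMap.lineMap o x t ∈ Q) : x ∈ Q := by
  have e : x = AffineMap.lineMap o (AffineMap.lineMap o x t) t⁻¹ := by
    simp only [AffineMap.lineMap_apply, vsub_eq_sub, vadd_eq_add, add_sub_cancel_right, smul_smul,
      inv_mul_cancel₀ ht, one_smul, sub_add_cancel]
  rw [e]
  exact AffineMap.lineMap_mem _ ho h

/-- Coordinates with respect to an orthonormal pair in the complement of a subspace of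
codimension two. -/
lemma eq_add_of_orthonormal_pair {d : ℕ} {V : Submodule ℝ (Euc d)}
    (hV : Module.finrank ℝ V + 2 = d) {e e' : Euc d} (he : ‖e‖ = 1) (he' : ‖e'‖ = 1)
    (hee : ⟪e, e'⟫ = 0) (hVe : ∀ a ∈ V, ⟪a, e⟫ = 0) (hVe' : ∀ a ∈ V, ⟪a, e'⟫ = 0) {v : Euc d}
    (hv : ∀ a ∈ V, ⟪a, v⟫ = 0) : v = ⟪e, v⟫ • e + ⟪e', v⟫ • e' := by
  have ho : Orthonormal ℝ ![e, e'] := by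
    rw [orthonormal_iff_ite]
    intro i j
    fin_cases i <;> fin_cases j <;>
      simp [hee, real_inner_comm e e', he, he']
  have hspan : Submodule.span ℝ {e, e'} = Vᗮ := by
    refine Submodule.eq_of_le_of_finrank_eq ?_ ?_
    · rw [Submodule.span_le]
      rintro x (rfl | rfl)
      · exact (Submodule.mem_orthogonal _ _).2 hVe
      · exact (Submodule.mem_orthogonal _ _).2 hVe'
    · have h1 := finrank_span_eq_card ho.linearIndependent
      have h2 := V.finrank_add_finrank_orthogonal
      rw [finrank_euclideanSpace_fin] at h2
      rw [Matrix.range_cons, Matrix.range_cons, Matrix.range_empty, union_empty, singleton_union,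
        Fintype.card_fin] at h1
      omega
  obtain ⟨a, b, hab⟩ := Submodule.mem_span_pair.1
    (hspan ▸ (Submodule.mem_orthogonal _ _).2 hv : v ∈ Submodule.span ℝ {e, e'})
  rw [← hab]
  simp [inner_add_right, inner_smul_right, hee, real_inner_comm e e', he, he']

/-- The segment from `o` to `x` meets `F`. -/
def Hits {d : ℕ} (o x : Euc d) (F : Set (Euc d)) : Prop :=
  ∃ t ∈ Icc (0 : ℝ) 1, AffineMap.lineMap o x t ∈ F

/-- `u` is the unit normal to `F` that points away from `o`. -/
structure IsNormalFrom {d : ℕ} (o : Euc d) (F : Set (Euc d)) (u : Euc d) : Prop where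
  norm_eq : ‖u‖ = 1
  perp : ∀ a ∈ vectorSpan ℝ F, ⟪a, u⟫ = 0
  pos : ∀ z ∈ F, 0 < ⟪u, z - o⟫

lemma lineMap_sub_left {d : ℕ} (o x : Euc d) (t : ℝ) :
    AffineMap.lineMap o x t - o = t • (x - o) := by
  simp [AffineMap.lineMap_apply]

lemma inner_lineMap_sub {d : ℕ} (u o x : Euc d) (t : ℝ) :
    ⟪u, AffineMap.lineMap o x t - o⟫ = t * ⟪u, x - o⟫ := by
  rw [lineMap_sub_left, inner_smul_right]

lemma IsNormalFrom.inner_eq {d : ℕ} {o : Euc d} {F : Set (Euc d)} {u : Euc d}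
    (hu : IsNormalFrom o F u) {z z' : Euc d} (hz : z ∈ F) (hz' : z' ∈ F) :
    ⟪u, z - o⟫ = ⟪u, z' - o⟫ := by
  have h := hu.perp _ (sub_mem_lin hz hz')
  rw [real_inner_comm] at h
  rw [← sub_eq_zero, ← inner_sub_right, sub_sub_sub_cancel_right, h]

/-- A segment from `o` meets `F` at most once. -/
lemma IsNormalFrom.lineMap_inj {d : ℕ} {o x : Euc d} {F : Set (Euc d)} {u : Euc d}
    (hu : IsNormalFrom o F u) {t t' : ℝ} (ht : AffineMap.lineMap o x t ∈ F)
    (ht' : AffineMap.lineMap o x t' ∈ F) : t = t' := by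
  have h := hu.inner_eq ht ht'
  have h0 := hu.pos _ ht
  rw [inner_lineMap_sub] at h h0
  rw [inner_lineMap_sub] at h
  exact mul_right_cancel₀ (right_ne_zero_of_mul h0.ne') h

lemma hits_lineMap {d : ℕ} {o x : Euc d} {F : Set (Euc d)} {l : ℝ} (hl : 0 < l) :
    Hits o (AffineMap.lineMap o x l) F ↔ ∃ t ∈ Icc 0 l, AffineMap.lineMap o x t ∈ F := by
  have e : ∀ t : ℝ, (AffineMap.lineMap o (AffineMap.lineMap o x l) t : Euc d) =
      AffineMap.lineMap o x (t * l) := fun t => by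
    simp [AffineMap.lineMap_apply, smul_smul]
  constructor
  · rintro ⟨t, ht, h⟩
    exact ⟨t * l, ⟨mul_nonneg ht.1 hl.le, mul_le_of_le_one_left hl.le ht.2⟩, e t ▸ h⟩
  · rintro ⟨t, ht, h⟩
    refine ⟨t / l, ⟨div_nonneg ht.1 hl.le, (div_le_one hl).2 ht.2⟩, ?_⟩
    rwa [e, div_mul_cancel₀ _ hl.ne']

lemma eventually_not_hits {d : ℕ} {o x₀ : Euc d} {F : Set (Euc d)} (hF : IsClosed F)
    (h : ¬ Hits o x₀ F) : ∀ᶠ x in 𝓝 x₀, ¬ Hits o x F := by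
  have : ∀ᶠ x in 𝓝 x₀, ∀ t ∈ Icc (0 : ℝ) 1, AffineMap.lineMap o x t ∉ F := by
    refine isCompact_Icc.eventually_forall_of_forall_eventually fun t ht => ?_
    have hc : Continuous fun z : Euc d × ℝ => (AffineMap.lineMap o z.1 z.2 : Euc d) := by
      simp only [AffineMap.lineMap_apply, vsub_eq_sub, vadd_eq_add]
      fun_prop
    exact (hF.isOpen_compl.preimage hc).mem_nhds (show (x₀, t) ∈ _ from fun hm => h ⟨t, ht, hm⟩)
  filter_upwards [this] with x hx
  rintro ⟨t, ht, hm⟩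
  exact hx t ht hm

lemma mem_of_perp_of_inner_eq_zero {d : ℕ} {V : Submodule ℝ (Euc d)}
    (hV : Module.finrank ℝ V + 1 = d) {u v : Euc d} (hu : ‖u‖ = 1) (hVu : ∀ a ∈ V, ⟪a, u⟫ = 0)
    (h : ⟪u, v⟫ = 0) : v ∈ V := by
  have hspan : Submodule.span ℝ {u} = Vᗮ := by
    refine Submodule.eq_of_le_of_finrank_eq ?_ ?_
    · rw [Submodule.span_singleton_le_iff_mem]
      exact (Submodule.mem_orthogonal _ _).2 hVu
    · have h2 := V.finrank_add_finrank_orthogonal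
      rw [finrank_euclideanSpace_fin] at h2
      rw [finrank_span_singleton (by rintro rfl; simp at hu)]
      omega
  rw [← V.orthogonal_orthogonal, ← hspan, Submodule.mem_orthogonal_singleton_iff_inner_right]
  exact h

lemma exists_isNormalFrom {d : ℕ} {F : Set (Euc d)} (hdim : flatDim F + 1 = d) {o z : Euc d}
    (hz : z ∈ F) (ho : o ∉ affineSpan ℝ F) : ∃ u, IsNormalFrom o F u := by
  obtain ⟨u, -, hu, hperp⟩ := CellDecomposition.exists_unit_perp (le_top : vectorSpan ℝ F ≤ ⊤) (by
    rw [finrank_top, finrank_euclideanSpace_fin]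
    unfold flatDim at hdim
    omega)
  have hne : ⟪u, z - o⟫ ≠ 0 := by
    intro h0
    have h1 := mem_of_perp_of_inner_eq_zero hdim hu hperp h0
    rw [← direction_affineSpan] at h1
    have := AffineSubspace.vadd_mem_of_mem_direction (Submodule.neg_mem _ h1)
      (subset_affineSpan ℝ _ hz)
    rw [vadd_eq_add, neg_sub, sub_add_cancel] at this
    exact ho this
  have key : ∀ v : Euc d, ‖v‖ = 1 → (∀ a ∈ vectorSpan ℝ F, ⟪a, v⟫ = 0) → 0 < ⟪v, z - o⟫ →
      IsNormalFrom o F v := fun v hv hvp hpos => ⟨hv, hvp, fun z' hz' => by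
    have h := hvp _ (sub_mem_lin hz' hz)
    rw [real_inner_comm] at h
    rw [← sub_add_sub_cancel z' z o, inner_add_right, h, zero_add]
    exact hpos⟩
  rcases hne.lt_or_gt with h | h
  · exact ⟨-u, key _ (by rwa [norm_neg]) (fun a ha => by rw [inner_neg_right, hperp a ha, neg_zero])
      (by rw [inner_neg_left]; linarith)⟩
  · exact ⟨u, key u hu hperp h⟩

/-- Whether a segment from `o` to a point near `x₀` meets `F` is decided by the local shape of `F`
at the point where the segment to `x₀` meets it. -/
lemma eventually_hits_iff {d : ℕ} {o x₀ : Euc d} {F : Set (Euc d)} {u : Euc d}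
    (hu : IsNormalFrom o F u) (hdim : flatDim F + 1 = d) (hx₀ : x₀ ∉ F) {t₀ : ℝ}
    (ht₀ : t₀ ∈ Icc (0 : ℝ) 1) {z : Euc d} (hz : AffineMap.lineMap o x₀ t₀ = z) (hzF : z ∈ F)
    {m : Euc d} {ε : ℝ} (hε : 0 < ε)
    (hm : ∀ v ∈ vectorSpan ℝ F, ‖v‖ < ε → (z + v ∈ F ↔ 0 ≤ ⟪m, v⟫)) :
    ∀ᶠ x in 𝓝 x₀, ∃ τ : ℝ, 0 < τ ∧ AffineMap.lineMap o x τ - z ∈ vectorSpan ℝ F ∧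
      (Hits o x F ↔ 0 ≤ ⟪m, AffineMap.lineMap o x τ - z⟫) := by
  -- `c` is the height of the hyperplane of `F` above `o`. The ray from `o` through `x` meets this
  -- hyperplane at parameter `c / ⟪u, x - o⟫`, which depends continuously on `x` and is below `1`
  -- near `x₀`.
  set c := ⟪u, z - o⟫ with hc
  have hcpos : 0 < c := hu.pos z hzF
  have hct : c = t₀ * ⟪u, x₀ - o⟫ := by rw [hc, ← hz, inner_lineMap_sub]
  have ht₁ : t₀ < 1 := by
    refine lt_of_le_of_ne ht₀.2 fun h => hx₀ ?_
    rw [h, AffineMap.lineMap_apply_one] at hz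
    rwa [hz]
  have hb : c < ⟪u, x₀ - o⟫ := by nlinarith [ht₀.1]
  have hcont : ContinuousAt (fun x : Euc d => c / ⟪u, x - o⟫) x₀ :=
    continuousAt_const.div (by fun_prop) (hcpos.trans hb).ne'
  have hcont' : ContinuousAt (fun x : Euc d =>
      (AffineMap.lineMap o x (c / ⟪u, x - o⟫) : Euc d)) x₀ := by
    simp only [AffineMap.lineMap_apply, vsub_eq_sub, vadd_eq_add]
    exact (hcont.smul (by fun_prop)).add continuousAt_const
  have hv : AffineMap.lineMap o x₀ (c / ⟪u, x₀ - o⟫) = z := by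
    rw [hct, mul_div_cancel_right₀ _ (hcpos.trans hb).ne', hz]
  have hlt : ∀ᶠ x in 𝓝 x₀, c < ⟪u, x - o⟫ :=
    (show ContinuousAt (fun x : Euc d => ⟪u, x - o⟫) x₀ by fun_prop).eventually_const_lt hb
  have hnear := hcont'.eventually (Metric.ball_mem_nhds _ hε)
  simp only [hv] at hnear
  filter_upwards [hlt, hnear] with x hx hxn
  have hpos := hcpos.trans hx
  have hmem : AffineMap.lineMap o x (c / ⟪u, x - o⟫) - z ∈ vectorSpan ℝ F := by
    refine mem_of_perp_of_inner_eq_zero hdim hu.norm_eq hu.perp ?_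
    rw [← sub_sub_sub_cancel_right _ z o, inner_sub_right, inner_lineMap_sub,
      div_mul_cancel₀ _ hpos.ne', hc, sub_self]
  refine ⟨c / ⟪u, x - o⟫, div_pos hcpos hpos, hmem, ?_⟩
  rw [← hm _ hmem (by rwa [← dist_eq_norm]), add_sub_cancel]
  constructor
  · rintro ⟨t, ht, htF⟩
    have h1 := hu.inner_eq htF hzF
    rw [inner_lineMap_sub, ← hc] at h1
    rwa [← h1, mul_div_cancel_right₀ _ hpos.ne']
  · exact fun h => ⟨_, ⟨(div_pos hcpos hpos).le, (div_le_one hpos).2 hx.le⟩, h⟩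

namespace CellDecomposition

variable {d : ℕ} {Δ : CellDecomposition d}

/-- The away-pointing unit normal of a facet near a codimension two cell `E`, from its inner
normal, by a rotation of the plane perpendicular to `E`. -/
lemma normalFrom_eq {E F : Set (Euc d)} (hE : E ∈ Δ.cells) (hF : F ∈ Δ.cells) (hEF : E ⊆ F)
    (hEd : flatDim E + 2 = d) (hFd : flatDim F + 1 = d) {o z u e e' : Euc d}
    (hu : IsNormalFrom o F u) (hz : z ∈ E) (he : ‖e‖ = 1) (he' : ‖e'‖ = 1)
    (hee : ⟪e, e'⟫ = 0) (hEe : ∀ a ∈ vectorSpan ℝ E, ⟪a, e⟫ = 0)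
    (hEe' : ∀ a ∈ vectorSpan ℝ E, ⟪a, e'⟫ = 0) {ρ : ℝ} (hρ : 0 < ρ)
    (hzo : z - o - ρ • e ∈ vectorSpan ℝ E) :
    (0 < ⟪e', innerNormal E F⟫ ∧
      u = ⟪e', innerNormal E F⟫ • e - ⟪e, innerNormal E F⟫ • e') ∨
    (⟪e', innerNormal E F⟫ < 0 ∧
      u = -(⟪e', innerNormal E F⟫ • e - ⟪e, innerNormal E F⟫ • e')) := by
  obtain ⟨hn, hn1, hnp, -⟩ := innerNormal_spec hE hF hEF (by omega)
  set n := innerNormal E F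
  have hn_eq := eq_add_of_orthonormal_pair hEd he he' hee hEe hEe' hnp
  have hu_eq := eq_add_of_orthonormal_pair hEd he he' hee hEe hEe'
    (fun a ha => hu.perp a (vectorSpan_mono ℝ hEF ha))
  have hnu : ⟪n, u⟫ = 0 := hu.perp n hn
  have hpos := hu.pos z (hEF hz)
  have h0 : ⟪u, z - o - ρ • e⟫ = 0 := by
    rw [real_inner_comm]; exact hu.perp _ (vectorSpan_mono ℝ hEF hzo)
  rw [inner_sub_right, inner_smul_right, real_inner_comm e u] at h0
  have hγ : 0 < ⟪e, u⟫ := by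
    by_contra! hle
    nlinarith
  -- In the plane of `e`, `e'`, the vectors `n = (α, β)` and `u = (γ, δ)` are orthogonal unit
  -- vectors, so `u` is `(β, -α)` up to sign. Since `γ > 0`, the sign is that of `β`.
  set α := ⟪e, n⟫
  set β := ⟪e', n⟫
  set γ := ⟪e, u⟫
  set δ := ⟪e', u⟫
  have hee' : ⟪e', e⟫ = 0 := by rw [real_inner_comm]; exact hee
  have e1 : α ^ 2 + β ^ 2 = 1 := by
    have := congrArg (fun v => ⟪n, v⟫) hn_eq
    simp only [inner_add_right, inner_smul_right, real_inner_self_eq_norm_sq, hn1] at this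
    rw [real_inner_comm, real_inner_comm e' n] at this
    linarith
  have e2 : γ ^ 2 + δ ^ 2 = 1 := by
    have := congrArg (fun v => ⟪u, v⟫) hu_eq
    simp only [inner_add_right, inner_smul_right, real_inner_self_eq_norm_sq, hu.norm_eq] at this
    rw [real_inner_comm, real_inner_comm e' u] at this
    linarith
  have e3 : α * γ + β * δ = 0 := by
    have := congrArg (fun v => ⟪n, v⟫) hu_eq
    simp only [inner_add_right, inner_smul_right, hnu] at this
    rw [real_inner_comm e n, real_inner_comm e' n] at this
    linarith
  have e4 : γ ^ 2 = β ^ 2 := by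
    have : α ^ 2 * γ ^ 2 = β ^ 2 * δ ^ 2 := by
      rw [← mul_pow, ← mul_pow, show α * γ = -(β * δ) by linarith, neg_sq]
    nlinarith
  rcases sq_eq_sq_iff_eq_or_eq_neg.1 e4 with h | h
  · have hδ : δ = -α := by
      have : γ * (δ + α) = 0 := by rw [← h] at e3; linarith
      rcases mul_eq_zero.1 this with h' | h' <;> linarith
    left
    refine ⟨by linarith, ?_⟩
    rw [hu_eq, ← h, hδ, neg_smul, sub_eq_add_neg]
  · have hδ : δ = α := by
      have : γ * (δ - α) = 0 := by rw [show β = -γ by linarith] at e3; linarith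
      rcases mul_eq_zero.1 this with h' | h' <;> linarith
    right
    refine ⟨by linarith, ?_⟩
    rw [hu_eq, show β = -γ by linarith, hδ, neg_smul]; abel

/-- A segment that avoids the subcells of `F` of codimension two or more in the space either meets
`F` in its relative interior, transversally, or misses the closed set `F`. Both are stable under
small motions of the end point. -/
lemma eventually_hits_iff_of_forall_not_hits {F : Set (Euc d)} (hF : F ∈ Δ.cells)
    (hFd : flatDim F + 1 = d) {o x₀ u : Euc d} (hu : IsNormalFrom o F u) (hx₀ : x₀ ∉ F)
    (hno : ∀ E ∈ Δ.cells, E ⊆ F → flatDim E + 2 ≤ d → ¬ Hits o x₀ E) :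
    ∀ᶠ x in 𝓝 x₀, (Hits o x F ↔ Hits o x₀ F) := by
  by_cases h : Hits o x₀ F
  · obtain ⟨t₀, ht₀, hzF⟩ := id h
    obtain ⟨K, hK, hKF, hzK⟩ := exists_carrier hF hzF
    have hKd : flatDim F ≤ flatDim K := by
      by_contra! hlt
      exact hno K hK hKF (by omega) ⟨t₀, ht₀, relint_subset hzK⟩
    obtain rfl := eq_of_subset_of_dim_le hF hK hKF hKd
    obtain ⟨ε, hε, H⟩ := (mem_relint_iff.1 hzK).2
    -- At a relative interior point `F` is locally its entire flat: the half-flat condition with `m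
    -- = 0` is always true.
    filter_upwards [eventually_hits_iff (m := 0) hu hFd hx₀ ht₀ rfl hzF hε fun v hv hvε => by
      simpa using H v hv hvε] with x ⟨τ, _, _, hτ⟩
    simp only [inner_zero_left, le_refl, iff_true] at hτ
    exact iff_of_true hτ h
  · filter_upwards [eventually_not_hits (Δ.isFlatCell F hF).isClosed h] with x hx
    exact iff_of_false hx h

open Classical in
/-- The jump `a` if the segment from `o` to `x` meets `F`. -/
def jump (o x : Euc d) (F : Set (Euc d)) (a : Euc d) : Euc d := if Hits o x F then a else 0

lemma jump_congr {o x x' : Euc d} {F : Set (Euc d)} {a : Euc d} (h : Hits o x F ↔ Hits o x' F) :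
    jump o x F a = jump o x' F a := by
  unfold jump
  split_ifs <;> tauto

/-- The sum of the jumps at the facets around a cell `E` of codimension two does not depend on the
side on which `E` is passed. -/
lemma exists_nhds_sum_jump_eq {E : Set (Euc d)} (hE : E ∈ Δ.cells) (hEd : flatDim E + 2 = d)
    {o x₀ : Euc d} (ho : o ∉ affineSpan ℝ E) {t₀ : ℝ} (ht₀ : t₀ ∈ Icc (0 : ℝ) 1)
    (hz : AffineMap.lineMap o x₀ t₀ ∈ intrinsicInterior ℝ E) (T : Finset (Δ.StressCell d))
    (hT : ∀ F ∈ T, E ⊆ F.1) {ν : Δ.StressCell d → Euc d} {σ : Δ.StressCell d → ℝ}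
    (hν : ∀ F ∈ T, IsNormalFrom o F.1 (ν F)) (hx₀ : ∀ F ∈ T, x₀ ∉ F.1)
    (hσ : ∑ F ∈ T, σ F • innerNormal E F.1 = 0) :
    ∃ V ∈ 𝓝 x₀, ∀ x ∈ V, ∀ x' ∈ V, x ∉ affineSpan ℝ (insert o E) →
      x' ∉ affineSpan ℝ (insert o E) →
      ∑ F ∈ T, jump o x F.1 (σ F • ν F) = ∑ F ∈ T, jump o x' F.1 (σ F • ν F) := by
  classical
  set z : Euc d := AffineMap.lineMap o x₀ t₀ with hz_def
  have hzE := relint_subset hz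
  set V := vectorSpan ℝ E with hV
  set q : Euc d := z - o - V.starProjection (z - o) with hq
  have hqV : z - o - q ∈ V := by
    rw [hq, sub_sub_cancel]; exact V.starProjection_apply_mem _
  have hVq : ∀ a ∈ V, ⟪a, q⟫ = 0 :=
    (Submodule.mem_orthogonal _ _).1 (V.sub_starProjection_mem_orthogonal (z - o))
  have hq0 : q ≠ 0 := by
    intro h0
    rw [h0, sub_zero] at hqV
    apply ho
    have := AffineSubspace.vadd_mem_of_mem_direction
      (by rw [direction_affineSpan]; exact V.neg_mem hqV : -(z - o) ∈ (affineSpan ℝ E).direction)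
      (subset_affineSpan ℝ _ hzE)
    rwa [vadd_eq_add, neg_sub, sub_add_cancel] at this
  set ρ := ‖q‖ with hρ
  have hρpos : 0 < ρ := norm_pos_iff.2 hq0
  set e : Euc d := ρ⁻¹ • q with he_def
  have hρe : ρ • e = q := by rw [he_def, smul_smul, mul_inv_cancel₀ hρpos.ne', one_smul]
  have he : ‖e‖ = 1 := by
    rw [he_def, norm_smul, norm_inv, norm_norm, ← hρ, inv_mul_cancel₀ hρpos.ne']
  have hVe : ∀ a ∈ V, ⟪a, e⟫ = 0 := fun a ha => by
    rw [he_def, inner_smul_right, hVq a ha, mul_zero]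
  obtain ⟨e', -, he', hperp⟩ := exists_unit_perp (le_top : V ⊔ Submodule.span ℝ {e} ≤ ⊤) (by
    rw [finrank_top, finrank_euclideanSpace_fin]
    have h1 := Submodule.finrank_add_le_finrank_add_finrank V (Submodule.span ℝ {e})
    have h2 : Module.finrank ℝ (Submodule.span ℝ {e}) ≤ 1 :=
      (finrank_span_singleton (by rintro h0; simp [h0] at he)).le
    change Module.finrank ℝ V + 2 = d at hEd
    omega)
  have hVe' : ∀ a ∈ V, ⟪a, e'⟫ = 0 := fun a ha => hperp a (Submodule.mem_sup_left ha)
  have hee : ⟪e, e'⟫ = 0 := hperp e (Submodule.mem_sup_right (Submodule.mem_span_singleton_self e))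
  have hzo : z - o - ρ • e ∈ V := by rwa [hρe]
  have hze' : ⟪e', z - o⟫ = 0 := by
    have := hVe' _ hzo
    rwa [real_inner_comm, inner_sub_right, inner_smul_right, real_inner_comm e e', hee, mul_zero,
      sub_zero] at this
  -- `e'` is normal to the hyperplane spanned by `o` and `E`, so `⟪e', x - o⟫` tells on which side
  -- of `E` the segment to `x` passes.
  have hgen : ∀ x, x ∉ affineSpan ℝ (insert o E) → ⟪e', x - o⟫ ≠ 0 := by
    intro x hx h0
    apply hx
    have h1 := eq_add_of_orthonormal_pair hEd he he' hee hVe hVe'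
      ((Submodule.mem_orthogonal _ _).1 (V.sub_starProjection_mem_orthogonal (x - o)))
    have h2 : ⟪e', x - o - V.starProjection (x - o)⟫ = 0 := by
      rw [inner_sub_right, h0, real_inner_comm, hVe' _ (V.starProjection_apply_mem _), sub_zero]
    rw [h2, zero_smul, add_zero, sub_eq_iff_eq_add] at h1
    have hle : V ≤ vectorSpan ℝ (insert o E) := vectorSpan_mono ℝ (subset_insert _ _)
    have hoz : z - o ∈ vectorSpan ℝ (insert o E) :=
      vsub_mem_vectorSpan ℝ (mem_insert_of_mem _ hzE) (mem_insert _ _)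
    have hemem : e ∈ vectorSpan ℝ (insert o E) := by
      rw [he_def]
      refine Submodule.smul_mem _ _ ?_
      rw [show q = z - o - (z - o - q) by abel]
      exact Submodule.sub_mem _ hoz (hle hqV)
    have h3 : x - o ∈ (affineSpan ℝ (insert o E)).direction := by
      rw [direction_affineSpan, h1]
      exact Submodule.add_mem _ (Submodule.smul_mem _ _ hemem)
        (hle (V.starProjection_apply_mem _))
    have := AffineSubspace.vadd_mem_of_mem_direction h3
      (subset_affineSpan ℝ _ (mem_insert o E))
    rwa [vadd_eq_add, sub_add_cancel] at this
  have hR : ∀ F ∈ T, (0 < ⟪e', innerNormal E F.1⟫ ∧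
      ν F = ⟪e', innerNormal E F.1⟫ • e - ⟪e, innerNormal E F.1⟫ • e') ∨
      (⟪e', innerNormal E F.1⟫ < 0 ∧
      ν F = -(⟪e', innerNormal E F.1⟫ • e - ⟪e, innerNormal E F.1⟫ • e')) := fun F hF =>
    normalFrom_eq hE F.2.1 (hT F hF) hEd F.2.2 (hν F hF) hzE he he' hee hVe hVe' hρpos hzo
  -- The equilibrium `hσ`, rotated by a right angle in the plane perpendicular to `E`. The rotated
  -- inner normals are the normals pointing away from `o`, with opposite signs on the two sides.
  have hbal : ∑ F ∈ T, (if 0 < ⟪e', innerNormal E F.1⟫ then σ F • ν F else 0) =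
      ∑ F ∈ T, (if ⟪e', innerNormal E F.1⟫ < 0 then σ F • ν F else 0) := by
    rw [← sub_eq_zero, ← Finset.sum_sub_distrib]
    have h1 : ∀ F ∈ T, ((if 0 < ⟪e', innerNormal E F.1⟫ then σ F • ν F else 0) -
        if ⟪e', innerNormal E F.1⟫ < 0 then σ F • ν F else 0) =
        ⟪e', σ F • innerNormal E F.1⟫ • e - ⟪e, σ F • innerNormal E F.1⟫ • e' := by
      intro F hF
      rw [inner_smul_right, inner_smul_right, mul_smul, mul_smul, ← smul_sub]
      rcases hR F hF with ⟨h, h'⟩ | ⟨h, h'⟩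
      · rw [if_pos h, if_neg h.not_gt, sub_zero, h']
      · rw [if_pos h, if_neg h.not_gt, zero_sub, h', smul_neg, neg_neg]
    rw [Finset.sum_congr rfl h1, Finset.sum_sub_distrib, ← Finset.sum_smul, ← Finset.sum_smul,
      ← inner_sum, ← inner_sum, hσ]
    simp
  -- Near `x₀`, the segment to `x` crosses those facets around `E` that lie on the same side as `x`
  -- of the hyperplane through `o` and `E`.
  have hev : ∀ᶠ x in 𝓝 x₀, ∀ F ∈ T, x ∉ affineSpan ℝ (insert o E) →
      (Hits o x F.1 ↔ 0 < ⟪e', innerNormal E F.1⟫ * ⟪e', x - o⟫) := by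
    rw [Filter.eventually_all_finset]
    intro F hF
    obtain ⟨hn, hn1, hnp, hn2⟩ := innerNormal_spec hE F.2.1 (hT F hF)
      (by have := F.2.2; omega)
    obtain ⟨ε, hε, H⟩ := hn2 z hz
    filter_upwards [eventually_hits_iff (hν F hF) F.2.2 (hx₀ F hF) ht₀ hz_def.symm
      (hT F hF hzE) hε H] with x ⟨τ, hτ, hmem, hiff⟩ hx
    rw [hiff]
    have hκ := hgen x hx
    have h1 := lin_decomp (hT F hF) (by have := F.2.2; omega) hn1 hn hnp hmem
    set v := AffineMap.lineMap o x τ - z with hv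
    set n := innerNormal E F.1
    have h2 : τ * ⟪e', x - o⟫ = ⟪n, v⟫ * ⟪e', n⟫ := by
      have := hVe' _ h1
      rw [real_inner_comm, inner_sub_right, inner_smul_right, hv,
        ← sub_sub_sub_cancel_right _ z o, inner_sub_right e', hze', sub_zero,
        inner_lineMap_sub, sub_sub_sub_cancel_right, ← hv] at this
      linarith
    have hβ : ⟪e', n⟫ ≠ 0 := by
      intro h0
      rw [h0, mul_zero] at h2
      exact (mul_ne_zero hτ.ne' hκ) h2
    have h3 : ⟪e', n⟫ * ⟪e', x - o⟫ * τ = ⟪n, v⟫ * ⟪e', n⟫ ^ 2 := by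
      rw [mul_assoc, mul_comm _ τ, h2]; ring
    have hβ2 : 0 < ⟪e', n⟫ ^ 2 := by positivity
    have hne : ⟪e', n⟫ * ⟪e', x - o⟫ ≠ 0 := mul_ne_zero hβ hκ
    constructor
    · intro h
      refine lt_of_le_of_ne ?_ hne.symm
      by_contra! hlt
      nlinarith [mul_nonneg h hβ2.le]
    · intro h
      by_contra! hlt
      nlinarith [mul_pos h hτ]
  have hval : ∀ᶠ x in 𝓝 x₀, x ∉ affineSpan ℝ (insert o E) →
      ∑ F ∈ T, jump o x F.1 (σ F • ν F) =
        ∑ F ∈ T, (if 0 < ⟪e', innerNormal E F.1⟫ then σ F • ν F else 0) := by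
    filter_upwards [hev] with x hx hxE
    rcases (hgen x hxE).lt_or_gt with h | h
    · rw [hbal]
      refine Finset.sum_congr rfl fun F hF => ?_
      unfold jump
      refine if_congr ((hx F hF hxE).trans ?_) rfl rfl
      constructor
      · intro h'; exact (neg_iff_neg_of_mul_pos h').2 h
      · intro h'; exact mul_pos_of_neg_of_neg h' h
    · refine Finset.sum_congr rfl fun F hF => ?_
      unfold jump
      exact if_congr ((hx F hF hxE).trans (mul_pos_iff_of_pos_right h)) rfl rfl
  exact ⟨_, hval, fun x hx x' hx' h h' => (hx h).trans (hx' h').symm⟩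

/-- The points from which the segment to `o` avoids the cells of codimension two at `y`. -/
def generic (Δ : CellDecomposition d) (y o : Euc d) : Set (Euc d) :=
  {x | ∀ E ∈ Δ.cells, y ∈ E → flatDim E + 2 ≤ d → x ∉ affineSpan ℝ (insert o E)}

lemma dense_generic (y o : Euc d) : Dense (Δ.generic y o) := by
  refine dense_iff_inter_open.2 fun U hU hne => ?_
  obtain ⟨x, hx, h⟩ := exists_generic_point (s := {E ∈ Δ.cells | y ∈ E ∧ flatDim E + 2 ≤ d})
    ((finite_cells_at y).subset fun E hE => ⟨hE.1, hE.2.1⟩) (fun E => affineSpan ℝ (insert o E))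
    (fun E hE => affineSpan_ne_top ((Nat.lt_succ_of_le (flatDim_insert_le E o)).trans_le hE.2.2))
    hU hne
  exact ⟨x, hx, fun E hE hy hd => h E ⟨hE, hy, hd⟩⟩

lemma generic_of_lineMap {y o x : Euc d} {t : ℝ} (h : x ∈ Δ.generic y o) (ht : t ≠ 0) :
    AffineMap.lineMap o x t ∈ Δ.generic y o := fun E hE hy hd hm =>
  h E hE hy hd (mem_of_lineMap_mem (subset_affineSpan ℝ _ (mem_insert _ _)) ht hm)

lemma finite_stressCells (k : ℕ) (y : Euc d) : {F : Δ.StressCell k | y ∈ F.1}.Finite :=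
  Finite.of_finite_image ((finite_cells_at y).subset (by
    rintro _ ⟨F, hF, rfl⟩
    exact ⟨F.2.1, hF⟩)) Subtype.val_injective.injOn

/-- The facets that contain `y`. -/
def facetsAt (Δ : CellDecomposition d) (y : Euc d) : Finset (Δ.StressCell d) :=
  (finite_stressCells d y).toFinset

lemma mem_facetsAt {y : Euc d} {F : Δ.StressCell d} : F ∈ Δ.facetsAt y ↔ y ∈ F.1 := by
  simp [facetsAt]

/-- The total jump at the facets between `o` and `x`. -/
def totalJump (Δ : CellDecomposition d) (y o : Euc d) (a : Δ.StressCell d → Euc d) (x : Euc d) :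
    Euc d :=
  ∑ F ∈ Δ.facetsAt y, jump o x F.1 (a F)

section

variable {w : Set (Euc d) → ℝ} {s : Δ.StressCell d → ℝ} {G : Set (Euc d)} {y o : Euc d} {ε : ℝ}
  {ν : Δ.StressCell d → Euc d}
  (hs : Δ.IsStress w d s) (hG : G ∈ Δ.cells) (hint : Δ.IsInternal G)
  (hy : y ∈ intrinsicInterior ℝ G)
  (hst : ∀ C ∈ Δ.cells, ∀ z ∈ C, dist z y < ε → y ∈ C) (ho : o ∈ Metric.ball y ε)
  (hoE : ∀ E ∈ Δ.cells, y ∈ E → flatDim E < d → o ∉ affineSpan ℝ E)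
  (hν : ∀ F : Δ.StressCell d, y ∈ F.1 → IsNormalFrom o F.1 (ν F))
include hs hG hint hy hst ho hoE hν

/-- The segment to `x₀` avoids codimension three, so it meets cells of codimension two only in their
relative interiors. Facets containing none of the cells of codimension two that are met contribute
stable jumps; the others are grouped around these cells, where equilibrium balances the jumps. -/
lemma exists_nhds_totalJump_eq {x₀ : Euc d} (hx₀ : x₀ ∈ Metric.ball y ε)
    (hx₀F : ∀ F : Δ.StressCell d, y ∈ F.1 → x₀ ∉ F.1)
    (hx₀E : ∀ E ∈ Δ.cells, y ∈ E → flatDim E + 3 ≤ d → ¬ Hits o x₀ E) :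
    ∃ V ∈ 𝓝 x₀, ∀ x ∈ V ∩ Δ.generic y o, ∀ x' ∈ V ∩ Δ.generic y o,
      Δ.totalJump y o (fun F => (s F * w F.1) • ν F) x =
        Δ.totalJump y o (fun F => (s F * w F.1) • ν F) x' := by
  classical
  have hhit : ∀ E ∈ Δ.cells, Hits o x₀ E → y ∈ E := by
    rintro E hE ⟨t, ht, hz⟩
    exact hst E hE _ hz ((convex_ball y ε).lineMap_mem ho hx₀ ht)
  have hfin : {E ∈ Δ.cells | Hits o x₀ E ∧ flatDim E + 2 = d}.Finite :=
    (finite_cells_at y).subset fun E hE => ⟨hE.1, hhit E hE.1 hE.2.1⟩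
  set 𝓔 := hfin.toFinset with h𝓔
  have hmem : ∀ {E}, E ∈ 𝓔 ↔ E ∈ Δ.cells ∧ Hits o x₀ E ∧ flatDim E + 2 = d :=
    hfin.mem_toFinset
  have hcar : ∀ E ∈ 𝓔, ∀ t ∈ Icc (0 : ℝ) 1, AffineMap.lineMap o x₀ t ∈ E →
      AffineMap.lineMap o x₀ t ∈ intrinsicInterior ℝ E := by
    intro E hE t ht hz
    obtain ⟨hEc, -, hEd⟩ := hmem.1 hE
    obtain ⟨K, hK, hKE, hzK⟩ := exists_carrier hEc hz
    have hKd : flatDim E ≤ flatDim K := by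
      by_contra! hlt
      have hH : Hits o x₀ K := ⟨t, ht, relint_subset hzK⟩
      exact hx₀E K hK (hhit K hK hH) (by omega) hH
    obtain rfl := eq_of_subset_of_dim_le hEc hK hKE hKd
    exact hzK
  -- A facet is met by the segment in at most one point, so it belongs to at most one of the groups.
  have huniq : ∀ F : Δ.StressCell d, y ∈ F.1 → ∀ E ∈ 𝓔, ∀ E' ∈ 𝓔, E ⊆ F.1 → E' ⊆ F.1 → E = E' := by
    intro F hyF E hE E' hE' hEF hEF'
    obtain ⟨hEc, ⟨t, ht, hz⟩, -⟩ := hmem.1 hE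
    obtain ⟨hEc', ⟨t', ht', hz'⟩, -⟩ := hmem.1 hE'
    have htt := (hν F hyF).lineMap_inj (hEF hz) (hEF' hz')
    subst htt
    exact carrier_unique hEc hEc' (hcar E hE t ht hz) (hcar E' hE' t ht hz')
  set a : Δ.StressCell d → Euc d := fun F => (s F * w F.1) • ν F with ha
  have hA : ∀ F ∈ Δ.facetsAt y, ∃ V ∈ 𝓝 x₀, (∀ E ∈ 𝓔, ¬ E ⊆ F.1) → ∀ x ∈ V, ∀ x' ∈ V,
      jump o x F.1 (a F) = jump o x' F.1 (a F) := by
    intro F hF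
    rw [mem_facetsAt] at hF
    by_cases h : ∀ E ∈ 𝓔, ¬ E ⊆ F.1
    · refine ⟨_, eventually_hits_iff_of_forall_not_hits F.2.1 F.2.2 (hν F hF) (hx₀F F hF)
        fun E hE hEF hEd hH => ?_, fun _ x hx x' hx' => jump_congr (Iff.trans hx (Iff.symm hx'))⟩
      by_cases hEd' : flatDim E + 2 = d
      · exact h E (hmem.2 ⟨hE, hH, hEd'⟩) hEF
      · exact hx₀E E hE (hhit E hE hH) (by omega) hH
    · exact ⟨univ, univ_mem, fun h' => absurd h' h⟩
  have hB : ∀ E ∈ 𝓔, ∃ V ∈ 𝓝 x₀, ∀ x ∈ V, ∀ x' ∈ V, x ∉ affineSpan ℝ (insert o E) →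
      x' ∉ affineSpan ℝ (insert o E) →
      ∑ F ∈ Δ.facetsAt y with E ⊆ F.1, jump o x F.1 (a F) =
        ∑ F ∈ Δ.facetsAt y with E ⊆ F.1, jump o x' F.1 (a F) := by
    intro E hE
    obtain ⟨hEc, hEh, hEd⟩ := hmem.1 hE
    have hyE := hhit E hEc hEh
    obtain ⟨t, ht, hz⟩ := hEh
    refine exists_nhds_sum_jump_eq hEc hEd (hoE E hEc hyE (by omega)) ht (hcar E hE t ht hz) _
      (fun F hF => (Finset.mem_filter.1 hF).2)
      (fun F hF => hν F (mem_facetsAt.1 (Finset.mem_filter.1 hF).1))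
      (fun F hF => hx₀F F (mem_facetsAt.1 (Finset.mem_filter.1 hF).1)) ?_
    have h := hs E hEc hEd (hint.mono hG hEc (carrier_subset hG hEc hy hyE))
    rw [← h, ← finsum_mem_coe_finset]
    refine finsum_congr fun F => ?_
    simp only [Finset.coe_filter, mem_facetsAt, mem_ofPred_eq]
    exact finsum_congr_Prop (propext ⟨fun h => h.2, fun h => ⟨h hyE, h⟩⟩) fun _ => rfl
  choose! VA hVA HA using hA
  choose! VB hVB HB using hB
  refine ⟨(⋂ F ∈ Δ.facetsAt y, VA F) ∩ ⋂ E ∈ 𝓔, VB E,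
    inter_mem ((Filter.biInter_finset_mem _).2 hVA) ((Filter.biInter_finset_mem _).2 hVB), ?_⟩
  rintro x ⟨⟨hxA, hxB⟩, hxg⟩ x' ⟨⟨hxA', hxB'⟩, hxg'⟩
  simp only [mem_iInter] at hxA hxB hxA' hxB'
  set g : Δ.StressCell d → Euc d := fun F => jump o x F.1 (a F) - jump o x' F.1 (a F) with hg
  have h1 : ∀ F ∈ Δ.facetsAt y, g F = ∑ E ∈ 𝓔, if E ⊆ F.1 then g F else 0 := by
    intro F hF
    by_cases h : ∃ E ∈ 𝓔, E ⊆ F.1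
    · obtain ⟨E, hE, hEF⟩ := h
      rw [Finset.sum_eq_single E, if_pos hEF]
      · intro E' hE' hne
        rw [if_neg]
        exact fun hEF' => hne (huniq F (mem_facetsAt.1 hF) E' hE' E hE hEF' hEF)
      · exact fun h => absurd hE h
    · push Not at h
      rw [Finset.sum_eq_zero fun E hE => if_neg (h E hE)]
      exact sub_eq_zero.2 (HA F hF h x (hxA F hF) x' (hxA' F hF))
  unfold totalJump
  rw [← sub_eq_zero, ← Finset.sum_sub_distrib]
  change ∑ F ∈ Δ.facetsAt y, g F = 0
  rw [Finset.sum_congr rfl h1, Finset.sum_comm]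
  refine Finset.sum_eq_zero fun E hE => ?_
  obtain ⟨hEc, hEh, hEd⟩ := hmem.1 hE
  have hyE := hhit E hEc hEh
  rw [← Finset.sum_filter, hg, Finset.sum_sub_distrib, sub_eq_zero]
  exact HB E hE x (hxB E hE) x' (hxB' E hE) (hxg E hEc hyE hEd.le) (hxg' E hEc hyE hEd.le)

/-- The total jump is constant in each top-dimensional cell. -/
lemma totalJump_eq_of_mem (A : Δ.TopCell)
    (hconn : IsPreconnected (Metric.ball y ε ∩ intrinsicInterior ℝ A.1)) {x x' : Euc d}
    (hx : x ∈ (Metric.ball y ε ∩ intrinsicInterior ℝ A.1) ∩ Δ.generic y o)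
    (hx' : x' ∈ (Metric.ball y ε ∩ intrinsicInterior ℝ A.1) ∩ Δ.generic y o) :
    Δ.totalJump y o (fun F => (s F * w F.1) • ν F) x =
      Δ.totalJump y o (fun F => (s F * w F.1) • ν F) x' := by
  set J := Δ.totalJump y o (fun F => (s F * w F.1) • ν F) with hJ
  have hoE' : ∀ E ∈ Δ.cells, y ∈ E → flatDim E < d → o ∉ E := fun E hE hyE hd h =>
    hoE E hE hyE hd (subset_affineSpan ℝ _ h)
  have hrelF : ∀ p ∈ intrinsicInterior ℝ A.1, ∀ F : Δ.StressCell d, p ∉ F.1 := by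
    intro p hp F hpF
    have h1 := carrier_subset A.2.1 F.2.1 hp hpF
    have h2 := dim_le_of_subset h1
    have h3 := A.2.2
    have h4 := F.2.2
    omega
  refine eq_of_locally_eq_on_dense hconn (dense_generic y o) (fun p hp => ?_) hx hx'
  have hopen : IsOpen (Metric.ball y ε ∩ intrinsicInterior ℝ A.1) :=
    Metric.isOpen_ball.inter (isOpen_relint_top A)
  obtain ⟨δ, hδ, hδs⟩ := Metric.isOpen_iff.1 hopen p hp
  refine ⟨Metric.ball p δ, Metric.ball_mem_nhds p hδ, ?_⟩
  -- a generic point in the ball that is also generic with respect to two given generic points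
  rintro a ⟨ha, hag⟩ b ⟨hb, hbg⟩
  have hfin : {E ∈ Δ.cells | y ∈ E ∧ flatDim E + 3 ≤ d}.Finite :=
    (finite_cells_at y).subset fun E hE => ⟨hE.1, hE.2.1⟩
  have hins : ∀ q, ∀ E ∈ {E ∈ Δ.cells | y ∈ E ∧ flatDim E + 3 ≤ d},
      affineSpan ℝ (insert q (insert o E)) ≠ ⊤ := fun q E hE => affineSpan_ne_top (by
    have h1 := flatDim_insert_le (insert o E) q
    have h2 := flatDim_insert_le E o
    have h3 := hE.2.2
    omega)
  have hdense : ∀ q : Euc d, Dense {c : Euc d | ∀ E ∈ {E ∈ Δ.cells | y ∈ E ∧ flatDim E + 3 ≤ d},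
      c ∉ affineSpan ℝ (insert q (insert o E))} := fun q =>
    dense_iff_inter_open.2 fun U hU hne => exists_generic_point hfin
      (fun E => affineSpan ℝ (insert q (insert o E))) (hins q) hU hne
  have hopen' : ∀ q : Euc d, IsOpen {c : Euc d | ∀ E ∈ {E ∈ Δ.cells | y ∈ E ∧ flatDim E + 3 ≤ d},
      c ∉ affineSpan ℝ (insert q (insert o E))} := fun q => by
    have : {c : Euc d | ∀ E ∈ {E ∈ Δ.cells | y ∈ E ∧ flatDim E + 3 ≤ d},
        c ∉ affineSpan ℝ (insert q (insert o E))} =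
        ⋂ E ∈ {E ∈ Δ.cells | y ∈ E ∧ flatDim E + 3 ≤ d},
          ((affineSpan ℝ (insert q (insert o E)) : AffineSubspace ℝ (Euc d)) : Set (Euc d))ᶜ := by
      ext c; simp
    rw [this]
    exact hfin.isOpen_biInter fun E _ =>
      (AffineSubspace.closed_of_finiteDimensional _).isOpen_compl
  -- Instead of joining `a` to `b` directly, both are joined to a point `c` outside the flats
  -- spanned by `a` or `b` together with `o` and a cell of codimension at least three. Seen from
  -- `o`, the two segments then never pass over such a cell.
  obtain ⟨c, hc, hcab, hcg⟩ := dense_iff_inter_open.1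
    (((hdense a).inter_of_isOpen_left (hdense b) (hopen' a)).inter_of_isOpen_left
      (dense_generic (Δ := Δ) y o) ((hopen' a).inter (hopen' b)))
    _ Metric.isOpen_ball ⟨p, Metric.mem_ball_self hδ⟩
  have hseg : ∀ q ∈ Metric.ball p δ ∩ Δ.generic y o, (∀ E ∈ {E ∈ Δ.cells | y ∈ E ∧
      flatDim E + 3 ≤ d}, c ∉ affineSpan ℝ (insert q (insert o E))) → J q = J c := by
    rintro q ⟨hq, hqg⟩ hqc
    have hpre : IsPreconnected ((fun t : ℝ => (AffineMap.lineMap q c t : Euc d)) '' Icc 0 1) :=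
      isPreconnected_Icc.image _ AffineMap.lineMap_continuous.continuousOn
    refine eq_of_locally_eq_on_dense hpre (dense_generic (Δ := Δ) y o) ?_
      ⟨⟨0, by simp, by simp⟩, hqg⟩ ⟨⟨1, by simp, by simp⟩, hcg⟩
    rintro _ ⟨t, ht, rfl⟩
    have hxt := hδs ((convex_ball p δ).lineMap_mem hq hc ht)
    refine exists_nhds_totalJump_eq hs hG hint hy hst ho hoE hν hxt.1 (fun F _ => hrelF _ hxt.2 F)
      fun E hE hyE hEd => ?_
    rintro ⟨τ, -, hτE⟩
    have hτ0 : τ ≠ 0 := by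
      rintro rfl
      rw [AffineMap.lineMap_apply_zero] at hτE
      exact hoE' E hE hyE (by omega) hτE
    have hxE : AffineMap.lineMap q c t ∈ affineSpan ℝ (insert o E) :=
      mem_of_lineMap_mem (subset_affineSpan ℝ _ (mem_insert _ _)) hτ0
        (subset_affineSpan ℝ _ (mem_insert_of_mem _ hτE))
    by_cases ht0 : t = 0
    · subst ht0
      rw [AffineMap.lineMap_apply_zero] at hxE
      exact hqg E hE hyE (by omega) hxE
    · exact hqc E ⟨hE, hyE, hEd⟩ (mem_of_lineMap_mem (subset_affineSpan ℝ _ (mem_insert _ _)) ht0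
        (affineSpan_mono ℝ (subset_insert _ _) hxE))
  exact (hseg a ⟨ha, hag⟩ hcab.1).trans (hseg b ⟨hb, hbg⟩ hcab.2).symm

end

/-- The total jumps on the two sides of a facet differ by the jump of that facet. -/
lemma exists_totalJump_sub {y o : Euc d} {ε : ℝ} (hε : 0 < ε) {F : Δ.StressCell d}
    {A B : Δ.TopCell} (hyF : y ∈ F.1) {u : Euc d} (hu : IsNormalFrom o F.1 u)
    (hFA : F.1 ⊆ A.1) (hFB : F.1 ⊆ B.1) (hAB : A ≠ B) (huB : u = innerNormal F.1 B.1)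
    (a : Δ.StressCell d → Euc d) :
    ∃ p ∈ (Metric.ball y ε ∩ intrinsicInterior ℝ A.1) ∩ Δ.generic y o,
      ∃ q ∈ (Metric.ball y ε ∩ intrinsicInterior ℝ B.1) ∩ Δ.generic y o,
        Δ.totalJump y o a q - Δ.totalJump y o a p = a F := by
  obtain ⟨z, hz, hzy⟩ := exists_relint_ball F.2.1 hyF hε
  have hzF := relint_subset hz
  obtain ⟨ρ₁, hρ₁, H1⟩ := exists_uniform_half F.2.1 F.2.2 hz
  obtain ⟨-, ρ₂, hρ₂, H2⟩ := mem_relint_iff.1 hz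
  obtain ⟨ρ₃, hρ₃, H3⟩ := exists_star_ball (mem_region F.2.1 hzF)
  obtain ⟨ρ₄, hρ₄, H4⟩ := Metric.isOpen_iff.1 Metric.isOpen_ball z hzy
  obtain ⟨ρ, hρ, hρlt⟩ : ∃ ρ > 0, ρ < min (min ρ₁ ρ₂) (min ρ₃ ρ₄) := exists_between (by positivity)
  simp only [lt_min_iff] at hρlt
  obtain ⟨⟨hρ1, hρ2⟩, hρ3, hρ4⟩ := hρlt
  set c := ⟪u, z - o⟫ with hc
  have hcpos : 0 < c := hu.pos z hzF
  -- The point at height `(1 + η) * c` on the ray from `o` through a given point. Small `η` of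
  -- either sign yields points of one ray just beyond and just before `F`.
  let g : Euc d × ℝ → Euc d := fun v => AffineMap.lineMap o v.1 ((1 + v.2) * c / ⟪u, v.1 - o⟫)
  have hg : ContinuousAt g (z, 0) := by
    simp only [g, AffineMap.lineMap_apply, vsub_eq_sub, vadd_eq_add]
    have h1 : ContinuousAt (fun v : Euc d × ℝ => (1 + v.2) * c) (z, 0) := by fun_prop
    have h2 : ContinuousAt (fun v : Euc d × ℝ => ⟪u, v.1 - o⟫) (z, 0) := by fun_prop
    have h3 : ContinuousAt (fun v : Euc d × ℝ => v.1 - o) (z, 0) := by fun_prop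
    exact ((h1.div h2 hcpos.ne').smul h3).add continuousAt_const
  have hgz : g (z, 0) = z := by
    simp only [g, add_zero, one_mul]
    rw [← hc, div_self hcpos.ne', AffineMap.lineMap_apply_one]
  have hev := hg.eventually (Metric.ball_mem_nhds _ hρ)
  rw [hgz, nhds_prod_eq, Filter.eventually_prod_iff] at hev
  obtain ⟨P, hP, Q, hQ, hPQ⟩ := hev
  obtain ⟨δ, hδ, hδQ⟩ := Metric.eventually_nhds_iff.1 hQ
  obtain ⟨x, ⟨hxP, hxb⟩, hxg⟩ := mem_closure_iff_nhds.1 (dense_generic (Δ := Δ) y o z) _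
    (hP.and ((show ContinuousAt (fun x : Euc d => ⟪u, x - o⟫) z by fun_prop).eventually_const_lt
      hcpos))
  set b := ⟪u, x - o⟫ with hb
  have hgη : ∀ η : ℝ, |η| < δ → AffineMap.lineMap o x ((1 + η) * c / b) ∈ Metric.ball z ρ :=
    fun η hη => hPQ hxP (hδQ (by simpa using hη))
  have hval : ∀ η : ℝ, ⟪u, AffineMap.lineMap o x ((1 + η) * c / b) - z⟫ = η * c := fun η => by
    rw [← sub_sub_sub_cancel_right _ z o, inner_sub_right, inner_lineMap_sub, ← hb, ← hc,
      div_mul_cancel₀ _ (ne_of_gt hxb)]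
    ring
  obtain ⟨η, hη, hηlt⟩ : ∃ η > 0, η < min δ 1 := exists_between (by positivity)
  rw [lt_min_iff] at hηlt
  have hdim : ∀ C : Δ.TopCell, flatDim F.1 + 1 = flatDim C.1 := fun C => by rw [F.2.2, C.2.2]
  have hside : ∀ C : Δ.TopCell, F.1 ⊆ C.1 → ∀ p ∈ Metric.ball z ρ,
      0 < ⟪innerNormal F.1 C.1, p - z⟫ →
      p ∈ Metric.ball y ε ∩ intrinsicInterior ℝ C.1 := by
    intro C hFC p hp hpos
    refine ⟨H4 (Metric.ball_subset_ball hρ4.le hp), ?_⟩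
    rw [interior_eq_relint (vectorSpan_eq_top_iff_flatDim.2 C.2.2), mem_interior]
    refine ⟨Metric.ball z ρ ∩ {p | 0 < ⟪innerNormal F.1 C.1, p - z⟫}, ?_,
      Metric.isOpen_ball.inter (isOpen_lt continuous_const (by fun_prop)), hp, hpos⟩
    rintro p ⟨hp, hpos⟩
    have := (H1 C.1 C.2.1 C.2.2 hFC (p - z) (by
      rw [← dist_eq_norm]; exact lt_trans hp hρ1)).2 (le_of_lt hpos)
    rwa [add_sub_cancel] at this
  have hneg : innerNormal F.1 A.1 = -u := by
    rw [huB]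
    exact innerNormal_top_neg F.2.1 F.2.2 B.2.1 A.2.1 B.2.2 A.2.2 hFB hFA
      fun h => hAB (Subtype.ext h).symm
  have hcb : 0 < c / b := div_pos hcpos hxb
  have hpos1 : 0 < (1 + η) * c / b := by rw [mul_div_assoc]; exact mul_pos (by linarith) hcb
  have hpos2 : 0 < (1 + -η) * c / b := by rw [mul_div_assoc]; exact mul_pos (by linarith) hcb
  refine ⟨_, ⟨hside A hFA _ (hgη (-η) (by rw [abs_neg, abs_of_pos hη]; exact hηlt.1)) ?_,
    generic_of_lineMap hxg hpos2.ne'⟩, _, ⟨hside B hFB _ (hgη η (by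
      rw [abs_of_pos hη]; exact hηlt.1)) ?_, generic_of_lineMap hxg hpos1.ne'⟩, ?_⟩
  · rw [hneg, inner_neg_left, hval]; nlinarith
  · rw [← huB, hval]; exact mul_pos hη hcpos
  unfold totalJump
  -- Between the two points of the ray only `F` is crossed: any other facet met there would contain
  -- `z`, hence `F`, and so equal `F` by dimension.
  rw [← Finset.sum_sub_distrib, Finset.sum_eq_single F]
  · unfold jump
    rw [if_pos, if_neg, sub_zero]
    · rw [hits_lineMap hpos2]
      rintro ⟨t, ht, htF⟩
      have h1 := hu.inner_eq htF hzF
      rw [inner_lineMap_sub, ← hb, ← hc] at h1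
      have h2 := mul_le_mul_of_nonneg_right ht.2 hxb.le
      rw [div_mul_cancel₀ _ (ne_of_gt hxb), h1] at h2
      nlinarith
    · rw [hits_lineMap hpos1]
      refine ⟨(1 + 0) * c / b, ⟨by rw [mul_div_assoc]; linarith, ?_⟩, ?_⟩
      · rw [mul_div_assoc, mul_div_assoc]; nlinarith
      · have := H2 _ (mem_of_perp_of_inner_eq_zero F.2.2 hu.norm_eq hu.perp
          ((hval 0).trans (zero_mul c))) (by
            rw [← dist_eq_norm]
            exact lt_trans (hgη 0 (by simpa using hδ)) hρ2)
        rwa [add_sub_cancel] at this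
  · intro F' hF' hne
    rw [sub_eq_zero]
    refine jump_congr ?_
    rw [hits_lineMap hpos1, hits_lineMap hpos2]
    constructor
    · rintro ⟨t, ht, htF⟩
      refine ⟨t, ⟨ht.1, ?_⟩, htF⟩
      by_contra! hlt
      have e : t = (1 + (t * b / c - 1)) * c / b := by
        have := ne_of_gt hxb
        field_simp
        ring
      have ht2 := ht.2
      rw [le_div_iff₀ hxb] at ht2
      rw [div_lt_iff₀ hxb] at hlt
      have habs : |t * b / c - 1| < δ := by
        rw [abs_lt, lt_sub_iff_add_lt, sub_lt_iff_lt_add, lt_div_iff₀ hcpos, div_lt_iff₀ hcpos]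
        constructor <;> nlinarith [hηlt.1]
      have hzF' := H3 F'.1 F'.2.1 _ htF (by
        rw [e]
        exact lt_trans (hgη _ habs) hρ3)
      have hFF := carrier_subset F.2.1 F'.2.1 hz hzF'
      have := eq_of_subset_of_dim_le F'.2.1 F.2.1 hFF (by
        have h1 := F.2.2
        have h2 := F'.2.2
        omega)
      exact hne (Subtype.ext this.symm)
    · rintro ⟨t, ht, htF⟩
      refine ⟨t, ⟨ht.1, ht.2.trans ?_⟩, htF⟩
      rw [mul_div_assoc, mul_div_assoc]; nlinarith
  · exact fun h => absurd (mem_facetsAt.2 hyF) h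

/-- Every internal cell has a reciprocal of its star with edges given by a stress. -/
theorem exists_isReciprocal {w : Set (Euc d) → ℝ} {s : Δ.StressCell d → ℝ} {G : Set (Euc d)}
    (hs : Δ.IsStress w d s) (hG : G ∈ Δ.cells) (hint : Δ.IsInternal G) :
    ∃ r, Δ.IsReciprocal w s G r := by
  classical
  obtain ⟨y, hy⟩ := nonempty_relint hG
  obtain ⟨ε₀, hε₀, hst₀, -⟩ := exists_internal_star_ball hG hint hy
  -- A radius for which the part of each open cell at `y` in the ball is connected. This makes the
  -- total jump well defined on each `d`-cell.
  have hev : ∀ᶠ ε in 𝓝[>] (0 : ℝ), ∀ A ∈ {A ∈ Δ.cells | y ∈ A},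
      IsConnected (Metric.ball y ε ∩ intrinsicInterior ℝ A) :=
    (finite_cells_at y).eventually_all.2 fun A hA =>
      (Δ.isFlatCell A hA.1).locallyConnected y hA.2
  obtain ⟨ε, hconn, hε, hεε₀⟩ := (hev.and (Ioo_mem_nhdsGT hε₀)).exists
  have hst : ∀ C ∈ Δ.cells, ∀ z ∈ C, dist z y < ε → y ∈ C := fun C hC z hz hd =>
    hst₀ C hC z hz (hd.trans hεε₀)
  obtain ⟨o, ho, hoE'⟩ := exists_generic_point (s := {E ∈ Δ.cells | y ∈ E ∧ flatDim E < d})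
    ((finite_cells_at y).subset fun E hE => ⟨hE.1, hE.2.1⟩) (fun E => affineSpan ℝ E)
    (fun E hE => affineSpan_ne_top hE.2.2) (Metric.isOpen_ball (x := y) (ε := ε))
    ⟨y, Metric.mem_ball_self hε⟩
  have hoE : ∀ E ∈ Δ.cells, y ∈ E → flatDim E < d → o ∉ affineSpan ℝ E := fun E hE hyE hd =>
    hoE' E ⟨hE, hyE, hd⟩
  have hν' : ∀ F : Δ.StressCell d, ∃ u, y ∈ F.1 → IsNormalFrom o F.1 u := by
    intro F
    by_cases hyF : y ∈ F.1
    · obtain ⟨u, hu⟩ := exists_isNormalFrom F.2.2 hyF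
        (hoE F.1 F.2.1 hyF (by have := F.2.2; omega))
      exact ⟨u, fun _ => hu⟩
    · exact ⟨0, fun h => absurd h hyF⟩
  choose ν hν using hν'
  set a : Δ.StressCell d → Euc d := fun F => (s F * w F.1) • ν F with ha
  have hex : ∀ A : Δ.TopCell, ∃ x, y ∈ A.1 →
      x ∈ (Metric.ball y ε ∩ intrinsicInterior ℝ A.1) ∩ Δ.generic y o := by
    intro A
    by_cases hyA : y ∈ A.1
    · obtain ⟨x, hx⟩ := (dense_generic (Δ := Δ) y o).inter_open_nonempty _
        (Metric.isOpen_ball.inter (isOpen_relint_top A)) (hconn A.1 ⟨A.2.1, hyA⟩).nonempty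
      exact ⟨x, fun _ => hx⟩
    · exact ⟨0, fun h => absurd h hyA⟩
  choose x hx using hex
  have hr : ∀ A : Δ.TopCell, y ∈ A.1 →
      ∀ p ∈ (Metric.ball y ε ∩ intrinsicInterior ℝ A.1) ∩ Δ.generic y o,
        Δ.totalJump y o a (x A) = Δ.totalJump y o a p := fun A hyA p hp =>
    totalJump_eq_of_mem hs hG hint hy hst ho hoE hν A (hconn A.1 ⟨A.2.1, hyA⟩).isPreconnected
      (hx A hyA) hp
  have key : ∀ (F : Δ.StressCell d) (A B : Δ.TopCell), G ⊆ F.1 → F.1 ⊆ A.1 → F.1 ⊆ B.1 → A ≠ B →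
      ν F = innerNormal F.1 B.1 →
      Δ.totalJump y o a (x B) - Δ.totalJump y o a (x A) = a F := by
    intro F A B hGF hFA hFB hAB hFν
    have hyF := hGF (relint_subset hy)
    obtain ⟨p, hp, q, hq, h⟩ := exists_totalJump_sub hε hyF (hν F hyF) hFA hFB hAB hFν a
    rw [hr A (hFA hyF) p hp, hr B (hFB hyF) q hq, h]
  refine ⟨fun A => Δ.totalJump y o a (x A), fun F A B hGF hFA hFB hAB => ?_⟩
  have hyF := hGF (relint_subset hy)
  have hAF : flatDim F.1 + 1 = flatDim A.1 := by rw [F.2.2, A.2.2]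
  obtain ⟨hn, hn1, hnp, -⟩ := innerNormal_spec F.2.1 A.2.1 hFA hAF
  have hneg := innerNormal_top_neg F.2.1 F.2.2 A.2.1 B.2.1 A.2.2 B.2.2 hFA hFB
    fun h => hAB (Subtype.ext h)
  have huniv : ∀ v, v ∈ vectorSpan ℝ A.1 := fun v => by
    rw [vectorSpan_eq_top_iff_flatDim.2 A.2.2]; trivial
  -- The normal pointing away from `o` may point into `A` or into `B`; in the first case the roles
  -- are exchanged and both signs change.
  rcases unit_normal_eq_or_neg hFA hAF hn1 hn hnp (hν F hyF).norm_eq (huniv _)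
    (hν F hyF).perp with h | h
  · have := key F B A hGF hFB hFA hAB.symm h
    change Δ.totalJump y o a (x B) - Δ.totalJump y o a (x A) = _
    rw [← neg_sub, this, hneg, ← h, smul_neg]
  · rw [← hneg] at h
    rw [← h]
    exact key F A B hGF hFA hFB hAB h

end CellDecomposition

/-! ### Volumes of the faces of the dual polytopes -/

lemma maxFace_smul {d : ℕ} (S : Set (Euc d)) {t : ℝ} (ht : 0 < t) (v : Euc d) :
    maxFace S (t • v) = maxFace S v := by
  unfold maxFace
  simp only [inner_smul_right, mul_le_mul_iff_right₀ ht]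

namespace CellDecomposition

variable {d : ℕ} {Δ : CellDecomposition d}

lemma IsWeight.pos {w : Set (Euc d) → ℝ} (hw : Δ.IsWeight w) {C : Set (Euc d)}
    (hC : C ∈ Δ.cells) : 0 < w C := by
  rcases hw with h | ⟨h, h'⟩
  · rw [h]; exact one_pos
  · rw [h']; exact flatVol_pos (h C hC) (nonempty_relint hC)

lemma finite_topCells (y : Euc d) : {A : Δ.TopCell | y ∈ A.1}.Finite :=
  Finite.of_finite_image ((finite_cells_at y).subset (by
    rintro _ ⟨A, hA, rfl⟩
    exact ⟨A.2.1, hA⟩)) Subtype.val_injective.injOn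

lemma finite_image_topCells (r : Δ.TopCell → Euc d) {C : Set (Euc d)} (hC : C ∈ Δ.cells) :
    (r '' {A | C ⊆ A.1}).Finite := by
  obtain ⟨y, hy⟩ := nonempty_cell hC
  exact ((finite_topCells y).subset fun A (hA : C ⊆ A.1) => hA hy).image r

section Faces

variable {C : Set (Euc d)} (hC : C ∈ Δ.cells) (hint : Δ.IsInternal C)
  {w : Set (Euc d) → ℝ} {s : Δ.StressCell d → ℝ} {r : Δ.TopCell → Euc d}
  (hr : Δ.IsReciprocal w s C r) (hs : ∀ F : Δ.StressCell d, 0 ≤ s F * w F.1)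
include hC hint hr hs

/-- The face of the dual polytope in a given direction. -/
lemma exists_maxFace_eq (v : Euc d) : ∃ K ∈ Δ.cells, C ⊆ K ∧
    maxFace (r '' {A | C ⊆ A.1}) v = dualFace r K ∧ v ∈ vectorSpan ℝ K ∧
      (flatDim C + 1 = flatDim K → 0 ≤ ⟪innerNormal C K, v⟫) := by
  obtain ⟨y, hy⟩ := nonempty_relint hC
  obtain ⟨ε, hε, hst, hreg⟩ := exists_internal_star_ball hC hint hy
  have hc : Tendsto (fun t : ℝ => t • v) (𝓝[>] 0) (𝓝 ((0 : ℝ) • v)) :=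
    (continuous_id.smul continuous_const).tendsto 0 |>.mono_left nhdsWithin_le_nhds
  rw [zero_smul] at hc
  have hlin : ∀ K, C ⊆ K → ∀ t : ℝ, 0 < t → y + t • v ∈ K → v ∈ vectorSpan ℝ K := by
    intro K hCK t ht hK
    have := sub_mem_lin hK (hCK (relint_subset hy))
    rw [add_sub_cancel_left] at this
    exact (Submodule.smul_mem_iff _ ht.ne').1 this
  have hside : ∀ᶠ t : ℝ in 𝓝[>] 0, ∀ K ∈ {K ∈ Δ.cells | y ∈ K}, y + t • v ∈ K → C ⊆ K →
      flatDim C + 1 = flatDim K → 0 ≤ ⟪innerNormal C K, v⟫ := by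
    refine (finite_cells_at y).eventually_all.2 fun K hK => ?_
    by_cases h : C ⊆ K ∧ flatDim C + 1 = flatDim K
    · obtain ⟨-, -, -, H⟩ := innerNormal_spec hC hK.1 h.1 h.2
      obtain ⟨δ, hδ, H⟩ := H y hy
      filter_upwards [hc.eventually (Metric.ball_mem_nhds 0 hδ), self_mem_nhdsWithin]
        with t ht ht0 hyt _ _
      have h1 := (H (t • v) (Submodule.smul_mem _ _ (hlin K h.1 t ht0 hyt)) (by simpa using ht)).1 hyt
      rw [inner_smul_right] at h1
      exact nonneg_of_mul_nonneg_right h1 ht0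
    · exact Eventually.of_forall fun t _ h1 h2 => absurd ⟨h1, h2⟩ h
  obtain ⟨t, ⟨ht1, ht2⟩, ht0⟩ := ((hc.eventually (Metric.ball_mem_nhds 0 hε)).and hside |>.and
    self_mem_nhdsWithin).exists
  have hball : y + t • v ∈ Metric.ball y ε := by simpa using ht1
  obtain ⟨A, hA, hxA⟩ := hreg hball
  obtain ⟨K, hK, -, hxK⟩ := exists_carrier hA hxA
  have hyK := hst K hK _ (relint_subset hxK) hball
  have hCK := carrier_subset hC hK hy hyK
  refine ⟨K, hK, hCK, ?_, hlin K hCK t ht0 (relint_subset hxK),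
    ht2 K ⟨hK, hyK⟩ (relint_subset hxK) hCK⟩
  rw [← face_eq_dualFace hC hy hst hreg hr (fun F _ => hs F) hball hK hxK, add_sub_cancel_left,
    ← maxFace_smul _ ht0]
  rfl

/-- A small step from `C` along the inner normal leads into the relative interior of `C'`, and the
face in this direction is dual to the carrier reached. -/
lemma maxFace_innerNormal {C' : Set (Euc d)} (hC' : C' ∈ Δ.cells) (hCC : C ⊆ C')
    (hdim : flatDim C + 1 = flatDim C') :
    maxFace (r '' {A | C ⊆ A.1}) (innerNormal C C') = dualFace r C' := by
  obtain ⟨y, hy⟩ := nonempty_relint hC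
  obtain ⟨ε, hε, hst, hreg⟩ := exists_internal_star_ball hC hint hy
  obtain ⟨hn, hn1, -, -⟩ := innerNormal_spec hC hC' hCC hdim
  obtain ⟨δ, hδ, H⟩ := half_relint hC hC' hCC hdim hy
  obtain ⟨t, ht0, ht⟩ : ∃ t > 0, t < min ε δ := exists_between (by positivity)
  rw [lt_min_iff] at ht
  have hnorm : ‖t • innerNormal C C'‖ = t := by
    rw [norm_smul, hn1, mul_one, Real.norm_of_nonneg ht0.le]
  rw [← face_eq_dualFace hC hy hst hreg hr (fun F _ => hs F) (x := y + t • innerNormal C C')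
    (by simpa [hnorm] using ht.1) hC' (H _ (Submodule.smul_mem _ _ hn) (by rw [hnorm]; exact ht.2)
      (by rw [inner_smul_right, real_inner_self_eq_norm_sq, hn1]; linarith)),
    add_sub_cancel_left, ← maxFace_smul _ ht0]
  rfl

/-- The facets of a dual polytope and its volume. -/
lemma dualFace_facets {n : ℕ} (hd : flatDim C + (n + 1) = d)
    [Fintype {C' : Δ.StressCell (flatDim C + 2) // C ⊆ C'.1}] (A₀ : Δ.TopCell) (hA₀ : C ⊆ A₀.1)
    (T : {C' : Δ.StressCell (flatDim C + 2) // C ⊆ C'.1} → Δ.TopCell)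
    (hT : ∀ C', C'.1.1 ⊆ (T C').1) :
    ∑ C' : {C' : Δ.StressCell (flatDim C + 2) // C ⊆ C'.1},
      flatVol n (dualFace r C'.1.1) • innerNormal C C'.1.1 = 0 ∧
    (n + 1) * flatVol (n + 1) (dualFace r C) =
      ∑ C' : {C' : Δ.StressCell (flatDim C + 2) // C ⊆ C'.1},
        ⟪r (T C') - r A₀, innerNormal C C'.1.1⟫ * flatVol n (dualFace r C'.1.1) := by
  have hdim : ∀ C' : {C' : Δ.StressCell (flatDim C + 2) // C ⊆ C'.1},
      flatDim C + 1 = flatDim C'.1.1 := fun C' => by have := C'.1.2.2; omega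
  have hspec := fun C' : {C' : Δ.StressCell (flatDim C + 2) // C ⊆ C'.1} =>
    innerNormal_spec hC C'.1.2.1 C'.2 (hdim C')
  have hface := fun C' : {C' : Δ.StressCell (flatDim C + 2) // C ⊆ C'.1} =>
    maxFace_innerNormal hC hint hr hs C'.1.2.1 C'.2 (hdim C')
  have hWrank : Module.finrank ℝ (vectorSpan ℝ C)ᗮ = n + 1 := by
    have := (vectorSpan ℝ C).finrank_add_finrank_orthogonal
    rw [finrank_euclideanSpace_fin] at this
    unfold flatDim at hd
    omega
  have := polytope_facets_of_flat (S := r '' {A | C ⊆ A.1}) (x := r A₀) hWrank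
    (finite_image_topCells r hC)
    ⟨A₀, hA₀, rfl⟩ (by
      rintro _ ⟨A, hA, rfl⟩
      rw [Submodule.mem_orthogonal]
      intro a ha
      have := mem_dualPerp.1 (lin_le_dualPerp hC hint hr (fun F _ => hs F) hC Subset.rfl ha) A A₀
        hA hA₀
      rwa [real_inner_comm])
    (u := fun C' : {C' : Δ.StressCell (flatDim C + 2) // C ⊆ C'.1} => innerNormal C C'.1.1)
    (fun C' => (Submodule.mem_orthogonal _ _).2 (hspec C').2.2.1) (fun C' => (hspec C').2.1)
    (fun C₁ C₂ h => Subtype.ext (Subtype.ext (eq_of_innerNormal_eq hC C₁.1.2.1 C₂.1.2.1 C₁.2 C₂.2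
      (hdim C₁) (hdim C₂) h))) (fun v hvW hv hn => by
      -- The face in direction `v` is dual to a cell `K` properly containing `C`. A face of
      -- dimension at least `n` leaves only `flatDim C + 1` for the dimension of `K`, and then `v`
      -- is a unit normal of `C` in `K`, with the sign decided by `hside`.
      obtain ⟨K, hK, hCK, hmax, hvK, hside⟩ := exists_maxFace_eq hC hint hr hs v
      have hperp := (Submodule.mem_orthogonal _ _).1 hvW
      have hCK' : C ≠ K := by
        rintro rfl
        have := hperp v hvK
        rw [real_inner_self_eq_norm_sq, hv] at this
        norm_num at this
      have h1 := dim_lt_of_ssubset hK hC (hCK.ssubset_of_ne hCK')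
      have h2 : flatDim K ≤ _ := Submodule.finrank_mono
        (lin_le_dualPerp hC hint hr (fun F _ => hs F) hK hCK)
      have h3 := finrank_dualPerp r K
      rw [hmax] at hn
      have hKd : flatDim C + 1 = flatDim K := by omega
      refine ⟨⟨⟨K, hK, by omega⟩, hCK⟩, ?_⟩
      obtain ⟨hm, hm1, hmp, -⟩ := innerNormal_spec hC hK hCK hKd
      rcases unit_normal_eq_or_neg hCK hKd hm1 hm hmp hv hvK hperp with h | h
      · exact h.symm
      · have := hside hKd
        rw [h, inner_neg_right, real_inner_self_eq_norm_sq, hm1] at this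
        norm_num at this)
    (p := fun C' => r (T C')) (fun C' => by
      rw [hface]
      exact subset_convexHull ℝ _ ⟨T C', hT C', rfl⟩)
  simp only [hface] at this
  exact this

end Faces

lemma flatVol_dualFace_top (A : Δ.TopCell) (r : Δ.TopCell → Euc d) :
    flatVol 0 (dualFace r A.1) = 1 := by
  have h : {B : Δ.TopCell | A.1 ⊆ B.1} = {A} := by
    ext B
    refine ⟨fun h => Subtype.ext (eq_of_subset_of_dim_le B.2.1 A.2.1 h ?_).symm, ?_⟩
    · rw [A.2.2, B.2.2]
    · rintro rfl; exact Subset.rfl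
  unfold dualFace flatVol
  rw [h, image_singleton, convexHull_singleton, Measure.real,
    Measure.euclideanHausdorffMeasure_zero]
  simp

/-- The volumes of the faces of the dual polytopes are polynomials in the coefficients of the
tension. -/
lemma exists_poly_flatVol (w : Set (Euc d) → ℝ) (m : ℕ) :
    ∀ C ∈ Δ.cells, Δ.IsInternal C → flatDim C + m = d →
      ∃ q : MvPolynomial (Δ.StressCell d) ℝ, q.IsHomogeneous m ∧
        ∀ s : Δ.StressCell d → ℝ, (∀ F, 0 ≤ s F * w F.1) → ∀ r, Δ.IsReciprocal w s C r →
          flatVol m (dualFace r C) = MvPolynomial.eval s q := by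
  induction m with
  | zero =>
    intro C hC _ hd
    refine ⟨1, MvPolynomial.isHomogeneous_one _ _, fun s _ r _ => ?_⟩
    rw [map_one]
    exact flatVol_dualFace_top ⟨C, hC, hd⟩ r
  | succ n ih =>
    intro C hC hint hd
    obtain ⟨y, hy⟩ := nonempty_cell hC
    have : Finite {C' : Δ.StressCell (flatDim C + 2) // C ⊆ C'.1} :=
      ((finite_stressCells (flatDim C + 2) y).subset fun C' (h : C ⊆ C'.1) => h hy).to_subtype
    let _ := Fintype.ofFinite {C' : Δ.StressCell (flatDim C + 2) // C ⊆ C'.1}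
    obtain ⟨A, hA, hAd, hCA⟩ := Δ.pure C hC
    have hT : ∀ C' : {C' : Δ.StressCell (flatDim C + 2) // C ⊆ C'.1},
        ∃ T : Δ.TopCell, C'.1.1 ⊆ T.1 := fun C' => by
      obtain ⟨B, hB, hBd, hCB⟩ := Δ.pure C'.1.1 C'.1.2.1
      exact ⟨⟨B, hB, hBd⟩, hCB⟩
    choose T hT using hT
    choose L hL hLe using fun C' : {C' : Δ.StressCell (flatDim C + 2) // C ⊆ C'.1} =>
      exists_poly_diff hC hint w ⟨A, hA, hAd⟩ (T C') hCA (C'.2.trans (hT C'))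
    choose q hq hqe using fun C' : {C' : Δ.StressCell (flatDim C + 2) // C ⊆ C'.1} =>
      ih C'.1.1 C'.1.2.1 (hint.mono hC C'.1.2.1 C'.2) (by have := C'.1.2.2; omega)
    -- The pyramid formula with apex `r A`: the support number of each facet, a linear form in `s`,
    -- times the facet volume, of degree `n` by induction.
    refine ⟨MvPolynomial.C ((n + 1 : ℝ)⁻¹) * ∑ C' : {C' : Δ.StressCell (flatDim C + 2) // C ⊆ C'.1},
      (∑ i, MvPolynomial.C (innerNormal C C'.1.1 i) * L C' i) * q C', ?_, fun s hs r hr => ?_⟩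
    · refine MvPolynomial.IsHomogeneous.C_mul (MvPolynomial.IsHomogeneous.sum _ _ _ fun C' _ => ?_) _
      rw [add_comm n 1]
      exact (MvPolynomial.IsHomogeneous.sum _ _ _ fun i _ => (hL C' i).C_mul _).mul (hq C')
    · have h := (dualFace_facets hC hint hr hs hd ⟨A, hA, hAd⟩ hCA T hT).2
      rw [map_mul, MvPolynomial.eval_C, eq_inv_mul_iff_mul_eq₀ (by positivity), h, map_sum]
      refine Finset.sum_congr rfl fun C' _ => ?_
      rw [map_mul, hqe C' s hs r (isReciprocal_mono hr C'.2), map_sum, PiLp.inner_apply]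
      congr 1
      refine Finset.sum_congr rfl fun i _ => ?_
      rw [map_mul, MvPolynomial.eval_C, ← hLe C' s r hr i]
      simp

end CellDecomposition

/-! ### The polynomial map between the cones of tensions -/

theorem proposition5p2 {d : ℕ} (Δ : CellDecomposition d) (w : Set (Euc d) → ℝ)
    (hw : Δ.IsWeight w) (k : ℕ) (hk : 1 ≤ k) (hkd : k < d) :
    ∃ p : Δ.StressCell k → MvPolynomial (Δ.StressCell d) ℝ,
      (∀ C, (p C).IsHomogeneous (d - k + 1)) ∧
      Set.MapsTo (CellDecomposition.polyMap p) (Δ.tensionCone w d) (Δ.tensionCone w k) ∧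
      (∀ s ∈ Δ.tensionCone w d, (∀ F, s F ≠ 0) → ∀ C, CellDecomposition.polyMap p s C ≠ 0) ∧
      (∀ s ∈ Δ.tensionCone w d, ∀ G ∈ Δ.cells, Δ.IsInternal G →
        (∃ r, Δ.IsReciprocal w s G r) ∧
        ∀ r, Δ.IsReciprocal w s G r →
          ((∀ F : Δ.StressCell d, G ⊆ F.1 → s F ≠ 0) → Δ.IsDualPolytope G r) ∧
          (∀ C : Δ.StressCell k, G ⊆ C.1 →
            CellDecomposition.polyMap p s C * w C.1 =
              flatVol (d - k + 1) (CellDecomposition.dualFace r C.1))) := by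
  have hwpos : ∀ {k : ℕ} (C : Δ.StressCell k), 0 < w C.1 := fun C => hw.pos C.2.1
  have hp : ∀ C : Δ.StressCell k, ∃ q : MvPolynomial (Δ.StressCell d) ℝ,
      q.IsHomogeneous (d - k + 1) ∧
      (∀ s : Δ.StressCell d → ℝ, (∀ F, 0 ≤ s F * w F.1) → Δ.IsInternal C.1 →
        ∀ r, Δ.IsReciprocal w s C.1 r →
          MvPolynomial.eval s q * w C.1 = flatVol (d - k + 1) (CellDecomposition.dualFace r C.1)) ∧
      (¬ Δ.IsInternal C.1 → ∃ F, q = MvPolynomial.X F ^ (d - k + 1)) := by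
    intro C
    have hCk := C.2.2
    by_cases hint : Δ.IsInternal C.1
    · obtain ⟨q, hq, hqe⟩ := CellDecomposition.exists_poly_flatVol w (d - k + 1) C.1 C.2.1 hint
        (by omega)
      refine ⟨MvPolynomial.C (w C.1)⁻¹ * q, hq.C_mul _, fun s hs _ r hr => ?_,
        fun h => absurd hint h⟩
      rw [map_mul, MvPolynomial.eval_C, hqe s hs r hr, mul_comm, ← mul_assoc,
        mul_inv_cancel₀ (hwpos C).ne', one_mul]
    -- Cells that are not internal contain no internal cell, so their coefficients are subject to no
    -- equilibrium condition; a power of one variable keeps them non-negative, and nonzero when `s`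
    -- is.
    · obtain ⟨A, hA, hAd, hCA⟩ := Δ.pure C.1 C.2.1
      obtain ⟨K, hK, -, -, hKd⟩ := CellDecomposition.exists_facet_above C.2.1 hA
        (hCA.ssubset_of_ne (by rintro h; rw [h] at hCk; omega))
      exact ⟨MvPolynomial.X ⟨K, hK, by omega⟩ ^ (d - k + 1),
        MvPolynomial.isHomogeneous_X_pow _ _, fun _ _ h => absurd h hint, fun _ => ⟨_, rfl⟩⟩
  choose p hphom hpint hpbd using hp
  have hs0 : ∀ s ∈ Δ.tensionCone w d, ∀ F : Δ.StressCell d, 0 ≤ s F * w F.1 := fun s hs F =>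
    mul_nonneg (hs.2 F) (hwpos F).le
  have hpos : ∀ s ∈ Δ.tensionCone w d, ∀ F : Δ.StressCell d, s F ≠ 0 → 0 < s F * w F.1 :=
    fun s hs F h => mul_pos (lt_of_le_of_ne (hs.2 F) h.symm) (hwpos F)
  have hnn : ∀ (m : ℕ) (S : Set (Euc d)), 0 ≤ flatVol m S := fun m S => measureReal_nonneg
  refine ⟨p, hphom, fun s hs => ⟨?_, fun C => ?_⟩, fun s hs hs' C => ?_,
    fun s hs G hG hint => ⟨CellDecomposition.exists_isReciprocal hs.1 hG hint,
      fun r hr => ⟨fun h => ?_, fun C hGC => ?_⟩⟩⟩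
  · intro F hF hFk hFint
    subst hFk
    obtain ⟨y, hy⟩ := CellDecomposition.nonempty_cell hF
    have : Finite {C' : Δ.StressCell (flatDim F + 2) // F ⊆ C'.1} :=
      ((CellDecomposition.finite_stressCells (flatDim F + 2) y).subset
        fun C' (h : F ⊆ C'.1) => h hy).to_subtype
    let _ := Fintype.ofFinite {C' : Δ.StressCell (flatDim F + 2) // F ⊆ C'.1}
    obtain ⟨r, hr⟩ := CellDecomposition.exists_isReciprocal hs.1 hF hFint
    obtain ⟨A, hA, hAd, hFA⟩ := Δ.pure F hF
    choose T hT using fun C' : {C' : Δ.StressCell (flatDim F + 2) // F ⊆ C'.1} =>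
      Δ.pure C'.1.1 C'.1.2.1
    -- Equilibrium at `F` is Minkowski's relation for the polytope dual to `F`: its facets are dual
    -- to the `(k-1)`-cells containing `F`, and their volumes are the weighted coefficients.
    have h := (CellDecomposition.dualFace_facets (n := d - (flatDim F + 2) + 1) hF hFint hr
      (hs0 s hs) (by omega) ⟨A, hA, hAd⟩ hFA (fun C' => ⟨T C', (hT C').1, (hT C').2.1⟩)
      fun C' => (hT C').2.2).1
    rw [← h, ← finsum_eq_sum_of_fintype]
    refine (finsum_set_coe_eq_finsum_mem {C' : Δ.StressCell (flatDim F + 2) | F ⊆ C'.1}).symm.trans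
      (finsum_congr fun C' => ?_)
    rw [← hpint C'.1 s (hs0 s hs) (hFint.mono hF C'.1.2.1 C'.2) r
      (CellDecomposition.isReciprocal_mono hr C'.2)]
    rfl
  · by_cases hint : Δ.IsInternal C.1
    · obtain ⟨r, hr⟩ := CellDecomposition.exists_isReciprocal hs.1 C.2.1 hint
      refine nonneg_of_mul_nonneg_left ?_ (hwpos C)
      exact (hnn _ _).trans_eq (hpint C s (hs0 s hs) hint r hr).symm
    · obtain ⟨F, hF⟩ := hpbd C hint
      unfold CellDecomposition.polyMap
      rw [hF, map_pow, MvPolynomial.eval_X]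
      exact pow_nonneg (hs.2 F) _
  · by_cases hint : Δ.IsInternal C.1
    · obtain ⟨r, hr⟩ := CellDecomposition.exists_isReciprocal hs.1 C.2.1 hint
      -- Positivity makes the dual face of `C` have its full dimension `d - k + 1`, hence a positive
      -- volume in that dimension.
      have hdual := CellDecomposition.isDualPolytope_of_pos C.2.1 hr
        (fun F _ => hpos s hs F (hs' F)) hint
      have hdim := hdual.dim_add C.1 C.2.1 Subset.rfl
      obtain ⟨A, hA, hAd, hCA⟩ := Δ.pure C.1 C.2.1
      have hvol : 0 < flatVol (flatDim (CellDecomposition.dualFace r C.1))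
          (CellDecomposition.dualFace r C.1) :=
        flatVol_pos
          ((CellDecomposition.finite_image_topCells r C.2.1).isCompact_convexHull ℝ).isBounded
          (Set.Nonempty.intrinsicInterior (convex_convexHull ℝ _)
            ⟨r ⟨A, hA, hAd⟩, subset_convexHull ℝ _ ⟨_, hCA, rfl⟩⟩)
      have hCk := C.2.2
      rw [show flatDim (CellDecomposition.dualFace r C.1) = d - k + 1 by omega,
        ← hpint C s (hs0 s hs) hint r hr] at hvol
      exact left_ne_zero_of_mul hvol.ne'
    · obtain ⟨F, hF⟩ := hpbd C hint
      unfold CellDecomposition.polyMap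
      rw [hF, map_pow, MvPolynomial.eval_X]
      exact pow_ne_zero _ (hs' F)
  · exact CellDecomposition.isDualPolytope_of_pos hG hr (fun F hF => hpos s hs F (h F hF)) hint
  · exact hpint C s (hs0 s hs) (hint.mono hG C.2.1 hGC) r
      (CellDecomposition.isReciprocal_mono hr hGC)
end
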